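/- **Conventions.** Manifolds are smooth, finite-dimensional, Hausdorff and second countable, without boundary. A *vector bundle* is a complex hermitian vector bundle of finite constant rank with a connection respecting the hermitian structure; a *morphism of vector bundles* (over the identity) is a fibrewise linear smooth bundle map that preserves the hermitian structures and the connections (it need not be surjective); a *line bundle* is a vector bundle of rank one. The curvature $\mathrm{curv}(A)$ is normalised to be hermitian, so that $\mathrm{tr}(\mathrm{curv}(A))$ is a real 2-form. Pullbacks along evident projections are not written, and iterated fibre products and tensor products are identified in the canonical way. Let $M$ be a smooth manifold. A *bundle gerbe* $\mathcal G$ over $M$ consists of a surjective submersion $\pi:Y\to M$, a line bundle $L$ over $Y^{[2]}=Y\times_M Y$, a 2-form $C\in\Omega^2(Y)$ and an isomorphism $\mu:\pi_{12}^*L\otimes\pi_{23}^*L\to\pi_{13}^*L$ of line bundles over $Y^{[3]}$, such that $\mathrm{curv}(L)=\pi_2^*C-\pi_1^*C$ and $\mu$ is associative over $Y^{[4]}$. Let $t_\mu:\Delta^*L\to 1$ be the trivialization of $L$ over the diagonal given by $L=L\otimes L\otimes L^*\xrightarrow{\mu\otimes \mathrm{id}}L\otimes L^*=1$. A *1-morphism*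 $\mathcal A:\mathcal G_1\to\mathcal G_2$ consists of a surjective submersion $\zeta:Z\to P:=Y_1\times_M Y_2$, a vector bundle $A$ over $Z$ of rank $n\ge 1$, and an isomorphism $\alpha:L_1\otimes\zeta_2^*A\to\zeta_1^*A\otimes L_2$ of vector bundles over $Z\times_M Z$ (with projections $\zeta_1,\zeta_2$ to $Z$), such that $\frac1n\mathrm{tr}(\mathrm{curv}(A))=C_2-C_1$ and, over $Z\times_M Z\times_M Z$, $\zeta_{13}^*\alpha\circ(\mu_1\otimes\mathrm{id})=(\mathrm{id}\otimes\mu_2)\circ(\zeta_{12}^*\alpha\otimes\mathrm{id})\circ(\mathrm{id}\otimes\zeta_{23}^*\alpha)$. It induces over $Z\times_P Z$ the map $$\mathrm d_{\mathcal A}:\zeta_1^*A\xrightarrow{\mathrm{id}\otimes t_{\mu_2}^{-1}}\zeta_1^*A\otimes L_2\xrightarrow{\alpha^{-1}}L_1\otimes\zeta_2^*A\xrightarrow{t_{\mu_1}\otimes\mathrm{id}}\zeta_2^*A .$$ The *identity* $\mathrm{id}_{\mathcal G}$ is given by $Z=Y^{[2]}$, $\zeta=\mathrm{id}$, the line bundle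 $L$, and $\mu_{124}^{-1}\circ\mu_{134}:L_{13}\otimes L_{34}\to L_{12}\otimes L_{24}$. The *composition* $\mathcal A'\circ\mathcal A:\mathcal G_1\to\mathcal G_3$ of $\mathcal A=(Z,\zeta,A,\alpha):\mathcal G_1\to\mathcal G_2$ and $\mathcal A'=(Z',\zeta',A',\alpha'):\mathcal G_2\to\mathcal G_3$ is given by $\tilde Z=Z\times_{Y_2}Z'$ with the induced map to $Y_1\times_M Y_3$, the vector bundle $A\otimes A'$, and $(\mathrm{id}\otimes\alpha')\circ(\alpha\otimes\mathrm{id})$. A *2-morphism* $\mathcal A_1\Rightarrow\mathcal A_2$ (between 1-morphisms $\mathcal G_1\to\mathcal G_2$) is represented by triples $(W,\omega,\beta_W)$ consisting of a manifold $W$, a surjective submersion $\omega:W\to Z_1\times_P Z_2$ and a morphism $\beta_W:A_1\to A_2$ of vector bundles over $W$, such that $(\omega_1^*\beta_W\otimes 1)\circ\alpha_1=\alpha_2\circ(1\otimes\omega_2^*\beta_W)$ over $W\times_M W$ (with projections $\omega_1,\omega_2$ to $W$). Two triples are related if there are a manifold $X$ and surjective submersions $X\to W$, $X\to W'$, commuting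 with the maps to $Z_1\times_P Z_2$, such that $\beta_W$ and $\beta_{W'}$ coincide on $X$; 2-morphisms are the equivalence classes. The *identity* $\mathrm{id}_{\mathcal A}$ is the class of $(Z\times_P Z,\mathrm{id},\mathrm d_{\mathcal A})$. *Vertical composition* $\beta'\bullet\beta$ is the class of $(W\times_{Z_2}W',\ \cdot\ ,\beta_{W'}\circ\beta_W)$. *Horizontal composition* $\beta_2\circ\beta_1:\mathcal A_2\circ\mathcal A_1\Rightarrow\mathcal A_2'\circ\mathcal A_1'$ is the class of the triple with $W=\tilde Z\times_P(W_1\times_{Y_2}W_2)\times_P\tilde Z'$, where now $P=Y_1\times_M Y_3$, $\tilde Z=Z_1\times_{Y_2}Z_2$, $\tilde Z'=Z_1'\times_{Y_2}Z_2'$, the projection $W\to\tilde Z\times_P\tilde Z'$, and the morphism $\mathrm d_{\mathcal A_2'\circ\mathcal A_1'}\circ(\beta_{W_1}\otimes\beta_{W_2})\circ\mathrm d_{\mathcal A_2\circ\mathcal A_1}$. For $\mathcal A:\mathcal G_1\to\mathcal G_2$ the *unitors* $\lambda_{\mathcal A}:\mathcal A\circ\mathrm{id}_{\mathcal G_1}\Rightarrow\mathcal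 A$ and $\rho_{\mathcal A}:\mathrm{id}_{\mathcal G_2}\circ\mathcal A\Rightarrow\mathcal A$ are the classes of the triples with $W=\tilde Z\times_P Z$, $\omega=\mathrm{id}$, $\tilde Z$ being the space of $\mathcal A\circ\mathrm{id}_{\mathcal G_1}$, respectively $\mathrm{id}_{\mathcal G_2}\circ\mathcal A$, and with the morphisms $$L_1\otimes A\xrightarrow{\alpha}A\otimes L_2\xrightarrow{\mathrm{id}\otimes t_{\mu_2}}A,\qquad A\otimes L_2\xrightarrow{\alpha^{-1}}L_1\otimes A\xrightarrow{t_{\mu_1}\otimes\mathrm{id}}A .$$ **Proposition.** These data are well defined and form a strictly associative 2-category $\mathfrak{BGrb}(M)$. That is: 1. The relation on triples is an equivalence relation; $\mathrm{id}_{\mathcal G}$ and $\mathcal A'\circ\mathcal A$ are 1-morphisms; all triples above represent 2-morphisms, and the classes of the vertical and the horizontal composition depend only on the classes of the factors. 2. 1-morphisms $\mathcal G\to\mathcal H$ and 2-morphisms between them form a category under $\bullet$, and horizontal composition is a functor: $\mathrm{id}_{\mathcal A'}\circ\mathrm{id}_{\mathcal A}=\mathrm{id}_{\mathcal A'\circ\mathcal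 A}$ and $(\beta_2'\bullet\beta_2)\circ(\beta_1'\bullet\beta_1)=(\beta_2'\circ\beta_1')\bullet(\beta_2\circ\beta_1)$. 3. (Strict associativity.) The canonical diffeomorphism $Z\times_{Y_2}(Z'\times_{Y_3}Z'')\cong(Z\times_{Y_2}Z')\times_{Y_3}Z''$ together with $A\otimes(A'\otimes A'')\cong(A\otimes A')\otimes A''$ identifies all data of $(\mathcal A''\circ\mathcal A')\circ\mathcal A$ and $\mathcal A''\circ(\mathcal A'\circ\mathcal A)$. The 2-morphisms $(\mathcal A''\circ\mathcal A')\circ\mathcal A\Rightarrow\mathcal A''\circ(\mathcal A'\circ\mathcal A)$ induced by this identification (it, followed by $\mathrm d_{\mathcal A''\circ(\mathcal A'\circ\mathcal A)}$) are invertible, satisfy the pentagon identity, and are natural in all three arguments, so that under them $(\beta''\circ\beta')\circ\beta=\beta''\circ(\beta'\circ\beta)$. 4. The 2-morphisms $\lambda_{\mathcal A}$ and $\rho_{\mathcal A}$ are invertible and natural in $\mathcal A$: for $\beta:\mathcal A\Rightarrow\mathcal A'$ one has $\lambda_{\mathcal A'}\bullet(\beta\circ\mathrm{id}_{\mathrm{id}})=\beta\bullet\lambda_{\mathcal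 A}$ and $\rho_{\mathcal A'}\bullet(\mathrm{id}_{\mathrm{id}}\circ\beta)=\beta\bullet\rho_{\mathcal A}$. 5. For 1-morphisms $\mathcal A:\mathcal G_1\to\mathcal G_2$ and $\mathcal A':\mathcal G_2\to\mathcal G_3$, one has $\mathrm{id}_{\mathcal A'}\circ\rho_{\mathcal A}=\lambda_{\mathcal A'}\circ\mathrm{id}_{\mathcal A}$ as 2-morphisms from $\mathcal A'\circ\mathrm{id}_{\mathcal G_2}\circ\mathcal A$ to $\mathcal A'\circ\mathcal A$, where the two bracketings of the source are identified by the 2-morphism in 3. -/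

import Mathlib

open Set Filter Topology TensorProduct
open scoped Manifold ContDiff

universe u

noncomputable section

namespace BGrb

/-- A smooth manifold: Hausdorff, second countable, without boundary, modelled on a
finite-dimensional real vector space. -/
structure Mfd : Type (u + 1) where
  carrier : Type u
  E : Type u
  [normed : NormedAddCommGroup E]
  [space : NormedSpace ℝ E]
  [finDim : FiniteDimensional ℝ E]
  [top : TopologicalSpace carrier]
  [charted : ChartedSpace E carrier]
  [smooth : IsManifold 𝓘(ℝ, E) ∞ carrier]
  [t2 : T2Space carrier]
  [sc : SecondCountableTopology carrier]

instance : CoeSort Mfd.{u} (Type u) := ⟨Mfd.carrier⟩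

attribute [instance] Mfd.normed Mfd.space Mfd.finDim Mfd.top Mfd.charted Mfd.smooth Mfd.t2 Mfd.sc

/-- Smooth maps between manifolds. -/
abbrev Smooth {X Y : Mfd.{u}} (f : X → Y) : Prop := ContMDiff 𝓘(ℝ, X.E) 𝓘(ℝ, Y.E) ∞ f

/-- Smoothness at a point. -/
abbrev SmoothAt {X Y : Mfd.{u}} (f : X → Y) (x : X) : Prop :=
  ContMDiffAt 𝓘(ℝ, X.E) 𝓘(ℝ, Y.E) ∞ f x

/-- The tangent space at a point. -/
abbrev Tan {X : Mfd.{u}} (x : X) : Type u := TangentSpace 𝓘(ℝ, X.E) x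

/-- The differential of a map between manifolds. -/
abbrev D {X Y : Mfd.{u}} (f : X → Y) (x : X) :
    Tan x →L[ℝ] Tan (f x) :=
  mfderiv 𝓘(ℝ, X.E) 𝓘(ℝ, Y.E) f x

/-- Surjective submersions. -/
structure SurjSubm {X Y : Mfd.{u}} (f : X → Y) : Prop where
  smooth : Smooth f
  surj : Function.Surjective f
  subm : ∀ x, Function.Surjective (D f x)

/-! ### Submersions in charts -/

lemma exists_adapted_chart {Y M : Mfd.{u}} {g : Y → M} (hg : Smooth g) (y₀ : Y)
    (h : Function.Surjective (D g y₀)) :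
    ∃ Θ : OpenPartialHomeomorph Y
        (M.E × EuclideanSpace ℝ (Fin (Module.finrank ℝ Y.E - Module.finrank ℝ M.E))),
      y₀ ∈ Θ.source ∧
      (∀ y ∈ Θ.source, g y ∈ (chartAt M.E (g y₀)).source ∧
        (Θ y).1 = chartAt M.E (g y₀) (g y)) ∧
      (∀ y ∈ Θ.source, ContMDiffAt 𝓘(ℝ, Y.E) 𝓘(ℝ, M.E × EuclideanSpace ℝ
        (Fin (Module.finrank ℝ Y.E - Module.finrank ℝ M.E))) ∞ Θ y) ∧
      (∀ v ∈ Θ.target, ContMDiffAt 𝓘(ℝ, M.E × EuclideanSpace ℝ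
        (Fin (Module.finrank ℝ Y.E - Module.finrank ℝ M.E))) 𝓘(ℝ, Y.E) ∞ Θ.symm v) := by
  set F := EuclideanSpace ℝ (Fin (Module.finrank ℝ Y.E - Module.finrank ℝ M.E)) with hF
  set cY := chartAt Y.E y₀ with hcY
  set cM := chartAt M.E (g y₀) with hcM
  have hcYa : cY ∈ IsManifold.maximalAtlas 𝓘(ℝ, Y.E) ∞ Y := IsManifold.chart_mem_maximalAtlas y₀
  have hcMa : cM ∈ IsManifold.maximalAtlas 𝓘(ℝ, M.E) ∞ M :=
    IsManifold.chart_mem_maximalAtlas (g y₀)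
  -- the map in charts
  set gh : Y.E → M.E := fun u => cM (g (cY.symm u)) with hgh
  set O : Set Y.E := cY.target ∩ cY.symm ⁻¹' (g ⁻¹' cM.source) with hO
  have hOo : IsOpen O :=
    cY.isOpen_inter_preimage_symm (cM.open_source.preimage hg.continuous)
  have hgs : ∀ u ∈ O, ContDiffAt ℝ ∞ gh u := by
    intro u hu
    rw [← contMDiffAt_iff_contDiffAt]
    have h1 := contMDiffAt_symm_of_mem_maximalAtlas hcYa hu.1
    have h2 := contMDiffAt_of_mem_maximalAtlas hcMa hu.2
    exact ContMDiffAt.comp u h2 ((hg _).comp u h1)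
  set u₀ := cY y₀ with hu₀
  have hu₀O : u₀ ∈ O := by
    refine ⟨mem_chart_target _ _, ?_⟩
    simp [hu₀, hcY, hcM]
  set Lg : Y.E →L[ℝ] M.E := fderiv ℝ gh u₀ with hLg
  have hL : Function.Surjective Lg := by
    have hd : MDifferentiableAt 𝓘(ℝ, Y.E) 𝓘(ℝ, M.E) g y₀ := (hg y₀).mdifferentiableAt (by simp)
    have : D g y₀ = Lg := by
      simp only [D, mfderiv, hd, hLg]
      simp only [mfld_simps, fderivWithin_univ, writtenInExtChartAt]
      rfl
    rw [← this]; exact h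
  -- complement
  obtain ⟨P, hP⟩ : ∃ P : Y.E →L[ℝ] F, ∃ Ψ : Y.E ≃L[ℝ] M.E × F, (Ψ : Y.E →L[ℝ] M.E × F) = Lg.prod P := by
    obtain ⟨K, hK⟩ := Submodule.exists_isCompl (LinearMap.ker Lg.toLinearMap)
    have hr : Module.finrank ℝ (LinearMap.ker Lg.toLinearMap) = Module.finrank ℝ F := by
      have := LinearMap.finrank_range_add_finrank_ker Lg.toLinearMap
      rw [LinearMap.range_eq_top.2 hL, finrank_top] at this
      rw [finrank_euclideanSpace_fin]; omega
    let e := LinearEquiv.ofFinrankEq _ F hr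
    let P0 : Y.E →ₗ[ℝ] F := e.toLinearMap ∘ₗ (Submodule.projectionOnto _ _ hK)
    refine ⟨LinearMap.toContinuousLinearMap P0, ?_⟩
    have hk : LinearMap.ker P0 = K := by
      rw [LinearMap.ker_comp_of_ker_eq_bot _ (LinearEquiv.ker e)]
      exact Submodule.ker_projectionOnto hK
    have hs : LinearMap.range P0 = ⊤ := by
      rw [LinearMap.range_comp, Submodule.range_projectionOnto hK, Submodule.map_top]
      exact LinearEquiv.range e
    let Ψ := LinearMap.equivProdOfSurjectiveOfIsCompl Lg.toLinearMap P0
      (LinearMap.range_eq_top.2 hL) hs (by rw [hk]; exact hK)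
    refine ⟨Ψ.toContinuousLinearEquiv, ?_⟩
    ext x <;> rfl
  obtain ⟨Ψ, hΨ⟩ := hP
  set Φ : Y.E → M.E × F := fun u => (gh u, P u) with hΦ
  have hΦs : ∀ u ∈ O, ContDiffAt ℝ ∞ Φ u := fun u hu =>
    (hgs u hu).prodMk P.contDiff.contDiffAt
  have hΦd : ∀ u ∈ O, fderiv ℝ Φ u = (fderiv ℝ gh u).prod P := by
    intro u hu
    have h1 : HasFDerivAt gh (fderiv ℝ gh u) u :=
      ((hgs u hu).differentiableAt (by simp)).hasFDerivAt
    exact (h1.prodMk P.hasFDerivAt).fderiv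
  have hder : HasFDerivAt Φ (Ψ : Y.E →L[ℝ] M.E × F) u₀ := by
    rw [hΨ, hLg, ← hΦd u₀ hu₀O]
    exact ((hΦs u₀ hu₀O).differentiableAt (by simp)).hasFDerivAt
  let B := (hΦs u₀ hu₀O).toOpenPartialHomeomorph Φ hder (by simp)
  -- the open set where everything is fine
  have hcont : ContinuousOn (fun u => fderiv ℝ Φ u) O := fun u hu =>
    ((hΦs u hu).continuousAt_fderiv (by simp)).continuousWithinAt
  set V : Set Y.E := O ∩ (fun u => fderiv ℝ Φ u) ⁻¹'
    (range ((↑) : (Y.E ≃L[ℝ] M.E × F) → (Y.E →L[ℝ] M.E × F))) with hV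
  have hVo : IsOpen V := hcont.isOpen_inter_preimage hOo ContinuousLinearEquiv.isOpen
  have hu₀V : u₀ ∈ V := ⟨hu₀O, Ψ, hder.fderiv.symm⟩
  let B' := B.restrOpen V hVo
  refine ⟨cY.trans B', ?_, ?_, ?_, ?_⟩
  · simp only [OpenPartialHomeomorph.trans_source, mem_inter_iff, mem_preimage]
    exact ⟨mem_chart_source _ _, ContDiffAt.mem_toOpenPartialHomeomorph_source _ _ _, hu₀V⟩
  · intro y hy
    have hy1 : y ∈ cY.source := hy.1
    have hy2 : cY y ∈ V := hy.2.2
    have h3 := hy2.1.2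
    simp only [mem_preimage, cY.left_inv hy1] at h3
    refine ⟨h3, ?_⟩
    change cM (g (cY.symm (cY y))) = _
    rw [cY.left_inv hy1]
  · intro y hy
    have hy2 : cY y ∈ V := hy.2.2
    have h1 := contMDiffAt_of_mem_maximalAtlas hcYa hy.1
    exact ContMDiffAt.comp (f := cY) (g := Φ) y (hΦs _ hy2.1).contMDiffAt h1
  · intro v hv
    have hv1 : v ∈ B'.target := hv.1
    have hv2 : B'.symm v ∈ cY.target := hv.2
    have hv3 : B'.symm v ∈ V := (B'.map_target hv1).2
    obtain ⟨A, hA⟩ := hv3.2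
    have h1 := contMDiffAt_symm_of_mem_maximalAtlas hcYa hv2
    have h2 : ContDiffAt ℝ ∞ B'.symm v := by
      refine B'.contDiffAt_symm (f₀' := A) hv1 ?_ (hΦs _ hv3.1)
      rw [hA]
      exact ((hΦs _ hv3.1).differentiableAt (by simp)).hasFDerivAt
    exact ContMDiffAt.comp (f := B'.symm) (g := cY.symm) v h1 h2.contMDiffAt


/-! ### Fibre products -/

/-- The set underlying a fibre product. -/
abbrev FPt {X Y S : Mfd.{u}} (f : X → S) (g : Y → S) : Type u := {p : X × Y // f p.1 = g p.2}

/-- The vector space on which the fibre product `X ×_S Y` is modelled. -/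
abbrev FE (X Y S : Mfd.{u}) : Type u :=
  X.E × EuclideanSpace ℝ (Fin (Module.finrank ℝ Y.E - Module.finrank ℝ S.E))

/-- Charts of the subset `X ×_S Y` of `X × Y` that are compatible with the smooth structure of the
product: they are locally restrictions of smooth maps, and their inverses are smooth. -/
structure GoodChart {X Y S : Mfd.{u}} (f : X → S) (g : Y → S)
    (e : OpenPartialHomeomorph (FPt f g) (FE X Y S)) : Prop where
  symm_smooth : ∀ v ∈ e.target, ContMDiffAt 𝓘(ℝ, FE X Y S) (𝓘(ℝ, X.E).prod 𝓘(ℝ, Y.E)) ∞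
    (fun v => (e.symm v).1) v
  smooth : ∀ p ∈ e.source, ∃ ψ : X × Y → FE X Y S,
    ContMDiffAt (𝓘(ℝ, X.E).prod 𝓘(ℝ, Y.E)) 𝓘(ℝ, FE X Y S) ∞ ψ p.1 ∧ ∀ᶠ q in 𝓝 p, ψ q.1 = e q

lemma exists_goodChart {X Y S : Mfd.{u}} {f : X → S} {g : Y → S} (hf : Smooth f)
    (hg : SurjSubm g) (p₀ : FPt f g) : ∃ e, GoodChart f g e ∧ p₀ ∈ e.source := by
  classical
  obtain ⟨Θ, h0, h1, h2, h3⟩ := exists_adapted_chart hg.smooth p₀.1.2 (hg.subm p₀.1.2)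
  set F := EuclideanSpace ℝ (Fin (Module.finrank ℝ Y.E - Module.finrank ℝ S.E)) with hF
  set cX := chartAt X.E p₀.1.1 with hcX
  set cS := chartAt S.E (g p₀.1.2) with hcS
  have hcXa : cX ∈ IsManifold.maximalAtlas 𝓘(ℝ, X.E) ∞ X :=
    IsManifold.chart_mem_maximalAtlas p₀.1.1
  have hcSa : cS ∈ IsManifold.maximalAtlas 𝓘(ℝ, S.E) ∞ S :=
    IsManifold.chart_mem_maximalAtlas (g p₀.1.2)
  set T0 : Set X.E := cX.target ∩ cX.symm ⁻¹' (f ⁻¹' cS.source) with hT0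
  have hT0o : IsOpen T0 :=
    cX.isOpen_inter_preimage_symm (cS.open_source.preimage hf.continuous)
  set m : X.E → S.E := fun u => cS (f (cX.symm u)) with hm
  have hms : ∀ u ∈ T0, ContMDiffAt 𝓘(ℝ, X.E) 𝓘(ℝ, S.E) ∞ m u := by
    intro u hu
    have a1 := contMDiffAt_symm_of_mem_maximalAtlas hcXa hu.1
    have a2 := contMDiffAt_of_mem_maximalAtlas hcSa hu.2
    exact ContMDiffAt.comp (f := fun u => f (cX.symm u)) (g := cS) u a2 ((hf _).comp u a1)
  set k : X.E × F → S.E × F := fun v => (m v.1, v.2) with hk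
  have hks : ∀ v : X.E × F, v.1 ∈ T0 → ContMDiffAt 𝓘(ℝ, X.E × F) 𝓘(ℝ, S.E × F) ∞ k v := by
    intro v hv
    refine ContDiffAt.contMDiffAt (ContDiffAt.prodMk ?_ contDiff_snd.contDiffAt)
    exact (hms v.1 hv).contDiffAt.comp v contDiff_fst.contDiffAt
  set T : Set (X.E × F) := (T0 ×ˢ univ) ∩ k ⁻¹' Θ.target with hT
  have hTo : IsOpen T := ContinuousOn.isOpen_inter_preimage
    (fun v hv => (hks v hv.1).continuousAt.continuousWithinAt) (hT0o.prod isOpen_univ)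
    Θ.open_target
  set i : X.E × F → X × Y := fun v => (cX.symm v.1, Θ.symm (k v)) with hi
  have his : ∀ v ∈ T, ContMDiffAt 𝓘(ℝ, X.E × F) (𝓘(ℝ, X.E).prod 𝓘(ℝ, Y.E)) ∞ i v := by
    intro v hv
    refine ContMDiffAt.prodMk ?_ ?_
    · have b1 : ContMDiffAt 𝓘(ℝ, X.E) 𝓘(ℝ, X.E) ∞ cX.symm v.1 :=
        contMDiffAt_symm_of_mem_maximalAtlas hcXa hv.1.1.1
      have b2 : ContMDiffAt 𝓘(ℝ, X.E × F) 𝓘(ℝ, X.E) ∞ Prod.fst v :=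
        contDiff_fst.contDiffAt.contMDiffAt
      exact b1.comp v b2
    · have b1 : ContMDiffAt 𝓘(ℝ, S.E × F) 𝓘(ℝ, Y.E) ∞ Θ.symm (k v) := h3 _ hv.2
      exact b1.comp v (hks v hv.1.1)
  have himem : ∀ v ∈ T, f (i v).1 = g (i v).2 := by
    intro v hv
    have b1 := h1 _ (Θ.map_target hv.2)
    rw [Θ.right_inv hv.2] at b1
    exact cS.injOn hv.1.1.2 b1.1 b1.2
  set J : X.E × F → FPt f g := fun v => if h : f (i v).1 = g (i v).2 then ⟨i v, h⟩ else p₀ with hJ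
  have hJv : ∀ v ∈ T, (J v).1 = i v := by
    intro v hv; simp only [hJ]; rw [dif_pos (himem v hv)]
  set ψ : X × Y → X.E × F := fun q => (cX q.1, (Θ q.2).2) with hψ
  set O : Set (FPt f g) := {p | p.1.1 ∈ cX.source ∧ p.1.2 ∈ Θ.source} with hO
  have hψs : ∀ q : X × Y, q.1 ∈ cX.source → q.2 ∈ Θ.source →
      ContMDiffAt (𝓘(ℝ, X.E).prod 𝓘(ℝ, Y.E)) 𝓘(ℝ, X.E × F) ∞ ψ q := by
    intro q hq1 hq2
    refine ContMDiffAt.prodMk_space ?_ ?_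
    · have b1 : ContMDiffAt 𝓘(ℝ, X.E) 𝓘(ℝ, X.E) ∞ cX q.1 :=
        contMDiffAt_of_mem_maximalAtlas hcXa hq1
      exact b1.comp q contMDiffAt_fst
    · have b1 : ContMDiffAt 𝓘(ℝ, Y.E) 𝓘(ℝ, S.E × F) ∞ Θ q.2 := h2 _ hq2
      have b2 : ContMDiffAt 𝓘(ℝ, S.E × F) 𝓘(ℝ, F) ∞ Prod.snd (Θ q.2) :=
        contDiff_snd.contDiffAt.contMDiffAt
      exact b2.comp q (b1.comp q contMDiffAt_snd)
  have hkψ : ∀ p ∈ O, k (ψ p.1) = Θ p.1.2 ∧ p.1.1 ∈ cX.source ∧ f p.1.1 ∈ cS.source := by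
    intro p hp
    have b1 := h1 _ hp.2
    refine ⟨Prod.ext ?_ rfl, hp.1, by rw [p.2]; exact b1.1⟩
    simp only [hk, hψ, hm]
    rw [cX.left_inv hp.1, p.2]; exact b1.2.symm
  have hψT : ∀ p ∈ O, ψ p.1 ∈ T := by
    intro p hp
    obtain ⟨b1, b2, b3⟩ := hkψ p hp
    refine ⟨⟨⟨cX.map_source hp.1, ?_⟩, mem_univ _⟩, ?_⟩
    · simp only [hψ, mem_preimage, cX.left_inv hp.1]; exact b3
    · simp only [mem_preimage]; rw [b1]; exact Θ.map_source hp.2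
  have hOo : IsOpen O :=
    (cX.open_source.preimage (continuous_fst.comp continuous_subtype_val)).inter
      (Θ.open_source.preimage (continuous_snd.comp continuous_subtype_val))
  let e : OpenPartialHomeomorph (FPt f g) (FE X Y S) :=
    { toFun := fun p => ψ p.1
      invFun := J
      source := O
      target := T
      map_source' := hψT
      map_target' := fun v hv => by
        simp only [hO, mem_ofPred_eq, hJv v hv]
        exact ⟨cX.map_target hv.1.1.1, Θ.map_target hv.2⟩
      left_inv' := fun p hp => by
        apply Subtype.ext
        rw [hJv _ (hψT p hp)]
        simp only [hi]
        rw [(hkψ p hp).1, Θ.left_inv hp.2]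
        simp only [hψ]
        rw [cX.left_inv hp.1]
      right_inv' := fun v hv => by
        rw [hJv v hv]
        simp only [hψ, hi]
        rw [cX.right_inv hv.1.1.1, Θ.right_inv hv.2]
      open_source := hOo
      open_target := hTo
      continuousOn_toFun := fun p hp =>
        (ContinuousAt.comp (f := Subtype.val) (g := ψ) (hψs p.1 hp.1 hp.2).continuousAt
          continuous_subtype_val.continuousAt).continuousWithinAt
      continuousOn_invFun := by
        refine (Topology.IsInducing.subtypeVal (t := {p : X × Y | f p.1 = g p.2})).continuousOn_iff.2 ?_
        intro v hv
        exact ((his v hv).continuousAt.continuousWithinAt).congr (fun w hw => hJv w hw)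
          (hJv v hv) }
  refine ⟨e, ⟨?_, ?_⟩, ?_⟩
  · intro v hv
    exact (his v hv).congr_of_eventuallyEq
      (Filter.eventuallyEq_of_mem (hTo.mem_nhds hv) fun w hw => hJv w hw)
  · intro p hp
    exact ⟨ψ, hψs p.1 hp.1 hp.2, Filter.Eventually.of_forall fun q => rfl⟩
  · exact ⟨mem_chart_source _ _, h0⟩

/-- The manifold structure of the fibre product, as a submanifold of `X × Y`. -/
@[reducible] def fpCharted {X Y S : Mfd.{u}} {f : X → S} {g : Y → S} (hf : Smooth f)
    (hg : SurjSubm g) : ChartedSpace (FE X Y S) (FPt f g) where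
  atlas := {e | GoodChart f g e}
  chartAt p := (exists_goodChart hf hg p).choose
  mem_chart_source p := (exists_goodChart hf hg p).choose_spec.2
  chart_mem_atlas p := (exists_goodChart hf hg p).choose_spec.1

lemma fpManifold {X Y S : Mfd.{u}} {f : X → S} {g : Y → S} (hf : Smooth f) (hg : SurjSubm g) :
    letI := fpCharted hf hg
    IsManifold 𝓘(ℝ, FE X Y S) ∞ (FPt f g) := by
  let _ := fpCharted hf hg
  refine isManifold_of_contDiffOn _ _ _ ?_
  intro e e' he he'
  have he : GoodChart f g e := he
  have he' : GoodChart f g e' := he'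
  simp only [modelWithCornersSelf_coe, modelWithCornersSelf_coe_symm, Function.comp_id,
    Function.id_comp, preimage_id, range_id, inter_univ]
  intro v hv
  refine ContDiffAt.contDiffWithinAt ?_
  have hv1 : v ∈ e.target := hv.1
  obtain ⟨ψ, hψ, hψe⟩ := he'.smooth (e.symm v) hv.2
  have h1 := ContMDiffAt.comp (f := fun v => (e.symm v).1) (g := ψ) v hψ (he.symm_smooth v hv1)
  rw [← contMDiffAt_iff_contDiffAt]
  refine h1.congr_of_eventuallyEq ?_
  filter_upwards [(e.symm.continuousAt hv1).eventually hψe] with w hw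
  exact hw.symm

/-- The fibre product `X ×_S Y` of a smooth map and a surjective submersion. -/
def fp {X Y S : Mfd.{u}} (f : X → S) (g : Y → S) (hf : Smooth f) (hg : SurjSubm g) : Mfd.{u} :=
  letI := fpCharted hf hg
  haveI := fpManifold hf hg
  { carrier := FPt f g
    E := FE X Y S
    sc := Topology.IsInducing.subtypeVal.secondCountableTopology }

section fp

variable {X Y S : Mfd.{u}} {f : X → S} {g : Y → S} {hf : Smooth f} {hg : SurjSubm g}

/-- A point of the fibre product. -/
def fp.mk (x : X) (y : Y) (h : f x = g y) : fp f g hf hg := ⟨(x, y), h⟩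

/-- The first projection. -/
def pr₁ (p : fp f g hf hg) : X := p.1.1

/-- The second projection. -/
def pr₂ (p : fp f g hf hg) : Y := (show FPt f g from p).1.2

lemma fp.cond (p : fp f g hf hg) : f (pr₁ p) = g (pr₂ p) := (show FPt f g from p).2

lemma fp.ext {p q : fp f g hf hg} (h1 : pr₁ p = pr₁ q) (h2 : pr₂ p = pr₂ q) : p = q :=
  Subtype.ext (Prod.ext h1 h2)

lemma fp.chart_smooth {e : OpenPartialHomeomorph (FPt f g) (FE X Y S)} (he : GoodChart f g e)
    (p : fp f g hf hg) (hp : p ∈ e.source) : ContMDiffAt 𝓘(ℝ, (fp f g hf hg).E)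
      𝓘(ℝ, FE X Y S) ∞ (fun p : fp f g hf hg => e p) p :=
  contMDiffAt_of_mem_maximalAtlas (M := fp f g hf hg) (H := (fp f g hf hg).E)
    (IsManifold.subset_maximalAtlas he) hp

lemma fp.chart_symm_smooth {e : OpenPartialHomeomorph (FPt f g) (FE X Y S)}
    (he : GoodChart f g e) (v : FE X Y S) (hv : v ∈ e.target) : ContMDiffAt 𝓘(ℝ, FE X Y S)
      𝓘(ℝ, (fp f g hf hg).E) ∞ (fun v => (show fp f g hf hg from e.symm v)) v :=
  contMDiffAt_symm_of_mem_maximalAtlas (I := 𝓘(ℝ, (fp f g hf hg).E)) (M := fp f g hf hg)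
    (IsManifold.subset_maximalAtlas he) hv

lemma fp.smooth_val : ContMDiff 𝓘(ℝ, (fp f g hf hg).E) (𝓘(ℝ, X.E).prod 𝓘(ℝ, Y.E)) ∞
    (fun p : fp f g hf hg => (pr₁ p, pr₂ p)) := by
  intro p
  obtain ⟨e, he, hp⟩ := exists_goodChart hf hg p
  have h1 := fp.chart_smooth (hf := hf) (hg := hg) he p hp
  have h2 := (he.symm_smooth _ (e.map_source hp)).comp p h1
  refine h2.congr_of_eventuallyEq ?_
  filter_upwards [e.open_source.mem_nhds hp] with q hq
  simp only [Function.comp, e.left_inv hq]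
  rfl

lemma fp.smooth_fst : Smooth (fun p : fp f g hf hg => pr₁ p) :=
  contMDiff_fst.comp fp.smooth_val

lemma fp.smooth_snd : Smooth (fun p : fp f g hf hg => pr₂ p) :=
  contMDiff_snd.comp fp.smooth_val

/-- A map into the fibre product is smooth as soon as its components are. -/
lemma fp.smoothAt_of {N : Mfd.{u}} {h : N → fp f g hf hg} {n : N}
    (h1 : SmoothAt (fun n => pr₁ (h n)) n) (h2 : SmoothAt (fun n => pr₂ (h n)) n) :
    SmoothAt h n := by
  have hv : ContMDiffAt 𝓘(ℝ, N.E) (𝓘(ℝ, X.E).prod 𝓘(ℝ, Y.E)) ∞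
    (fun n => (pr₁ (h n), pr₂ (h n))) n := h1.prodMk h2
  have hc : ContinuousAt h n :=
    (Topology.IsInducing.subtypeVal (t := {p : X × Y | f p.1 = g p.2})).continuousAt_iff.2
      hv.continuousAt
  obtain ⟨e, he, hp⟩ := exists_goodChart hf hg (h n)
  obtain ⟨ψ, hψ, hψe⟩ := he.smooth (h n) hp
  have h3 := ContMDiffAt.comp (f := fun n => (pr₁ (h n), pr₂ (h n))) (g := ψ) n hψ hv
  have h4 : ContMDiffAt 𝓘(ℝ, N.E) 𝓘(ℝ, FE X Y S) ∞ (fun n => e (h n)) n := by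
    refine h3.congr_of_eventuallyEq ?_
    filter_upwards [hc.eventually hψe] with m hm
    exact hm.symm
  have h5 := fp.chart_symm_smooth (hf := hf) (hg := hg) he _ (e.map_source hp)
  refine (h5.comp n h4).congr_of_eventuallyEq ?_
  filter_upwards [hc.eventually (e.open_source.mem_nhds hp)] with m hm
  exact (e.left_inv hm).symm

lemma fp.smooth_of {N : Mfd.{u}} {h : N → fp f g hf hg}
    (h1 : Smooth (fun n => pr₁ (h n))) (h2 : Smooth (fun n => pr₂ (h n))) : Smooth h :=
  fun n => fp.smoothAt_of (h1 n) (h2 n)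

end fp

/-! ### Stability of surjective submersions -/

lemma SurjSubm.exists_section {X Y : Mfd.{u}} {f : X → Y} (hf : SurjSubm f) (x : X) :
    ∃ s : Y → X, SmoothAt s (f x) ∧ s (f x) = x ∧ ∀ᶠ y in 𝓝 (f x), f (s y) = y := by
  obtain ⟨Θ, h0, h1, h2, h3⟩ := exists_adapted_chart hf.smooth x (hf.subm x)
  set c := chartAt Y.E (f x) with hc
  have hca : c ∈ IsManifold.maximalAtlas 𝓘(ℝ, Y.E) ∞ Y := IsManifold.chart_mem_maximalAtlas (f x)
  have hx : (c (f x), (Θ x).2) = Θ x := Prod.ext (h1 x h0).2.symm rfl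
  have hct := mem_chart_source Y.E (f x)
  have hj : ContMDiffAt 𝓘(ℝ, Y.E) 𝓘(ℝ, Y.E × _) ∞ (fun y => (c y, (Θ x).2)) (f x) :=
    (contMDiffAt_of_mem_maximalAtlas hca hct).prodMk_space contMDiffAt_const
  refine ⟨fun y => Θ.symm (c y, (Θ x).2), ?_, ?_, ?_⟩
  · refine ContMDiffAt.comp (f := fun y => (c y, (Θ x).2)) (g := Θ.symm) (f x) ?_ hj
    rw [hx]; exact h3 _ (Θ.map_source h0)
  · simp only [hx, Θ.left_inv h0]
  · have ht : ∀ᶠ y in 𝓝 (f x), (c y, (Θ x).2) ∈ Θ.target :=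
      hj.continuousAt.eventually (Θ.open_target.mem_nhds (by simp only [hx]; exact Θ.map_source h0))
    filter_upwards [ht, c.open_source.mem_nhds hct] with y hy hys
    have := h1 _ (Θ.map_target hy)
    rw [Θ.right_inv hy] at this
    exact c.injOn this.1 hys this.2.symm

lemma SurjSubm.of_section {X Y : Mfd.{u}} {f : X → Y} (hf : Smooth f)
    (hs : Function.Surjective f)
    (h : ∀ x, ∃ s : Y → X, SmoothAt s (f x) ∧ s (f x) = x ∧ ∀ᶠ y in 𝓝 (f x), f (s y) = y) :
    SurjSubm f := by
  refine ⟨hf, hs, fun x => ?_⟩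
  obtain ⟨s, h1, h2, h3⟩ := h x
  have e1 : D (fun y => f (s y)) (f x) = ContinuousLinearMap.id ℝ Y.E := by
    have : (fun y => f (s y)) =ᶠ[𝓝 (f x)] id := h3
    exact this.mfderiv_eq.trans mfderiv_id
  have e2 : D (fun y => f (s y)) (f x) = (D f (s (f x))).comp (D s (f x)) :=
    mfderiv_comp (f x) ((hf _).mdifferentiableAt (by simp)) (h1.mdifferentiableAt (by simp))
  have e3 : Function.Surjective (D f (s (f x))) := fun v =>
    ⟨_, congrArg (fun L : Y.E →L[ℝ] Y.E => L v) (e2.symm.trans e1)⟩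
  rwa [h2] at e3


lemma SurjSubm.id (X : Mfd.{u}) : SurjSubm (fun x : X => x) :=
  SurjSubm.of_section contMDiff_id Function.surjective_id
    fun _ => ⟨fun y => y, contMDiffAt_id, rfl, Filter.Eventually.of_forall fun _ => rfl⟩

lemma SurjSubm.comp {X Y Z : Mfd.{u}} {g : Y → Z} {f : X → Y} (hg : SurjSubm g)
    (hf : SurjSubm f) : SurjSubm (fun x => g (f x)) := by
  refine ⟨hg.smooth.comp hf.smooth, hg.surj.comp hf.surj, fun x => ?_⟩
  have : D (fun x => g (f x)) x = (D g (f x)).comp (D f x) :=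
    mfderiv_comp x ((hg.smooth _).mdifferentiableAt (by simp))
      ((hf.smooth _).mdifferentiableAt (by simp))
  rw [this]
  exact (hg.subm _).comp (hf.subm _)

section fp

variable {X Y S : Mfd.{u}} {f : X → S} {g : Y → S} {hf : Smooth f} {hg : SurjSubm g}

/-- Local smooth maps into a fibre product. -/
lemma fp.exists_lift {N : Mfd.{u}} {n : N} {a : N → X} {b : N → Y} (p : fp f g hf hg)
    (ha : SmoothAt a n) (hb : SmoothAt b n) (hap : a n = pr₁ p) (hbp : b n = pr₂ p)
    (hab : ∀ᶠ m in 𝓝 n, f (a m) = g (b m)) :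
    ∃ s : N → fp f g hf hg, SmoothAt s n ∧ s n = p ∧
      ∀ᶠ m in 𝓝 n, pr₁ (s m) = a m ∧ pr₂ (s m) = b m := by
  classical
  let s : N → fp f g hf hg := fun m => if h : f (a m) = g (b m) then fp.mk (a m) (b m) h else p
  have hs : ∀ m, f (a m) = g (b m) → pr₁ (s m) = a m ∧ pr₂ (s m) = b m := by
    intro m hm
    simp only [s, dif_pos hm]
    exact ⟨rfl, rfl⟩
  have hev : ∀ᶠ m in 𝓝 n, pr₁ (s m) = a m ∧ pr₂ (s m) = b m := hab.mono hs
  refine ⟨s, fp.smoothAt_of ?_ ?_, ?_, hev⟩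
  · exact ha.congr_of_eventuallyEq (hev.mono fun _ h => h.1)
  · exact hb.congr_of_eventuallyEq (hev.mono fun _ h => h.2)
  · have := hs n hab.self_of_nhds
    exact fp.ext (this.1.trans hap) (this.2.trans hbp)

lemma fp.subm_fst : SurjSubm (fun p : fp f g hf hg => pr₁ p) := by
  refine SurjSubm.of_section fp.smooth_fst ?_ ?_
  · intro x
    obtain ⟨y, hy⟩ := hg.surj (f x)
    exact ⟨fp.mk x y hy.symm, rfl⟩
  · intro p
    obtain ⟨s, h1, h2, h3⟩ := hg.exists_section (pr₂ p)
    rw [← fp.cond p] at h1 h2 h3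
    obtain ⟨t, t1, t2, t3⟩ := fp.exists_lift (n := pr₁ p) (a := fun x => x)
      (b := fun x => s (f x)) p contMDiffAt_id (h1.comp _ (hf _)) rfl h2
      ((hf.continuous.continuousAt.eventually h3).mono fun _ h => h.symm)
    exact ⟨t, t1, t2, t3.mono fun _ h => h.1⟩

lemma fp.subm_snd (hf' : SurjSubm f) : SurjSubm (fun p : fp f g hf hg => pr₂ p) := by
  refine SurjSubm.of_section fp.smooth_snd ?_ ?_
  · intro y
    obtain ⟨x, hx⟩ := hf'.surj (g y)
    exact ⟨fp.mk x y hx, rfl⟩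
  · intro p
    obtain ⟨s, h1, h2, h3⟩ := hf'.exists_section (pr₁ p)
    rw [fp.cond p] at h1 h2 h3
    obtain ⟨t, t1, t2, t3⟩ := fp.exists_lift (n := pr₂ p) (a := fun y => s (g y))
      (b := fun y => y) p (h1.comp _ (hg.smooth _)) contMDiffAt_id h2 rfl
      (hg.smooth.continuous.continuousAt.eventually h3)
    exact ⟨t, t1, t2, t3.mono fun _ h => h.2⟩

end fp


section span

variable {A B C S X X' : Mfd.{u}} {f : A → S} {g : B → S} {h : C → S} {hf : Smooth f}
  {hg : SurjSubm g} {hg' : Smooth g} {hh : SurjSubm h}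

/-- Given `X → A ×_S B` and `X' → B ×_S C`, the induced map `X ×_B X' → A ×_S C`. -/
def spanMap {p : X → fp f g hf hg} {q : X' → fp g h hg' hh}
    {hp : Smooth fun x => pr₂ (p x)} {hq : SurjSubm fun x => pr₁ (q x)}
    (w : fp (fun x => pr₂ (p x)) (fun x => pr₁ (q x)) hp hq) : fp f h hf hh :=
  fp.mk (pr₁ (p (pr₁ w))) (pr₂ (q (pr₂ w)))
    ((fp.cond _).trans ((congrArg g (fp.cond w)).trans (fp.cond _)))

lemma spanMap_subm {p : X → fp f g hf hg} {q : X' → fp g h hg' hh}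
    {hp : Smooth fun x => pr₂ (p x)} {hq : SurjSubm fun x => pr₁ (q x)}
    (hp' : SurjSubm p) (hq' : SurjSubm q) :
    SurjSubm (spanMap (p := p) (q := q) (hp := hp) (hq := hq)) := by
  refine SurjSubm.of_section (fp.smooth_of ?_ ?_) ?_ ?_
  · exact (fp.smooth_fst.comp hp'.smooth).comp fp.smooth_fst
  · exact (fp.smooth_snd.comp hq'.smooth).comp fp.smooth_snd
  · intro r
    obtain ⟨b, hb⟩ := hg.surj (f (pr₁ r))
    obtain ⟨x, hx⟩ := hp'.surj (fp.mk (pr₁ r) b hb.symm)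
    obtain ⟨y, hy⟩ := hq'.surj (fp.mk b (pr₂ r) (hb.trans (fp.cond r)))
    refine ⟨fp.mk x y ?_, fp.ext ?_ ?_⟩
    · simp only [hx, hy]; rfl
    · change pr₁ (p x) = _; rw [hx]; rfl
    · change pr₂ (q y) = _; rw [hy]; rfl
  · intro w
    set r := spanMap w with hr
    -- a local section of `B → S`
    obtain ⟨σ, σ1, σ2, σ3⟩ := hg.exists_section (pr₂ (p (pr₁ w)))
    have e0 : g (pr₂ (p (pr₁ w))) = f (pr₁ r) := (fp.cond _).symm
    rw [e0] at σ1 σ2 σ3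
    have hb : SmoothAt (fun r' : fp f h hf hh => σ (f (pr₁ r'))) r :=
      ContMDiffAt.comp (f := fun r' : fp f h hf hh => f (pr₁ r')) (g := σ) r σ1
        ((hf _).comp r (fp.smooth_fst _))
    have hgb : ∀ᶠ r' : fp f h hf hh in 𝓝 r, g (σ (f (pr₁ r'))) = f (pr₁ r') :=
      (hf.continuous.comp fp.smooth_fst.continuous).continuousAt.eventually σ3
    -- lift to `A ×_S B` and to `B ×_S C`
    obtain ⟨a, a1, a2, a3⟩ := fp.exists_lift (n := r) (p (pr₁ w)) (fp.smooth_fst _) hb rfl σ2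
      (hgb.mono fun _ h => h.symm)
    obtain ⟨c, c1, c2, c3⟩ := fp.exists_lift (n := r) (q (pr₂ w)) hb (fp.smooth_snd _)
      (σ2.trans (fp.cond w)) rfl (hgb.mono fun r' h => h.trans (fp.cond r'))
    obtain ⟨s, s1, s2, s3⟩ := hp'.exists_section (pr₁ w)
    obtain ⟨t, t1, t2, t3⟩ := hq'.exists_section (pr₂ w)
    have sa : ∀ᶠ r' in 𝓝 r, p (s (a r')) = a r' := by
      rw [← a2] at s3; exact a1.continuousAt.eventually s3
    have tc : ∀ᶠ r' in 𝓝 r, q (t (c r')) = c r' := by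
      rw [← c2] at t3; exact c1.continuousAt.eventually t3
    rw [← a2] at s1
    rw [← c2] at t1
    obtain ⟨z, z1, z2, z3⟩ := fp.exists_lift (n := r) (a := fun r' => s (a r'))
      (b := fun r' => t (c r')) w (s1.comp r a1) (t1.comp r c1)
      (by simp only [a2, s2]) (by simp only [c2, t2])
      (by
        filter_upwards [sa, tc, a3, c3] with r' h1 h2 h3 h4
        rw [h1, h2, h3.2, h4.1])
    refine ⟨z, z1, z2, ?_⟩
    filter_upwards [sa, tc, a3, c3, z3] with r' h1 h2 h3 h4 h5
    refine fp.ext ?_ ?_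
    · change pr₁ (p (pr₁ (z r'))) = _; rw [h5.1, h1, h3.1]
    · change pr₂ (q (pr₂ (z r'))) = _; rw [h5.2, h2, h4.2]

/-- The projection `(A ×_S B) ×_S C → A ×_S C`. -/
def outer {hk : Smooth fun p : fp f g hf hg => f (pr₁ p)}
    (w : fp (fun p : fp f g hf hg => f (pr₁ p)) h hk hh) : fp f h hf hh :=
  fp.mk (pr₁ (pr₁ w)) (pr₂ w) (fp.cond w)

lemma outer_subm {hk : Smooth fun p : fp f g hf hg => f (pr₁ p)} :
    SurjSubm (outer (hk := hk) (hh := hh)) := by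
  refine SurjSubm.of_section (fp.smooth_of ?_ ?_) ?_ ?_
  · exact (fp.smooth_fst (hf := hf) (hg := hg)).comp (fp.smooth_fst (hf := hk) (hg := hh))
  · exact fp.smooth_snd
  · intro r
    obtain ⟨b, hb⟩ := hg.surj (f (pr₁ r))
    exact ⟨fp.mk (fp.mk (pr₁ r) b hb.symm) (pr₂ r) (fp.cond r), rfl⟩
  · intro w
    obtain ⟨s, s1, s2, s3⟩ := (fp.subm_fst (f := f) (hf := hf) (hg := hg)).exists_section (pr₁ w)
    set r := outer w with hr
    have hc : ContinuousAt (fun r' : fp f h hf hh => pr₁ r') r :=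
      fp.smooth_fst.continuous.continuousAt
    have s3' : ∀ᶠ r' in 𝓝 r, pr₁ (s (pr₁ r')) = pr₁ r' := hc.eventually s3
    obtain ⟨z, z1, z2, z3⟩ := fp.exists_lift (n := r) (a := fun r' => s (pr₁ r'))
      (b := fun r' => pr₂ r') w (ContMDiffAt.comp (g := s) r s1 (fp.smooth_fst _))
      (fp.smooth_snd _) s2 rfl (s3'.mono fun r' h => by rw [h]; exact fp.cond r')
    refine ⟨z, z1, z2, ?_⟩
    filter_upwards [z3, s3'] with r' h1 h2
    refine fp.ext ?_ ?_
    · change pr₁ (pr₁ (z r')) = _; rw [h1.1, h2]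
    · exact h1.2

end span

/-! ### Hermitian vector bundles with connection -/

/-- The differential of a complex-valued function. -/
def dFun {X : Mfd.{u}} (c : X → ℂ) (x : X) : Tan x →L[ℝ] ℂ := mfderiv 𝓘(ℝ, X.E) 𝓘(ℝ, ℂ) c x

/-- The data of a hermitian vector bundle with connection over `X`: hermitian fibres, an atlas of
local orthonormal frames `frame i` over `dom i`, and the matrices of local connection `1`-forms
`conn i` with respect to these frames, so that `∇ e_b = ∑ₐ e_a ⊗ (conn i a b)` for the frame
`e = frame i` over `dom i`. (The values of `frame i` and `conn i` outside of `dom i` play no role.)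
The axioms are in `HVB.IsVB`. -/
structure HVB (X : Mfd.{u}) where
  fib : X → Type u
  [nacg : ∀ x, NormedAddCommGroup (fib x)]
  [ips : ∀ x, InnerProductSpace ℂ (fib x)]
  κ : Type
  [fintype : Fintype κ]
  [decEq : DecidableEq κ]
  ι : Type u
  dom : ι → Set X
  frame : ι → ∀ x, OrthonormalBasis κ ℂ (fib x)
  conn : ι → κ → κ → ∀ x : X, Tan x →L[ℝ] ℂ

attribute [instance] HVB.nacg HVB.ips HVB.fintype HVB.decEq

namespace HVB

variable {X X' : Mfd.{u}}

/-- The rank. -/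
abbrev rank (E : HVB X) : ℕ := Fintype.card E.κ

/-- Matrix entries of a family of linear maps with respect to the frames `i` of `E` and `j` of
`E'`. -/
def coef (E E' : HVB X) (T : ∀ x, E.fib x →ₗ[ℂ] E'.fib x) (i : E.ι) (j : E'.ι) (a : E'.κ)
    (b : E.κ) (x : X) : ℂ :=
  inner ℂ (E'.frame j x a) (T x (E.frame i x b))

/-- A family of fibrewise linear maps is a morphism of hermitian vector bundles with connection:
it respects the hermitian structures, it is smooth, and it respects the connections, that is
`∇ (T e_b) = T (∇ e_b)`. -/
structure IsMor (E E' : HVB X) (T : ∀ x, E.fib x →ₗ[ℂ] E'.fib x) : Prop where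
  isometry : ∀ x v, ‖T x v‖ = ‖v‖
  smooth : ∀ i j a b, ContMDiffOn 𝓘(ℝ, X.E) 𝓘(ℝ, ℂ) ∞ (coef E E' T i j a b) (E.dom i ∩ E'.dom j)
  parallel : ∀ i j a b, ∀ x ∈ E.dom i ∩ E'.dom j, ∀ v : Tan x,
    dFun (coef E E' T i j a b) x v
        + ∑ c, E'.conn j a c x v * coef E E' T i j c b x
      = ∑ c, coef E E' T i j a c x * E.conn i c b x v

/-- The axioms of a hermitian vector bundle with connection: the frames are defined on an open
cover, the connection forms are smooth and skew-hermitian, and the changes of frames are smooth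
and transform the connection forms into each other. -/
structure IsVB (E : HVB X) : Prop where
  isOpen_dom : ∀ i, IsOpen (E.dom i)
  cover : ∀ x, ∃ i, x ∈ E.dom i
  conn_smooth : ∀ i a b, ContMDiffOn 𝓘(ℝ, X.E).tangent 𝓘(ℝ, ℂ) ∞
    (fun p : TangentBundle 𝓘(ℝ, X.E) X => E.conn i a b p.1 p.2) {p | p.1 ∈ E.dom i}
  conn_skew : ∀ i a b, ∀ x ∈ E.dom i, ∀ v,
    E.conn i a b x v + (starRingEnd ℂ) (E.conn i b a x v) = 0
  compat : IsMor E E (fun _ => LinearMap.id)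

/-- Pullback along a smooth map. -/
@[reducible] def pb (f : X' → X) (E : HVB X) : HVB X' where
  fib x := E.fib (f x)
  κ := E.κ
  ι := E.ι
  dom i := f ⁻¹' E.dom i
  frame i x := E.frame i (f x)
  conn i a b x := (E.conn i a b (f x)).comp (D f x)

/-- Tensor product, with the connection `∇ ⊗ 1 + 1 ⊗ ∇'`. -/
@[reducible] def tensor (E E' : HVB X) : HVB X where
  fib x := E.fib x ⊗[ℂ] E'.fib x
  κ := E.κ × E'.κ
  ι := E.ι × E'.ι
  dom i := E.dom i.1 ∩ E'.dom i.2
  frame i x := (E.frame i.1 x).tensorProduct (E'.frame i.2 x)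
  conn i a b x := (if a.2 = b.2 then E.conn i.1 a.1 b.1 x else 0)
    + (if a.1 = b.1 then E'.conn i.2 a.2 b.2 x else 0)

/-- The identification of the fibres over equal points. -/
def tr (E : HVB X) {x y : X} (h : x = y) : E.fib x ≃ₗ[ℂ] E.fib y :=
  h ▸ LinearEquiv.refl ℂ (E.fib x)

end HVB

/-- The exterior derivative of a complex-valued `1`-form, computed in the chart at `x`. -/
def dForm {X : Mfd.{u}} (θ : ∀ x : X, Tan x →L[ℝ] ℂ) (x : X)
    (v w : Tan x) : ℂ :=
  extDeriv (fun y : X.E => ContinuousAlternatingMap.ofSubsingleton ℝ X.E ℂ (0 : Fin 1)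
    ((θ ((chartAt X.E x).symm y)).comp
      (mfderiv 𝓘(ℝ, X.E) 𝓘(ℝ, X.E) (chartAt X.E x).symm y))) (chartAt X.E x x) ![v, w]

/-- The curvature `F = dω + ω ∧ ω` of the connection, as a matrix in the frame `i`. -/
def HVB.curvMatrix {X : Mfd.{u}} (E : HVB X) (i : E.ι) (a b : E.κ) (x : X)
    (v w : Tan x) : ℂ :=
  dForm (E.conn i a b) x v w
    + ∑ c, (E.conn i a c x v * E.conn i c b x w - E.conn i a c x w * E.conn i c b x v)

/-- The trace of the curvature. Curvatures are normalised to be hermitian, so that traces are real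
`2`-forms: `curv = √-1 · F`. -/
def HVB.trCurv {X : Mfd.{u}} (E : HVB X) (i : E.ι) (x : X)
    (v w : Tan x) : ℂ :=
  Complex.I * ∑ a, E.curvMatrix i a a x v w

/-- Smooth real `2`-forms. -/
structure Form2 (X : Mfd.{u}) where
  toFun : ∀ x : X, Tan x →L[ℝ] Tan x →L[ℝ] ℝ
  alt : ∀ x v, toFun x v v = 0
  smooth : ContMDiff 𝓘(ℝ, X.E) (𝓘(ℝ, X.E).prod 𝓘(ℝ, X.E →L[ℝ] X.E →L[ℝ] ℝ)) ∞
    (fun x => Bundle.TotalSpace.mk' (X.E →L[ℝ] X.E →L[ℝ] ℝ)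
      (E := fun x : X => Tan x →L[ℝ] Tan x →L[ℝ] ℝ)
      x (toFun x))

/-- The value of the pullback `f^* C` at `x`. -/
def Form2.pb {X Y : Mfd.{u}} (C : Form2 Y) (f : X → Y) (x : X)
    (v w : Tan x) : ℝ :=
  C.toFun (f x) (D f x v) (D f x w)

/-! ### Bundle gerbes -/

section fibres

variable {Y M : Mfd.{u}} (π : Y → M) (hπ : SurjSubm π)

/-- `Y^[2] = Y ×_M Y`. -/
abbrev Y2 : Mfd.{u} := fp π π hπ.smooth hπ

/-- `Y^[3] = Y^[2] ×_M Y`. -/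
abbrev Y3 : Mfd.{u} :=
  fp (fun p : Y2 π hπ => π (pr₁ p)) π (hπ.smooth.comp fp.smooth_fst) hπ

variable {π hπ}

/-- `π₁₂ : Y^[3] → Y^[2]`. -/
def pr₁₂ (p : Y3 π hπ) : Y2 π hπ := fp.mk (pr₁ (pr₁ p)) (pr₂ (pr₁ p)) (fp.cond (pr₁ p))

/-- `π₂₃ : Y^[3] → Y^[2]`. -/
def pr₂₃ (p : Y3 π hπ) : Y2 π hπ :=
  fp.mk (pr₂ (pr₁ p)) (pr₂ p) ((fp.cond (pr₁ p)).symm.trans (fp.cond p))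

/-- `π₁₃ : Y^[3] → Y^[2]`. -/
def pr₁₃ (p : Y3 π hπ) : Y2 π hπ := fp.mk (pr₁ (pr₁ p)) (pr₂ p) (fp.cond p)

end fibres

/-- Bundle gerbes over `M`. -/
structure BundleGerbe (M : Mfd.{u}) where
  Y : Mfd.{u}
  π : Y → M
  hπ : SurjSubm π
  L : HVB (Y2 π hπ)
  isVB : L.IsVB
  rank_eq : L.rank = 1
  C : Form2 Y
  μ : ∀ {y₁ y₂ y₃ : Y} (h₁₂ : π y₁ = π y₂) (h₂₃ : π y₂ = π y₃),
    L.fib (fp.mk y₁ y₂ h₁₂) ⊗[ℂ] L.fib (fp.mk y₂ y₃ h₂₃) ≃ₗ[ℂ]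
      L.fib (fp.mk y₁ y₃ (h₁₂.trans h₂₃))
  μ_mor : HVB.IsMor ((L.pb pr₁₂).tensor (L.pb pr₂₃)) (L.pb (pr₁₃ (π := π) (hπ := hπ)))
    (fun p => (μ (fp.cond (pr₁ p)) ((fp.cond (pr₁ p)).symm.trans (fp.cond p))).toLinearMap)
  /-- `curv(L) = π₂^* C - π₁^* C` -/
  curv_eq : ∀ i, ∀ p ∈ L.dom i, ∀ v w, L.trCurv i p v w =
    ((C.pb (pr₂ (hf := hπ.smooth) (hg := hπ)) p v w
      - C.pb (pr₁ (hf := hπ.smooth) (hg := hπ)) p v w : ℝ) : ℂ)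
  /-- `μ` is associative -/
  μ_assoc : ∀ {y₁ y₂ y₃ y₄ : Y} (h₁₂ : π y₁ = π y₂) (h₂₃ : π y₂ = π y₃) (h₃₄ : π y₃ = π y₄)
    (l : L.fib (fp.mk y₁ y₂ h₁₂)) (l' : L.fib (fp.mk y₂ y₃ h₂₃)) (l'' : L.fib (fp.mk y₃ y₄ h₃₄)),
    μ (h₁₂.trans h₂₃) h₃₄ (μ h₁₂ h₂₃ (l ⊗ₜ l') ⊗ₜ l'')
      = μ h₁₂ (h₂₃.trans h₃₄) (l ⊗ₜ μ h₂₃ h₃₄ (l' ⊗ₜ l''))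

namespace BundleGerbe

variable {M : Mfd.{u}} (G : BundleGerbe M)

/-- The fibre of `L` over `(y, y')`. -/
abbrev Lf (y y' : G.Y) (h : G.π y = G.π y') : Type u :=
  G.L.fib (fp.mk y y' h : Y2 G.π G.hπ)

/-- The identification of fibres of `L` over equal points. -/
def cast {y₁ y₁' y₂ y₂' : G.Y} {h : G.π y₁ = G.π y₁'} {h' : G.π y₂ = G.π y₂'} (e : y₁ = y₂)
    (e' : y₁' = y₂') : G.Lf y₁ y₁' h ≃ₗ[ℂ] G.Lf y₂ y₂' h' :=
  G.L.tr (fp.ext e e')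

/-- The linear map `t_μ` on the fibre `L_{(y,y)}`, given by `L = L ⊗ L ⊗ L^* → L ⊗ L^* = 1`: the
trace of the endomorphism `x ↦ μ(l ⊗ x)`. -/
def tLin (y : G.Y) : G.Lf y y rfl →ₗ[ℂ] ℂ :=
  (LinearMap.trace ℂ (G.Lf y y rfl)).comp (TensorProduct.curry (G.μ (y₁ := y) rfl rfl).toLinearMap)

lemma tLin_bijective (y : G.Y) : Function.Bijective (G.tLin y) := by
  obtain ⟨i, -⟩ := G.isVB.cover (fp.mk y y rfl)
  let b := (G.L.frame i (fp.mk y y rfl)).toBasis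
  have hfr : Module.finrank ℂ (G.Lf y y rfl) = 1 := by
    rw [Module.finrank_eq_card_basis b]; exact G.rank_eq
  have : Module.Finite ℂ (G.Lf y y rfl) := Module.Finite.of_basis b
  have hinj : Function.Injective (G.tLin y) := by
    rw [injective_iff_map_eq_zero]
    intro l hl
    by_contra hne
    -- `l` spans the fibre
    obtain ⟨c, hc⟩ := (finrank_eq_one_iff_of_nonzero' l hne).1 hfr (G.μ rfl rfl (l ⊗ₜ l))
    have hend : TensorProduct.curry (G.μ (y₁ := y) rfl rfl).toLinearMap l = c • LinearMap.id := by
      refine LinearMap.ext fun x => ?_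
      obtain ⟨d, rfl⟩ := (finrank_eq_one_iff_of_nonzero' l hne).1 hfr x
      rw [map_smul]
      simp only [LinearMap.smul_apply, LinearMap.id_apply, TensorProduct.curry_apply]
      rw [smul_comm c d l, hc]; rfl
    have ht : G.tLin y l = c := by
      simp only [tLin, LinearMap.comp_apply, hend, map_smul, LinearMap.trace_id, hfr]
      simp
    rw [ht] at hl
    rw [hl, zero_smul] at hc
    have h0 : (l ⊗ₜ[ℂ] l : G.Lf y y rfl ⊗[ℂ] G.Lf y y rfl) = 0 :=
      (G.μ (y₁ := y) (y₂ := y) (y₃ := y) rfl rfl).injective (hc.symm.trans (map_zero _).symm)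
    have h1 : ‖(l ⊗ₜ[ℂ] l : G.Lf y y rfl ⊗[ℂ] G.Lf y y rfl)‖ = 0 := by rw [h0, norm_zero]
    rw [TensorProduct.norm_tmul] at h1
    exact hne (norm_eq_zero.1 (mul_self_eq_zero.1 h1))
  exact ⟨hinj, (LinearMap.injective_iff_surjective_of_finrank_eq_finrank
    (by rw [hfr, Module.finrank_self])).1 hinj⟩

/-- The canonical trivialization `t_μ` of the line bundle `L` over the diagonal. -/
def t {y y' : G.Y} (e : y = y') (h : G.π y = G.π y') : G.Lf y y' h ≃ₗ[ℂ] ℂ :=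
  (G.cast rfl e.symm).trans (LinearEquiv.ofBijective (G.tLin y) (G.tLin_bijective y))

end BundleGerbe

/-! ### 1-morphisms -/

section base

variable {M : Mfd.{u}} {G₁ G₂ : BundleGerbe M}

/-- `Y₁ ×_M Y₂`. -/
abbrev P (G₁ G₂ : BundleGerbe M) : Mfd.{u} := fp G₁.π G₂.π G₁.hπ.smooth G₂.hπ

/-- The map `Y₁ ×_M Y₂ → M`. -/
def toM (p : P G₁ G₂) : M := G₁.π (pr₁ p)

lemma toM_subm : SurjSubm (toM : P G₁ G₂ → M) := G₁.hπ.comp fp.subm_fst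

lemma π_pr₂ {p q : P G₁ G₂} (h : toM p = toM q) : G₂.π (pr₂ p) = G₂.π (pr₂ q) :=
  (fp.cond p).symm.trans (h.trans (fp.cond q))

end base

/-- The data of a 1-morphism `G₁ → G₂`; the axioms are in `OneMorData.IsOneMor`. -/
structure OneMorData {M : Mfd.{u}} (G₁ G₂ : BundleGerbe M) where
  Z : Mfd.{u}
  ζ : Z → P G₁ G₂
  hζ : SurjSubm ζ
  A : HVB Z
  α : ∀ {z z' : Z} (h : toM (ζ z) = toM (ζ z')),
    G₁.Lf (pr₁ (ζ z)) (pr₁ (ζ z')) h ⊗[ℂ] A.fib z' ≃ₗ[ℂ]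
      A.fib z ⊗[ℂ] G₂.Lf (pr₂ (ζ z)) (pr₂ (ζ z')) (π_pr₂ h)

namespace OneMorData

variable {M : Mfd.{u}} {G₁ G₂ G₃ G₄ : BundleGerbe M}

/-- The projection `Z → Y₁`. -/
def src (D : OneMorData G₁ G₂) (z : D.Z) : G₁.Y := pr₁ (D.ζ z)

/-- The projection `Z → Y₂`. -/
def tgt (D : OneMorData G₁ G₂) (z : D.Z) : G₂.Y := pr₂ (D.ζ z)

/-- The projection `Z → M`. -/
def base (D : OneMorData G₁ G₂) (z : D.Z) : M := toM (D.ζ z)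

lemma src_subm (D : OneMorData G₁ G₂) : SurjSubm D.src :=
  (fp.subm_fst (hf := G₁.hπ.smooth) (hg := G₂.hπ)).comp D.hζ

lemma tgt_subm (D : OneMorData G₁ G₂) : SurjSubm D.tgt :=
  (fp.subm_snd (hf := G₁.hπ.smooth) (hg := G₂.hπ) G₁.hπ).comp D.hζ

lemma base_subm (D : OneMorData G₁ G₂) : SurjSubm D.base := toM_subm.comp D.hζ

lemma base_tgt (D : OneMorData G₁ G₂) (z : D.Z) : D.base z = G₂.π (D.tgt z) := fp.cond (D.ζ z)

/-- `Z ×_M Z`. -/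
abbrev ZZ (D : OneMorData G₁ G₂) : Mfd.{u} := fp D.base D.base D.base_subm.smooth D.base_subm

/-- The induced map `Z ×_M Z → Y₁^[2]`. -/
def src₂ (D : OneMorData G₁ G₂) (p : D.ZZ) : Y2 G₁.π G₁.hπ :=
  fp.mk (D.src (pr₁ p)) (D.src (pr₂ p)) (fp.cond p)

/-- The induced map `Z ×_M Z → Y₂^[2]`. -/
def tgt₂ (D : OneMorData G₁ G₂) (p : D.ZZ) : Y2 G₂.π G₂.hπ :=
  fp.mk (D.tgt (pr₁ p)) (D.tgt (pr₂ p)) (π_pr₂ (fp.cond p))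

/-- The axioms of a 1-morphism. -/
structure IsOneMor (D : OneMorData G₁ G₂) : Prop where
  isVB : D.A.IsVB
  rank_pos : 0 < D.A.rank
  /-- `α` is an isomorphism `L₁ ⊗ ζ₂^* A → ζ₁^* A ⊗ L₂` of hermitian vector bundles with
  connection over `Z ×_M Z` -/
  α_mor : HVB.IsMor ((G₁.L.pb D.src₂).tensor (D.A.pb pr₂)) ((D.A.pb pr₁).tensor (G₂.L.pb D.tgt₂))
    (fun p => (D.α (fp.cond p)).toLinearMap)
  /-- `tr(curv(A)) / n = C₂ - C₁`, where `n` is the rank of `A` -/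
  curv_eq : ∀ i, ∀ z ∈ D.A.dom i, ∀ v w, (1 / (D.A.rank : ℂ)) * D.A.trCurv i z v w =
    ((G₂.C.pb D.tgt z v w - G₁.C.pb D.src z v w : ℝ) : ℂ)
  /-- `α` is compatible with `μ₁` and `μ₂` over `Z ×_M Z ×_M Z` -/
  α_μ : ∀ {z₁ z₂ z₃ : D.Z} (h₁₂ : D.base z₁ = D.base z₂) (h₂₃ : D.base z₂ = D.base z₃)
    (l : G₁.Lf (D.src z₁) (D.src z₂) h₁₂) (l' : G₁.Lf (D.src z₂) (D.src z₃) h₂₃)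
    (a : D.A.fib z₃),
    D.α (h₁₂.trans h₂₃) (G₁.μ h₁₂ h₂₃ (l ⊗ₜ l') ⊗ₜ a)
      = (G₂.μ (π_pr₂ h₁₂) (π_pr₂ h₂₃)).lTensor _ (TensorProduct.assoc ℂ _ _ _
          ((D.α h₁₂).rTensor _ ((TensorProduct.assoc ℂ _ _ _).symm (l ⊗ₜ D.α h₂₃ (l' ⊗ₜ a)))))

/-- The isomorphism `d_A : ζ₁^* A → ζ₂^* A` over `Z ×_P Z`:
`A = A ⊗ L₂ → L₁ ⊗ A = A`, using `t_μ` for `G₁` and `G₂` and the inverse of `α`. -/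
def d (D : OneMorData G₁ G₂) {z z' : D.Z} (h : D.ζ z = D.ζ z') : D.A.fib z ≃ₗ[ℂ] D.A.fib z' :=
  (TensorProduct.rid ℂ _).symm ≪≫ₗ
    (G₂.t (congrArg pr₂ h) (π_pr₂ (congrArg toM h))).symm.lTensor _ ≪≫ₗ
    (D.α (congrArg toM h)).symm ≪≫ₗ
    (G₁.t (congrArg pr₁ h) (congrArg toM h)).rTensor _ ≪≫ₗ
    TensorProduct.lid ℂ _

/-- The identity 1-morphism of `G`: the line bundle `L` over `Y^[2]`, and
`μ₁₂₄⁻¹ ∘ μ₁₃₄ : L₁₃ ⊗ L₃₄ → L₁₂ ⊗ L₂₄`. -/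
def one (G : BundleGerbe M) : OneMorData G G where
  Z := Y2 G.π G.hπ
  ζ := fun p => p
  hζ := SurjSubm.id _
  A := G.L
  α := fun {p q} h => (G.μ (y₁ := pr₁ p) (y₂ := pr₁ q) (y₃ := pr₂ q) h (fp.cond q)) ≪≫ₗ
    (G.μ (y₁ := pr₁ p) (y₂ := pr₂ p) (y₃ := pr₂ q) (fp.cond p) (π_pr₂ (G₁ := G) (G₂ := G) h)).symm

/-- The manifold `Z ×_{Y₂} Z'` of a composed 1-morphism. -/
abbrev compZ (D' : OneMorData G₂ G₃) (D : OneMorData G₁ G₂) : Mfd.{u} :=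
  fp D.tgt D'.src D.tgt_subm.smooth D'.src_subm

/-- The map `Z ×_{Y₂} Z' → Y₁ ×_M Y₃`. -/
def compζ (D' : OneMorData G₂ G₃) (D : OneMorData G₁ G₂) : compZ D' D → P G₁ G₃ :=
  spanMap (p := D.ζ) (q := D'.ζ)

/-- The composition `D' ∘ D` of 1-morphisms: the vector bundle `A ⊗ A'` over `Z ×_{Y₂} Z'`, and
`(1 ⊗ α') ∘ (α ⊗ 1)`. -/
def comp (D' : OneMorData G₂ G₃) (D : OneMorData G₁ G₂) : OneMorData G₁ G₃ where
  Z := compZ D' D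
  ζ := compζ D' D
  hζ := spanMap_subm D.hζ D'.hζ
  A := (D.A.pb pr₁).tensor (D'.A.pb pr₂)
  α := fun {p q} h =>
    have h₁ : D.base (pr₁ p) = D.base (pr₁ q) := h
    have h₂ : D'.base (pr₂ p) = D'.base (pr₂ q) :=
      (congrArg G₂.π (fp.cond p)).symm.trans ((π_pr₂ h₁).trans (congrArg G₂.π (fp.cond q)))
    (TensorProduct.assoc ℂ _ _ _).symm ≪≫ₗ
      (D.α h₁).rTensor _ ≪≫ₗ
      TensorProduct.assoc ℂ _ _ _ ≪≫ₗ
      ((G₂.cast (h' := h₂) (fp.cond p) (fp.cond q)).rTensor _).lTensor _ ≪≫ₗ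
      (D'.α h₂).lTensor _ ≪≫ₗ
      (TensorProduct.assoc ℂ _ _ _).symm

end OneMorData

/-- 1-morphisms of bundle gerbes. -/
def OneMor {M : Mfd.{u}} (G₁ G₂ : BundleGerbe M) : Type (u + 1) :=
  {D : OneMorData G₁ G₂ // D.IsOneMor}

/-! ### 2-morphisms -/

section

variable {M : Mfd.{u}} {G₁ G₂ G₃ G₄ : BundleGerbe M}

/-- `Z₁ ×_P Z₂`, where `P = Y₁ ×_M Y₂`. -/
abbrev ZPZ (D D' : OneMorData G₁ G₂) : Mfd.{u} := fp D.ζ D'.ζ D.hζ.smooth D'.hζ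

/-- Triples `(W, ω, β_W)` representing 2-morphisms; the axioms are in `Triple.IsTwoMor`. -/
structure Triple (D D' : OneMorData G₁ G₂) where
  W : Mfd.{u}
  om : W → ZPZ D D'
  om_subm : SurjSubm om
  β : ∀ w, D.A.fib (pr₁ (om w)) →ₗ[ℂ] D'.A.fib (pr₂ (om w))

namespace Triple

variable {D D' D'' : OneMorData G₁ G₂}

/-- `β_W` is a morphism of hermitian vector bundles with connection over `W`, and it
is compatible with `α₁` and `α₂` over `W ×_M W`. -/
structure IsTwoMor (T : Triple D D') : Prop where
  isMor : HVB.IsMor (D.A.pb fun w => pr₁ (T.om w)) (D'.A.pb fun w => pr₂ (T.om w)) T.β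
  comm : ∀ {w w' : T.W} (h : D.base (pr₁ (T.om w)) = D.base (pr₁ (T.om w')))
    (h' : D'.base (pr₂ (T.om w)) = D'.base (pr₂ (T.om w')))
    (l : G₁.Lf (D.src (pr₁ (T.om w))) (D.src (pr₁ (T.om w'))) h)
    (a : D.A.fib (pr₁ (T.om w'))),
    TensorProduct.map (T.β w) (G₂.cast (h' := π_pr₂ h') (congrArg pr₂ (fp.cond (T.om w)))
        (congrArg pr₂ (fp.cond (T.om w')))).toLinearMap (D.α h (l ⊗ₜ a))
      = D'.α h' (G₁.cast (congrArg pr₁ (fp.cond (T.om w))) (congrArg pr₁ (fp.cond (T.om w'))) l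
          ⊗ₜ T.β w' a)

/-- The equivalence of triples: their pullbacks to some `X` with surjective submersions to `W` and
`W'` over `Z₁ ×_P Z₂` coincide. -/
def Rel (T T' : Triple D D') : Prop :=
  ∃ (X : Mfd.{u}) (r : X → T.W) (r' : X → T'.W) (_ : SurjSubm r) (_ : SurjSubm r')
    (h : ∀ x, T.om (r x) = T'.om (r' x)),
    ∀ x a, T'.β (r' x) (D.A.tr (congrArg pr₁ (h x)) a)
      = D'.A.tr (congrArg pr₂ (h x)) (T.β (r x) a)

/-- The identity: `(Z ×_P Z, id, d_A)`. -/
def one (D : OneMorData G₁ G₂) : Triple D D where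
  W := ZPZ D D
  om := fun w => w
  om_subm := SurjSubm.id _
  β := fun w => (D.d (fp.cond w)).toLinearMap

/-- Vertical composition `T' • T`: the composition `β_{W'} ∘ β_W` over `W ×_{Z₂} W'`. -/
def vcomp (T' : Triple D' D'') (T : Triple D D') : Triple D D'' where
  W := fp (fun w => pr₂ (T.om w)) (fun w => pr₁ (T'.om w)) (fp.smooth_snd.comp T.om_subm.smooth)
    (fp.subm_fst.comp T'.om_subm)
  om := spanMap
  om_subm := spanMap_subm T.om_subm T'.om_subm
  β := fun w => T'.β (pr₂ w) ∘ₗ (D'.A.tr (fp.cond w)).toLinearMap ∘ₗ T.β (pr₁ w)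

/-- The map `W → Z₁ ×_P Z₂ → P`. -/
def toP (T : Triple D D') (w : T.W) : P G₁ G₂ := D.ζ (pr₁ (T.om w))

lemma toP_subm (T : Triple D D') : SurjSubm T.toP := D.hζ.comp (fp.subm_fst.comp T.om_subm)

section hcomp

variable {D₁ D₁' : OneMorData G₁ G₂} {D₂ D₂' : OneMorData G₂ G₃}
  (T₂ : Triple D₂ D₂') (T₁ : Triple D₁ D₁')

/-- `W₁ ×_{Y₂} W₂`. -/
abbrev W₁₂ : Mfd.{u} := fp (fun w => pr₂ (T₁.toP w)) (fun w => pr₁ (T₂.toP w))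
  (fp.smooth_snd.comp T₁.toP_subm.smooth) (fp.subm_fst.comp T₂.toP_subm)

/-- The map `W₁ ×_{Y₂} W₂ → Y₁ ×_M Y₃`. -/
def toP₁₃ : W₁₂ T₂ T₁ → P G₁ G₃ := spanMap

lemma toP₁₃_subm : SurjSubm (toP₁₃ T₂ T₁) := spanMap_subm T₁.toP_subm T₂.toP_subm

/-- The map `u : W₁ ×_{Y₂} W₂ → Z₁ ×_{Y₂} Z₂`. -/
def uMap (w : W₁₂ T₂ T₁) : (D₂.comp D₁).Z :=
  fp.mk (pr₁ (T₁.om (pr₁ w))) (pr₁ (T₂.om (pr₂ w))) (fp.cond w)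

/-- The map `u' : W₁ ×_{Y₂} W₂ → Z₁' ×_{Y₂} Z₂'`. -/
def uMap' (w : W₁₂ T₂ T₁) : (D₂'.comp D₁').Z :=
  fp.mk (pr₂ (T₁.om (pr₁ w))) (pr₂ (T₂.om (pr₂ w)))
    ((congrArg pr₂ (fp.cond (T₁.om (pr₁ w)))).symm.trans
      ((fp.cond w).trans (congrArg pr₁ (fp.cond (T₂.om (pr₂ w))))))

lemma ζ_uMap (w : W₁₂ T₂ T₁) : (D₂.comp D₁).ζ (uMap T₂ T₁ w) = toP₁₃ T₂ T₁ w := rfl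

lemma ζ_uMap' (w : W₁₂ T₂ T₁) : (D₂'.comp D₁').ζ (uMap' T₂ T₁ w) = toP₁₃ T₂ T₁ w :=
  fp.ext (congrArg pr₁ (fp.cond (T₁.om (pr₁ w)))).symm
    (congrArg pr₂ (fp.cond (T₂.om (pr₂ w)))).symm

/-- Horizontal composition `T₂ ∘ T₁`: over `W = Z̃ ×_P (W₁ ×_{Y₂} W₂) ×_P Z̃'`, the morphism
`d ∘ (β₁ ⊗ β₂) ∘ d`. -/
def hcomp : Triple (D₂.comp D₁) (D₂'.comp D₁') where
  W := fp
    (fun p : fp (D₂.comp D₁).ζ (toP₁₃ T₂ T₁) (D₂.comp D₁).hζ.smooth (toP₁₃_subm T₂ T₁) =>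
      (D₂.comp D₁).ζ (pr₁ p))
    (D₂'.comp D₁').ζ ((D₂.comp D₁).hζ.smooth.comp fp.smooth_fst) (D₂'.comp D₁').hζ
  om := outer
  om_subm := outer_subm
  β := fun w =>
    ((D₂'.comp D₁').d (z := uMap' T₂ T₁ (pr₂ (pr₁ w))) (z' := pr₂ w)
        ((ζ_uMap' T₂ T₁ _).trans ((fp.cond (pr₁ w)).symm.trans (fp.cond w)))).toLinearMap ∘ₗ
      TensorProduct.map (T₁.β (pr₁ (pr₂ (pr₁ w)))) (T₂.β (pr₂ (pr₂ (pr₁ w)))) ∘ₗ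
      ((D₂.comp D₁).d (z := pr₁ (pr₁ w)) (z' := uMap T₂ T₁ (pr₂ (pr₁ w)))
        (fp.cond (pr₁ w))).toLinearMap

end hcomp

/-- The triple representing `λ_A : A ∘ id ⇒ A`. -/
def lam (D : OneMorData G₁ G₂) : Triple (D.comp (OneMorData.one G₁)) D where
  W := ZPZ (D.comp (OneMorData.one G₁)) D
  om := fun w => w
  om_subm := SurjSubm.id _
  β := fun w =>
    have e : (D.comp (OneMorData.one G₁)).ζ (pr₁ w) = D.ζ (pr₂ w) := fp.cond w
    have h : D.base (pr₂ w) = D.base (pr₂ (pr₁ w)) :=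
      (congrArg toM e).symm.trans ((fp.cond (pr₁ (pr₁ w))).trans
        (congrArg G₁.π (fp.cond (pr₁ w))))
    have e₂ : D.tgt (pr₂ w) = D.tgt (pr₂ (pr₁ w)) := (congrArg pr₂ e).symm
    ((G₁.cast (h' := h) (congrArg pr₁ e) (fp.cond (pr₁ w))).rTensor (D.A.fib (pr₂ (pr₁ w))) ≪≫ₗ
      D.α h ≪≫ₗ
      (G₂.t e₂ (π_pr₂ h)).lTensor _ ≪≫ₗ
      TensorProduct.rid ℂ _).toLinearMap

/-- The triple representing `ρ_A : id ∘ A ⇒ A`. -/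
def rho (D : OneMorData G₁ G₂) : Triple ((OneMorData.one G₂).comp D) D where
  W := ZPZ ((OneMorData.one G₂).comp D) D
  om := fun w => w
  om_subm := SurjSubm.id _
  β := fun w =>
    have e : ((OneMorData.one G₂).comp D).ζ (pr₁ w) = D.ζ (pr₂ w) := fp.cond w
    have e₁ : D.src (pr₁ (pr₁ w)) = D.src (pr₂ w) :=
      (congrArg (fun p : P G₁ G₂ => pr₁ p) e :)
    have h : D.base (pr₁ (pr₁ w)) = D.base (pr₂ w) := congrArg G₁.π e₁
    ((G₂.cast (h' := π_pr₂ h) (fp.cond (pr₁ w)).symm (congrArg pr₂ e)).lTensor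
        (D.A.fib (pr₁ (pr₁ w))) ≪≫ₗ
      (D.α h).symm ≪≫ₗ
      (G₁.t e₁ h).rTensor _ ≪≫ₗ
      TensorProduct.lid ℂ _).toLinearMap

end Triple

end

/-! ### Strict isomorphisms and the associator -/

/-- An isomorphism of the data of 1-morphisms on the nose: a diffeomorphism `f : Z → Z'` over
`Y₁ ×_M Y₂`, and an isomorphism `φ : A → f^* A'` of hermitian vector bundles with connection that
intertwines `α` and `α'`. -/
structure IsStrictIso {M : Mfd.{u}} {G₁ G₂ : BundleGerbe M} (D D' : OneMorData G₁ G₂)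
    (f : D.Z → D'.Z) (φ : ∀ z, D.A.fib z ≃ₗ[ℂ] D'.A.fib (f z)) : Prop where
  smooth : Smooth f
  inverse : ∃ g : D'.Z → D.Z, Smooth g ∧ Function.LeftInverse g f ∧ Function.RightInverse g f
  over_P : ∀ z, D'.ζ (f z) = D.ζ z
  isMor : HVB.IsMor D.A (D'.A.pb f) (fun z => (φ z).toLinearMap)
  comm : ∀ {z z' : D.Z} (h : D.base z = D.base z') (h' : D'.base (f z) = D'.base (f z'))
    (l : G₁.Lf (D.src z) (D.src z') h) (a : D.A.fib z'),
    D'.α h' (G₁.cast (congrArg (fun p : P G₁ G₂ => pr₁ p) (over_P z).symm)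
        (congrArg (fun p : P G₁ G₂ => pr₁ p) (over_P z').symm) l ⊗ₜ φ z' a)
      = TensorProduct.map (φ z).toLinearMap (G₂.cast (h' := π_pr₂ h')
          (congrArg (fun p : P G₁ G₂ => pr₂ p) (over_P z).symm)
          (congrArg (fun p : P G₁ G₂ => pr₂ p) (over_P z').symm)).toLinearMap (D.α h (l ⊗ₜ a))

section

variable {M : Mfd.{u}} {G₁ G₂ G₃ G₄ : BundleGerbe M}

/-- The canonical identification `Z ×_{Y₂} (Z' ×_{Y₃} Z'') → (Z ×_{Y₂} Z') ×_{Y₃} Z''`. -/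
def assocMap (D'' : OneMorData G₃ G₄) (D' : OneMorData G₂ G₃) (D : OneMorData G₁ G₂)
    (z : ((D''.comp D').comp D).Z) : (D''.comp (D'.comp D)).Z :=
  fp.mk (fp.mk (pr₁ z) (pr₁ (pr₂ z)) (fp.cond z) : (D'.comp D).Z) (pr₂ (pr₂ z))
    (fp.cond (pr₂ z))

/-- The canonical identification `A ⊗ (A' ⊗ A'') → (A ⊗ A') ⊗ A''`. -/
def assocFib (D'' : OneMorData G₃ G₄) (D' : OneMorData G₂ G₃) (D : OneMorData G₁ G₂)
    (z : ((D''.comp D').comp D).Z) :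
    ((D''.comp D').comp D).A.fib z ≃ₗ[ℂ] (D''.comp (D'.comp D)).A.fib (assocMap D'' D' D z) :=
  (TensorProduct.assoc ℂ (D.A.fib (pr₁ z)) (D'.A.fib (pr₁ (pr₂ z)))
    (D''.A.fib (pr₂ (pr₂ z)))).symm

/-- The triple representing the 2-morphism `(D'' ∘ D') ∘ D ⇒ D'' ∘ (D' ∘ D)` that is induced by the
canonical identifications; under these it is the identity 2-morphism. -/
def Triple.assoc (D'' : OneMorData G₃ G₄) (D' : OneMorData G₂ G₃) (D : OneMorData G₁ G₂) :
    Triple ((D''.comp D').comp D) (D''.comp (D'.comp D)) where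
  W := ZPZ ((D''.comp D').comp D) (D''.comp (D'.comp D))
  om := fun w => w
  om_subm := SurjSubm.id _
  β := fun w => ((D''.comp (D'.comp D)).d (z := assocMap D'' D' D (pr₁ w)) (z' := pr₂ w)
      (fp.cond w)).toLinearMap ∘ₗ (assocFib D'' D' D (pr₁ w)).toLinearMap

/-! ### 2-morphisms as equivalence classes -/

/-- 2-morphisms: equivalence classes of triples. -/
def TwoMor (A A' : OneMor G₁ G₂) : Type (u + 1) :=
  Quot fun T T' : {T : Triple A.1 A'.1 // T.IsTwoMor} => T.1.Rel T'.1

/-- The triple `T` satisfies the axioms of a 2-morphism and represents the 2-morphism `b`. -/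
def Rep {A A' : OneMor G₁ G₂} (b : TwoMor A A') (T : Triple A.1 A'.1) : Prop :=
  ∃ h : T.IsTwoMor, b = Quot.mk _ ⟨T, h⟩

end

/-! ### 2-categories -/

/-- The structure of a 2-category (with associativity and unit laws for 1-morphisms up to coherent
natural 2-isomorphisms) on given objects, 1-morphisms and 2-morphisms with given identity
1-morphisms and composition of 1-morphisms. Here `vcomp b' b = b' • b` and
`hcomp b₂ b₁ = b₂ ∘ b₁`. -/
structure TwoCategory (Obj : Type*) (Hom : Obj → Obj → Type*)
    (Two : ∀ {G H : Obj}, Hom G H → Hom G H → Type*) (one : ∀ G, Hom G G)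
    (comp : ∀ {G H K : Obj}, Hom H K → Hom G H → Hom G K) where
  id₂ : ∀ {G H : Obj} (A : Hom G H), Two A A
  vcomp : ∀ {G H : Obj} {A B C : Hom G H}, Two B C → Two A B → Two A C
  hcomp : ∀ {G H K : Obj} {B B' : Hom H K} {A A' : Hom G H}, Two B B' → Two A A' →
    Two (comp B A) (comp B' A')
  assoc : ∀ {G H K L : Obj} (C : Hom K L) (B : Hom H K) (A : Hom G H),
    Two (comp (comp C B) A) (comp C (comp B A))
  lam : ∀ {G H : Obj} (A : Hom G H), Two (comp A (one G)) A
  rho : ∀ {G H : Obj} (A : Hom G H), Two (comp (one H) A) A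
  /- 1-morphisms `G → H` and 2-morphisms between them form a category -/
  vcomp_assoc : ∀ {G H : Obj} {A B C E : Hom G H} (b₃ : Two C E) (b₂ : Two B C) (b₁ : Two A B),
    vcomp (vcomp b₃ b₂) b₁ = vcomp b₃ (vcomp b₂ b₁)
  id_vcomp : ∀ {G H : Obj} {A B : Hom G H} (b : Two A B), vcomp (id₂ B) b = b
  vcomp_id : ∀ {G H : Obj} {A B : Hom G H} (b : Two A B), vcomp b (id₂ A) = b
  /- horizontal composition is a functor -/
  hcomp_id : ∀ {G H K : Obj} (B : Hom H K) (A : Hom G H),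
    hcomp (id₂ B) (id₂ A) = id₂ (comp B A)
  hcomp_vcomp : ∀ {G H K : Obj} {B B' B'' : Hom H K} {A A' A'' : Hom G H}
    (c' : Two B' B'') (c : Two B B') (b' : Two A' A'') (b : Two A A'),
    hcomp (vcomp c' c) (vcomp b' b) = vcomp (hcomp c' b') (hcomp c b)
  /- the associator is a natural isomorphism -/
  assoc_iso : ∀ {G H K L : Obj} (C : Hom K L) (B : Hom H K) (A : Hom G H),
    ∃ i, vcomp i (assoc C B A) = id₂ _ ∧ vcomp (assoc C B A) i = id₂ _
  assoc_natural : ∀ {G H K L : Obj} {C C' : Hom K L} {B B' : Hom H K} {A A' : Hom G H}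
    (d : Two C C') (c : Two B B') (b : Two A A'),
    vcomp (assoc C' B' A') (hcomp (hcomp d c) b) = vcomp (hcomp d (hcomp c b)) (assoc C B A)
  /- the unitors are natural isomorphisms -/
  lam_iso : ∀ {G H : Obj} (A : Hom G H),
    ∃ i, vcomp i (lam A) = id₂ _ ∧ vcomp (lam A) i = id₂ _
  lam_natural : ∀ {G H : Obj} {A A' : Hom G H} (b : Two A A'),
    vcomp (lam A') (hcomp b (id₂ (one G))) = vcomp b (lam A)
  rho_iso : ∀ {G H : Obj} (A : Hom G H),
    ∃ i, vcomp i (rho A) = id₂ _ ∧ vcomp (rho A) i = id₂ _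
  rho_natural : ∀ {G H : Obj} {A A' : Hom G H} (b : Two A A'),
    vcomp (rho A') (hcomp (id₂ (one H)) b) = vcomp b (rho A)
  /- coherence -/
  pentagon : ∀ {G H K L N : Obj} (E : Hom L N) (C : Hom K L) (B : Hom H K) (A : Hom G H),
    vcomp (assoc E C (comp B A)) (assoc (comp E C) B A) =
      vcomp (hcomp (id₂ E) (assoc C B A))
        (vcomp (assoc E (comp C B) A) (hcomp (assoc E C B) (id₂ A)))
  triangle : ∀ {G H K : Obj} (A' : Hom H K) (A : Hom G H),
    vcomp (hcomp (id₂ A') (rho A)) (assoc A' (one H) A) = hcomp (lam A') (id₂ A)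

end BGrb

end

/-! The proof rests on three observations.

Rigidity. The fibres of `L₁` and `L₂` are lines, so `α` can be read as a relation `Act l v v' m`,
meaning `α (l ⊗ v) = v' ⊗ m`. For `m ≠ 0` the element `v'` exists and is unique, and for `l ≠ 0` the
element `v` is determined by `v'`. The axiom relating `α` to `μ₁` and `μ₂` says that such relations
multiply (`Act.mul`), and the relation for a composed 1-morphism is a chain of the relations of its
factors (`Act.tmul`). A 2-morphism respects these relations (`Comm`). Hence its value over one point
determines its values over all points with the same image in `M` (`Comm.ext`). Consequently two
triples are equivalent as soon as, over every `m` in `M`, they share a value at one point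
(`Triple.rel_of_val`). This gives transitivity of the relation, independence of representatives and
a test for equality of 2-morphisms (`TwoMor.ext`).

Units. Let `e` be the element of `L` over `(y, y)` with `t_μ(e) = 1`. Since `t_μ` is the trace of
left multiplication, `μ(e ⊗ e) = e`, and by associativity `e` is a two-sided unit for `μ`. The map
`d` is characterised by `α (e ⊗ d v) = v ⊗ e`, so multiplicativity shows that it respects `α`
(`d_comm`) and is the identity over the diagonal (`d_self`). Similar characterisations hold for the
unitors. At well-chosen points every `d` disappears: a horizontal composition has the value `f₁ ⊗
f₂`, the associator is the rebracketing of tensor products, and the unitors are contractions with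
`t_μ` over points `(y, y)`. Functoriality, naturality, pentagon and triangle then become identities
for tensor products of vector spaces.

Differential geometry. All maps must also be isometric, smooth and parallel. In local frames such
morphisms are closed under composition, inverse, pullback and tensor product, which handles every
composite of `α`, `μ` and their inverses. The remaining ingredient is `t_μ`: over the diagonal `μ(l
⊗ l') = t_μ(l) l'`, so parallelity of `μ` forces `t_μ` to be parallel (`tAlong_frame`), and isometry
of `μ` makes it isometric. For compositions, the normalised trace of the curvature is additive under
tensor products and natural under pullback, so the forms `C₂` cancel. -/

noncomputable section

namespace BGrb

/-! ### Differentials of complex-valued functions -/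

section dFun

variable {X X' : Mfd.{u}}

/-- Smoothness of complex-valued functions at a point. -/
abbrev CSmoothAt (c : X → ℂ) (x : X) : Prop := ContMDiffAt 𝓘(ℝ, X.E) 𝓘(ℝ, ℂ) ∞ c x

lemma CSmoothAt.hasMFDerivAt {c : X → ℂ} {x : X} (h : CSmoothAt c x) :
    HasMFDerivAt 𝓘(ℝ, X.E) 𝓘(ℝ, ℂ) c x (dFun c x) :=
  (h.mdifferentiableAt (by simp)).hasMFDerivAt

lemma dFun_eq_of_hasMFDerivAt {c : X → ℂ} {x : X} {L : Tan x →L[ℝ] ℂ}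
    (h : HasMFDerivAt 𝓘(ℝ, X.E) 𝓘(ℝ, ℂ) c x L) : dFun c x = L := h.mfderiv

lemma CSmoothAt.mul {c c' : X → ℂ} {x : X} (h : CSmoothAt c x) (h' : CSmoothAt c' x) :
    CSmoothAt (fun y => c y * c' y) x := by
  have : ContDiffAt ℝ ∞ (fun p : ℂ × ℂ => p.1 * p.2) (c x, c' x) :=
    (contDiff_fst.mul contDiff_snd).contDiffAt
  exact ContMDiffAt.comp (f := fun y => (c y, c' y)) x this.contMDiffAt (h.prodMk_space h')

lemma CSmoothAt.star {c : X → ℂ} {x : X} (h : CSmoothAt c x) :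
    CSmoothAt (fun y => (starRingEnd ℂ) (c y)) x :=
  ContMDiffAt.comp (f := c) x (Complex.conjCLE.contDiff.contDiffAt.contMDiffAt) h

lemma CSmoothAt.sum {ι : Type*} {s : Finset ι} {c : ι → X → ℂ} {x : X}
    (h : ∀ i ∈ s, CSmoothAt (c i) x) : CSmoothAt (fun y => ∑ i ∈ s, c i y) x :=
  contMDiffAt_finsetSum (fun i hi => h i hi)

lemma dFun_mul {c c' : X → ℂ} {x : X} (h : CSmoothAt c x) (h' : CSmoothAt c' x) (v : Tan x) :
    dFun (fun y => c y * c' y) x v = c x * dFun c' x v + dFun c x v * c' x := by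
  have := h.hasMFDerivAt.mul h'.hasMFDerivAt
  have e : (fun y => c y * c' y) = c * c' := rfl
  rw [e, dFun_eq_of_hasMFDerivAt this]
  exact congrArg (c x * dFun c' x v + ·) (mul_comm _ _)

lemma dFun_sum {ι : Type} {s : Finset ι} {c : ι → X → ℂ} {x : X}
    (h : ∀ i ∈ s, CSmoothAt (c i) x) (v : Tan x) :
    dFun (fun y => ∑ i ∈ s, c i y) x v = ∑ i ∈ s, dFun (c i) x v := by
  have : HasMFDerivAt 𝓘(ℝ, X.E) 𝓘(ℝ, ℂ) (∑ i ∈ s, c i) x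
      (∑ i ∈ s, (dFun (c i) x : Tan x →L[ℝ] ℂ)) :=
    HasMFDerivAt.sum fun i hi => (h i hi).hasMFDerivAt
  have e : (fun y => ∑ i ∈ s, c i y) = ∑ i ∈ s, c i := by ext; simp
  rw [e]
  exact (congrArg (fun L : Tan x →L[ℝ] ℂ => L v) (dFun_eq_of_hasMFDerivAt this)).trans
    (_root_.sum_apply s (fun i => dFun (c i) x) v)

lemma dFun_star {c : X → ℂ} {x : X} (h : CSmoothAt c x) (v : Tan x) :
    dFun (fun y => (starRingEnd ℂ) (c y)) x v = (starRingEnd ℂ) (dFun c x v) := by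
  have h1 : HasMFDerivAt 𝓘(ℝ, ℂ) 𝓘(ℝ, ℂ) (Complex.conjCLE : ℂ → ℂ) (c x)
    (Complex.conjCLE : ℂ →L[ℝ] ℂ) := (Complex.conjCLE : ℂ →L[ℝ] ℂ).hasMFDerivAt
  have := h1.comp x h.hasMFDerivAt
  exact congrArg (fun L : Tan x →L[ℝ] ℂ => L v) (dFun_eq_of_hasMFDerivAt this)

lemma dFun_const (c : ℂ) (x : X) (v : Tan x) : dFun (fun _ : X => c) x v = 0 := by
  rw [dFun_eq_of_hasMFDerivAt (hasMFDerivAt_const c x)]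
  rfl

lemma dFun_comp {c : X → ℂ} {f : X' → X} {x : X'} (h : CSmoothAt c (f x)) (hf : SmoothAt f x)
    (v : Tan x) : dFun (fun y => c (f y)) x v = dFun c (f x) (D f x v) := by
  have := h.hasMFDerivAt.comp x (hf.mdifferentiableAt (by simp)).hasMFDerivAt
  exact congrArg (fun L : Tan x →L[ℝ] ℂ => L v) (dFun_eq_of_hasMFDerivAt this)

lemma CSmoothAt.comp {c : X → ℂ} {f : X' → X} {x : X'} (h : CSmoothAt c (f x))
    (hf : SmoothAt f x) : CSmoothAt (fun y => c (f y)) x :=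
  ContMDiffAt.comp x h hf

end dFun

namespace HVB

variable {X X' : Mfd.{u}}

/-! ### Morphisms in local frames -/

/-- Smoothness and parallelity of a family of linear maps, in given frames and at a point. -/
structure MorAt (E E' : HVB X) (T : ∀ x, E.fib x →ₗ[ℂ] E'.fib x) (i : E.ι) (j : E'.ι)
    (x : X) : Prop where
  smooth : ∀ a b, CSmoothAt (coef E E' T i j a b) x
  parallel : ∀ a b (v : Tan x), dFun (coef E E' T i j a b) x v
        + ∑ c, E'.conn j a c x v * coef E E' T i j c b x
      = ∑ c, coef E E' T i j a c x * E.conn i c b x v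

lemma IsMor.morAt {E E' : HVB X} {T : ∀ x, E.fib x →ₗ[ℂ] E'.fib x} (h : IsMor E E' T)
    (hE : E.IsVB) (hE' : E'.IsVB) {i j x} (hi : x ∈ E.dom i) (hj : x ∈ E'.dom j) :
    MorAt E E' T i j x :=
  ⟨fun a b => (h.smooth i j a b).contMDiffAt
    (((hE.isOpen_dom i).inter (hE'.isOpen_dom j)).mem_nhds ⟨hi, hj⟩),
    fun a b v => h.parallel i j a b x ⟨hi, hj⟩ v⟩

lemma IsMor.of_forall_morAt {E E' : HVB X} {T : ∀ x, E.fib x →ₗ[ℂ] E'.fib x}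
    (h : ∀ x v, ‖T x v‖ = ‖v‖)
    (h' : ∀ x i j, x ∈ E.dom i → x ∈ E'.dom j → MorAt E E' T i j x) : IsMor E E' T :=
  ⟨h, fun i j a b x hx => ((h' x i j hx.1 hx.2).smooth a b).contMDiffWithinAt,
    fun i j a b x hx v => (h' x i j hx.1 hx.2).parallel a b v⟩

lemma coef_comp {E E' E'' : HVB X} {T : ∀ x, E.fib x →ₗ[ℂ] E'.fib x}
    {S : ∀ x, E'.fib x →ₗ[ℂ] E''.fib x} (i : E.ι) (j : E'.ι) (k : E''.ι) (a b) (x : X) :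
    coef E E'' (fun x => S x ∘ₗ T x) i k a b x
      = ∑ c, coef E' E'' S j k a c x * coef E E' T i j c b x := by
  simp only [coef, LinearMap.comp_apply]
  conv_lhs => rw [← (E'.frame j x).sum_repr (T x (E.frame i x b))]
  simp only [map_sum, map_smul, inner_sum, inner_smul_right, OrthonormalBasis.repr_apply_apply]
  exact Finset.sum_congr rfl fun c _ => mul_comm _ _

/-- In matrix notation, with connection forms `ω`, `ω'`, `ω''`, parallelity reads `dT = Tω - ω'T`
and `dS = Sω' - ω''S`. In `d(ST) = S dT + dS T` the two terms `Sω'T` cancel. -/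
lemma MorAt.comp {E E' E'' : HVB X} {T : ∀ x, E.fib x →ₗ[ℂ] E'.fib x}
    {S : ∀ x, E'.fib x →ₗ[ℂ] E''.fib x} {i : E.ι} {j : E'.ι} {k : E''.ι} {x : X}
    (hS : MorAt E' E'' S j k x) (hT : MorAt E E' T i j x) :
    MorAt E E'' (fun x => S x ∘ₗ T x) i k x := by
  have e : ∀ a b, coef E E'' (fun x => S x ∘ₗ T x) i k a b
      = fun x => ∑ c, coef E' E'' S j k a c x * coef E E' T i j c b x :=
    fun a b => funext fun x => coef_comp i j k a b x
  refine ⟨fun a b => ?_, fun a b v => ?_⟩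
  · rw [e]
    exact CSmoothAt.sum fun c _ => (hS.smooth a c).mul (hT.smooth c b)
  · simp only [e]
    rw [dFun_sum fun c _ => (hS.smooth a c).mul (hT.smooth c b)]
    have h1 : ∀ c, dFun (fun x => coef E' E'' S j k a c x * coef E E' T i j c b x) x v
        = coef E' E'' S j k a c x * dFun (coef E E' T i j c b) x v
          + dFun (coef E' E'' S j k a c) x v * coef E E' T i j c b x :=
      fun c => dFun_mul (hS.smooth a c) (hT.smooth c b) v
    have h2 : ∀ c, dFun (coef E E' T i j c b) x v
        = ∑ d, coef E E' T i j c d x * E.conn i d b x v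
          - ∑ d, E'.conn j c d x v * coef E E' T i j d b x :=
      fun c => eq_sub_of_add_eq (hT.parallel c b v)
    have h3 : ∀ c, dFun (coef E' E'' S j k a c) x v
        = ∑ d, coef E' E'' S j k a d x * E'.conn j d c x v
          - ∑ d, E''.conn k a d x v * coef E' E'' S j k d c x :=
      fun c => eq_sub_of_add_eq (hS.parallel a c v)
    simp only [h1, h2, h3, mul_sub, sub_mul, Finset.mul_sum, Finset.sum_mul,
      Finset.sum_add_distrib, Finset.sum_sub_distrib]
    have s1 : ∑ c, ∑ d, coef E' E'' S j k a c x * (E'.conn j c d x v * coef E E' T i j d b x)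
        = ∑ c, ∑ d, coef E' E'' S j k a d x * E'.conn j d c x v * coef E E' T i j c b x := by
      rw [Finset.sum_comm]
      simp only [mul_assoc]
    have s2 : ∑ c, ∑ d, E''.conn k a d x v * coef E' E'' S j k d c x * coef E E' T i j c b x
        = ∑ d, ∑ c, E''.conn k a d x v * (coef E' E'' S j k d c x * coef E E' T i j c b x) := by
      rw [Finset.sum_comm]
      simp only [mul_assoc]
    have s3 : ∑ c, ∑ d, coef E' E'' S j k a c x * (coef E E' T i j c d x * E.conn i d b x v)
        = ∑ d, ∑ c, coef E' E'' S j k a c x * coef E E' T i j c d x * E.conn i d b x v := by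
      rw [Finset.sum_comm]
      simp only [mul_assoc]
    rw [s1, s2, s3]
    ring

lemma IsMor.comp {E E' E'' : HVB X} {T : ∀ x, E.fib x →ₗ[ℂ] E'.fib x}
    {S : ∀ x, E'.fib x →ₗ[ℂ] E''.fib x} (hS : IsMor E' E'' S) (hT : IsMor E E' T)
    (hE : E.IsVB) (hE' : E'.IsVB) (hE'' : E''.IsVB) : IsMor E E'' (fun x => S x ∘ₗ T x) := by
  refine IsMor.of_forall_morAt (fun x v => ?_) fun x i k hi hk => ?_
  · exact (hS.isometry x _).trans (hT.isometry x v)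
  · obtain ⟨j, hj⟩ := hE'.cover x
    exact (hS.morAt hE' hE'' hj hk).comp (hT.morAt hE hE' hi hj)

/-- It suffices to check the axioms of a morphism for one pair of frames around each point. -/
lemma IsMor.of_exists_morAt {E E' : HVB X} (hE : E.IsVB) (hE' : E'.IsVB)
    {T : ∀ x, E.fib x →ₗ[ℂ] E'.fib x} (h : ∀ x v, ‖T x v‖ = ‖v‖)
    (h' : ∀ x, ∃ i j, x ∈ E.dom i ∧ x ∈ E'.dom j ∧ MorAt E E' T i j x) : IsMor E E' T := by
  refine IsMor.of_forall_morAt h fun x i j hi hj => ?_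
  obtain ⟨k, l, hk, hl, hkl⟩ := h' x
  -- Changing frames on either side is composition with the identity, whose matrix in two frames is
  -- smooth and parallel by `compat`.
  exact (hE'.compat.morAt hE' hE' hl hj).comp (hkl.comp (hE.compat.morAt hE hE hi hk))

/-- A family of maps that sends frames to frames and connection forms to connection forms. -/
lemma MorAt.of_frame {E E' : HVB X} {T : ∀ x, E.fib x →ₗ[ℂ] E'.fib x} {i : E.ι} {j : E'.ι}
    {x : X} (e : E.κ ≃ E'.κ) (hT : ∀ x b, T x (E.frame i x b) = E'.frame j x (e b))
    (hc : ∀ a b v, E.conn i a b x v = E'.conn j (e a) (e b) x v) : MorAt E E' T i j x := by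
  have hco : ∀ a b, coef E E' T i j a b = fun _ => if a = e b then 1 else 0 := by
    intro a b; funext y
    simp only [coef, hT, OrthonormalBasis.inner_eq_ite]
  refine ⟨fun a b => ?_, fun a b v => ?_⟩
  · rw [hco]; exact contMDiffAt_const
  · obtain ⟨a', rfl⟩ := e.surjective a
    simp only [hco, dFun_const, zero_add, mul_ite, mul_one, mul_zero, Finset.sum_ite_eq',
      Finset.mem_univ, if_true, ite_mul, one_mul, zero_mul]
    rw [← hc]
    simp [e.injective.eq_iff]

/-- The inverse of an isometry is its adjoint, so its matrix is the conjugate transpose. Conjugating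
the parallelity equation and using that both connections are skew-hermitian gives the equation for
the inverse. -/
lemma IsMor.symm {E E' : HVB X} {T : ∀ x, E.fib x ≃ₗ[ℂ] E'.fib x}
    (h : IsMor E E' (fun x => (T x).toLinearMap)) (hE : E.IsVB) (hE' : E'.IsVB) :
    IsMor E' E (fun x => (T x).symm.toLinearMap) := by
  have hiso : ∀ x v, ‖(T x).symm v‖ = ‖v‖ := fun x v => by
    rw [← h.isometry x]; simp
  refine IsMor.of_forall_morAt hiso fun x j i hj hi => ?_
  have hm := h.morAt hE hE' hi hj
  have e : ∀ b a, coef E' E (fun x => (T x).symm.toLinearMap) j i b a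
      = fun x => (starRingEnd ℂ) (coef E E' (fun x => (T x).toLinearMap) i j a b x) := by
    intro b a; funext y
    simp only [coef, LinearEquiv.coe_coe, inner_conj_symm]
    let L : E.fib y ≃ₗᵢ[ℂ] E'.fib y := ⟨T y, h.isometry y⟩
    have : T y ((T y).symm (E'.frame j y a)) = E'.frame j y a := by simp
    conv_rhs => rw [← this]
    exact (L.inner_map_map _ _).symm
  refine ⟨fun b a => ?_, fun b a v => ?_⟩
  · rw [e]; exact (hm.smooth a b).star
  · simp only [e]
    rw [dFun_star (hm.smooth a b)]
    have h1 := congrArg (starRingEnd ℂ) (hm.parallel a b v)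
    simp only [map_add, map_sum, map_mul] at h1
    have h2 : ∀ c, (starRingEnd ℂ) (E'.conn j a c x v) = - E'.conn j c a x v := fun c =>
      eq_neg_of_add_eq_zero_right (hE'.conn_skew j c a x hj v)
    have h3 : ∀ c, (starRingEnd ℂ) (E.conn i c b x v) = - E.conn i b c x v := fun c =>
      eq_neg_of_add_eq_zero_right (hE.conn_skew i b c x hi v)
    simp only [h2, h3, neg_mul, mul_neg, Finset.sum_neg_distrib] at h1
    simp only [mul_comm (E'.conn j _ a x v)] at h1
    simp only [mul_comm (E.conn i b _ x v)]
    linear_combination h1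

/-- Iterated pullbacks, and pullbacks of tensor products, agree with their simplified forms by
definition except for the connection forms, which agree only after the chain rule or linearity has
been applied. This lemma bridges that difference. -/
lemma IsMor.congr_conn {E E' : HVB X} {T : ∀ x, E.fib x →ₗ[ℂ] E'.fib x} (h : IsMor E E' T)
    {c : E.ι → E.κ → E.κ → ∀ x : X, Tan x →L[ℝ] ℂ} {c' : E'.ι → E'.κ → E'.κ → ∀ x : X, Tan x →L[ℝ] ℂ}
    (hc : ∀ i a b x v, c i a b x v = E.conn i a b x v)
    (hc' : ∀ i a b x v, c' i a b x v = E'.conn i a b x v) :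
    IsMor { E with conn := c } { E' with conn := c' } T := by
  refine ⟨h.isometry, h.smooth, fun i j a b x hx v => ?_⟩
  have := h.parallel i j a b x hx v
  simp only [hc, hc']
  exact this

/-! ### Pullbacks and tensor products -/

lemma MorAt.pb {E E' : HVB X} {T : ∀ x, E.fib x →ₗ[ℂ] E'.fib x} {i : E.ι} {j : E'.ι}
    {f : X' → X} {x : X'} (h : MorAt E E' T i j (f x)) (hf : SmoothAt f x) :
    MorAt (E.pb f) (E'.pb f) (fun x => T (f x)) i j x := by
  have e : ∀ a b, coef (E.pb f) (E'.pb f) (fun x => T (f x)) i j a b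
      = fun x => coef E E' T i j a b (f x) := fun a b => rfl
  refine ⟨fun a b => ?_, fun a b v => ?_⟩
  · rw [e]; exact (h.smooth a b).comp hf
  · simp only [e]
    rw [dFun_comp (h.smooth a b) hf]
    exact h.parallel a b _

lemma IsMor.pb {E E' : HVB X} {T : ∀ x, E.fib x →ₗ[ℂ] E'.fib x} (h : IsMor E E' T)
    (hE : E.IsVB) (hE' : E'.IsVB) {f : X' → X} (hf : Smooth f) :
    IsMor (E.pb f) (E'.pb f) (fun x => T (f x)) :=
  IsMor.of_forall_morAt (fun x v => h.isometry (f x) v)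
    fun x _ _ hi hj => (h.morAt hE hE' hi hj).pb (hf x)

/-- The matrix of `T ⊗ S` is the Kronecker product, and its differential is given by the Leibniz
rule. The Kronecker deltas in the connection `∇ ⊗ 1 + 1 ⊗ ∇'` collapse the double sums, leaving the
parallelity of `T` times `S` plus `T` times that of `S`. -/
lemma MorAt.tensor {E E' F F' : HVB X} {T : ∀ x, E.fib x →ₗ[ℂ] E'.fib x}
    {S : ∀ x, F.fib x →ₗ[ℂ] F'.fib x} {i : E.ι} {j : E'.ι} {k : F.ι} {l : F'.ι} {x : X}
    (hT : MorAt E E' T i j x) (hS : MorAt F F' S k l x) :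
    MorAt (E.tensor F) (E'.tensor F') (fun x => TensorProduct.map (T x) (S x)) (i, k) (j, l) x := by
  have e : ∀ a b, coef (E.tensor F) (E'.tensor F') (fun x => TensorProduct.map (T x) (S x))
      (i, k) (j, l) a b = fun x => coef E E' T i j a.1 b.1 x * coef F F' S k l a.2 b.2 x := by
    intro a b; funext y
    simp only [coef, OrthonormalBasis.tensorProduct_apply', TensorProduct.map_tmul,
      TensorProduct.inner_tmul]
  refine ⟨fun a b => ?_, fun a b v => ?_⟩
  · rw [e]; exact (hT.smooth _ _).mul (hS.smooth _ _)
  · simp only [e]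
    rw [dFun_mul (hT.smooth _ _) (hS.smooth _ _)]
    have h1 := hT.parallel a.1 b.1 v
    have h2 := hS.parallel a.2 b.2 v
    have s1 : ∑ c : E'.κ × F'.κ, (E'.tensor F').conn (j, l) a c x v
          * (coef E E' T i j c.1 b.1 x * coef F F' S k l c.2 b.2 x)
        = (∑ c, E'.conn j a.1 c x v * coef E E' T i j c b.1 x) * coef F F' S k l a.2 b.2 x
          + coef E E' T i j a.1 b.1 x * ∑ c, F'.conn l a.2 c x v * coef F F' S k l c b.2 x := by
      rw [Fintype.sum_prod_type]
      simp only [_root_.add_apply, add_mul, Finset.sum_add_distrib]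
      congr 1
      · rw [Finset.sum_mul]
        refine Finset.sum_congr rfl fun c _ => ?_
        rw [Finset.sum_eq_single a.2]
        · simp [mul_assoc]
        · intro d _ hd; simp [hd.symm]
        · simp
      · rw [Finset.sum_comm, Finset.mul_sum]
        refine Finset.sum_congr rfl fun c _ => ?_
        rw [Finset.sum_eq_single a.1]
        · simp; ring
        · intro d _ hd; simp [hd.symm]
        · simp
    have s2 : ∑ c : E.κ × F.κ, (coef E E' T i j a.1 c.1 x * coef F F' S k l a.2 c.2 x)
          * (E.tensor F).conn (i, k) c b x v
        = (∑ c, coef E E' T i j a.1 c x * E.conn i c b.1 x v) * coef F F' S k l a.2 b.2 x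
          + coef E E' T i j a.1 b.1 x * ∑ c, coef F F' S k l a.2 c x * F.conn k c b.2 x v := by
      rw [Fintype.sum_prod_type]
      simp only [_root_.add_apply, mul_add, Finset.sum_add_distrib]
      congr 1
      · rw [Finset.sum_mul]
        refine Finset.sum_congr rfl fun c _ => ?_
        rw [Finset.sum_eq_single b.2]
        · simp; ring
        · intro d _ hd; simp [hd]
        · simp
      · rw [Finset.sum_comm, Finset.mul_sum]
        refine Finset.sum_congr rfl fun c _ => ?_
        rw [Finset.sum_eq_single b.1]
        · simp; ring
        · intro d _ hd; simp [hd]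
        · simp
    refine (congrArg (_ + ·) s1).trans (Eq.trans ?_ s2.symm)
    rw [← h1, ← h2]
    ring

lemma IsMor.tensor {E E' F F' : HVB X} {T : ∀ x, E.fib x →ₗ[ℂ] E'.fib x}
    {S : ∀ x, F.fib x →ₗ[ℂ] F'.fib x} (hT : IsMor E E' T) (hS : IsMor F F' S)
    (hE : E.IsVB) (hE' : E'.IsVB) (hF : F.IsVB) (hF' : F'.IsVB) :
    IsMor (E.tensor F) (E'.tensor F') (fun x => TensorProduct.map (T x) (S x)) := by
  refine IsMor.of_forall_morAt (fun x v => ?_) fun x i j hi hj => ?_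
  · exact TensorProduct.norm_map (⟨T x, hT.isometry x⟩ : E.fib x →ₗᵢ[ℂ] E'.fib x)
      (⟨S x, hS.isometry x⟩ : F.fib x →ₗᵢ[ℂ] F'.fib x) v
  · exact (hT.morAt hE hE' hi.1 hj.1).tensor (hS.morAt hF hF' hi.2 hj.2)

lemma IsVB.pb {E : HVB X} (hE : E.IsVB) {f : X' → X} (hf : Smooth f) : (E.pb f).IsVB where
  isOpen_dom i := (hE.isOpen_dom i).preimage hf.continuous
  cover x := hE.cover (f x)
  conn_smooth i a b := by
    have h1 : ContMDiff 𝓘(ℝ, X'.E).tangent 𝓘(ℝ, X.E).tangent ∞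
        (tangentMap 𝓘(ℝ, X'.E) 𝓘(ℝ, X.E) f) := hf.contMDiff_tangentMap (by simp)
    exact (hE.conn_smooth i a b).comp h1.contMDiffOn (fun p hp => hp)
  conn_skew i a b x hx v := hE.conn_skew i a b (f x) hx _
  compat := hE.compat.pb hE hE hf

lemma IsVB.tensor {E F : HVB X} (hE : E.IsVB) (hF : F.IsVB) : (E.tensor F).IsVB where
  isOpen_dom i := (hE.isOpen_dom _).inter (hF.isOpen_dom _)
  cover x := by
    obtain ⟨i, hi⟩ := hE.cover x
    obtain ⟨j, hj⟩ := hF.cover x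
    exact ⟨(i, j), hi, hj⟩
  conn_smooth i a b := by
    have h1 : ContMDiffOn 𝓘(ℝ, X.E).tangent 𝓘(ℝ, ℂ) ∞
        (fun p : TangentBundle 𝓘(ℝ, X.E) X =>
          (if a.2 = b.2 then E.conn i.1 a.1 b.1 p.1 else 0) p.2)
        {p | p.1 ∈ (E.tensor F).dom i} := by
      split_ifs
      · exact (hE.conn_smooth _ _ _).mono fun p hp => hp.1
      · exact contMDiffOn_const
    have h2 : ContMDiffOn 𝓘(ℝ, X.E).tangent 𝓘(ℝ, ℂ) ∞
        (fun p : TangentBundle 𝓘(ℝ, X.E) X =>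
          (if a.1 = b.1 then F.conn i.2 a.2 b.2 p.1 else 0) p.2)
        {p | p.1 ∈ (E.tensor F).dom i} := by
      split_ifs
      · exact (hF.conn_smooth _ _ _).mono fun p hp => hp.2
      · exact contMDiffOn_const
    exact h1.add h2
  conn_skew i a b x hx v := by
    have h1 : (if a.2 = b.2 then E.conn i.1 a.1 b.1 x else 0) v
        + (starRingEnd ℂ) ((if b.2 = a.2 then E.conn i.1 b.1 a.1 x else 0) v) = 0 := by
      by_cases h : a.2 = b.2
      · rw [if_pos h, if_pos h.symm]; exact hE.conn_skew i.1 a.1 b.1 x hx.1 v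
      · rw [if_neg h, if_neg (Ne.symm h)]; simp
    have h2 : (if a.1 = b.1 then F.conn i.2 a.2 b.2 x else 0) v
        + (starRingEnd ℂ) ((if b.1 = a.1 then F.conn i.2 b.2 a.2 x else 0) v) = 0 := by
      by_cases h : a.1 = b.1
      · rw [if_pos h, if_pos h.symm]; exact hF.conn_skew i.2 a.2 b.2 x hx.2 v
      · rw [if_neg h, if_neg (Ne.symm h)]; simp
    simp only [_root_.add_apply, map_add]
    linear_combination h1 + h2
  compat := by
    have := hE.compat.tensor hF.compat hE hE hF hF
    simpa only [TensorProduct.map_id] using this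

end HVB

lemma D_comp {X Y Z : Mfd.{u}} {f : Y → Z} {g : X → Y} (hf : Smooth f) (hg : Smooth g) (x : X)
    (v : Tan x) : D (fun x => f (g x)) x v = D f (g x) (D g x v) :=
  congrArg (fun L : Tan x →L[ℝ] Tan (f (g x)) => L v)
    (mfderiv_comp x ((hf _).mdifferentiableAt (by simp)) ((hg _).mdifferentiableAt (by simp)))

namespace HVB

variable {X X' : Mfd.{u}}

/-! ### Structural morphisms -/

lemma IsMor.tr {E : HVB X} (hE : E.IsVB) {f g : X' → X} (hf : Smooth f) (h : ∀ x, f x = g x) :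
    IsMor (E.pb f) (E.pb g) (fun x => (E.tr (h x)).toLinearMap) := by
  obtain rfl : f = g := funext h
  exact (hE.pb hf).compat

/-- Rebracketing carries product frames to product frames, and the connection form of a triple
product is the same sum of three terms in either bracketing. -/
lemma IsMor.assoc {E F G : HVB X} (hE : E.IsVB) (hF : F.IsVB) (hG : G.IsVB) :
    IsMor ((E.tensor F).tensor G) (E.tensor (F.tensor G))
      (fun x => (TensorProduct.assoc ℂ (E.fib x) (F.fib x) (G.fib x)).toLinearMap) := by
  refine IsMor.of_exists_morAt ((hE.tensor hF).tensor hG) (hE.tensor (hF.tensor hG))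
    (fun x v => TensorProduct.norm_assoc v) fun x => ?_
  obtain ⟨i, hi⟩ := hE.cover x
  obtain ⟨j, hj⟩ := hF.cover x
  obtain ⟨k, hk⟩ := hG.cover x
  refine ⟨((i, j), k), (i, (j, k)), ⟨⟨hi, hj⟩, hk⟩, ⟨hi, ⟨hj, hk⟩⟩,
    MorAt.of_frame (Equiv.prodAssoc _ _ _) (fun x b => ?_) (fun a b v => ?_)⟩
  · simp [OrthonormalBasis.tensorProduct_apply']
  · obtain ⟨⟨a1, a2⟩, a3⟩ := a
    obtain ⟨⟨b1, b2⟩, b3⟩ := b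
    simp only [Equiv.prodAssoc_apply, Prod.mk.injEq]
    by_cases h1 : a1 = b1 <;> by_cases h2 : a2 = b2 <;> by_cases h3 : a3 = b3 <;>
      simp [h1, h2, h3, add_assoc]

lemma tensor_pb_conn (E F : HVB X) (f : X' → X) (i a b) (x : X') (v : Tan x) :
    ((E.tensor F).pb f).conn i a b x v = ((E.pb f).tensor (F.pb f)).conn i a b x v := by
  change (_ + _ : Tan (f x) →L[ℝ] ℂ) (D f x v) = (_ + _ : Tan x →L[ℝ] ℂ) v
  simp only [_root_.add_apply]
  split_ifs <;> rfl

/-- This is the chain rule for the differential of `f ∘ g`. -/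
lemma pb_pb_conn {Y : Mfd.{u}} (E : HVB Y) {f : X → Y} {g : X' → X} (hf : Smooth f)
    (hg : Smooth g) (i a b) (x : X') (v : Tan x) :
    (E.pb (fun x => f (g x))).conn i a b x v = ((E.pb f).pb g).conn i a b x v :=
  congrArg (E.conn i a b (f (g x))) (D_comp hf hg x v)

lemma tensor_conn_congr {E F : HVB X} {c : E.ι → E.κ → E.κ → ∀ x : X, Tan x →L[ℝ] ℂ}
    {c' : F.ι → F.κ → F.κ → ∀ x : X, Tan x →L[ℝ] ℂ} (hc : ∀ i a b x v, c i a b x v = E.conn i a b x v)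
    (hc' : ∀ i a b x v, c' i a b x v = F.conn i a b x v) (i a b) (x : X) (v : Tan x) :
    ({ E with conn := c }.tensor { F with conn := c' }).conn i a b x v
      = (E.tensor F).conn i a b x v := by
  change (_ + _ : Tan x →L[ℝ] ℂ) v = (_ + _ : Tan x →L[ℝ] ℂ) v
  simp only [_root_.add_apply]
  congr 1
  · split_ifs
    · exact hc _ _ _ _ _
    · rfl
  · split_ifs
    · exact hc' _ _ _ _ _
    · rfl

section

variable {Y₁ Y₂ Y₃ Y₄ : Mfd.{u}} {E₁ : HVB Y₁} {E₂ : HVB Y₂} {E₃ : HVB Y₃} {E₄ : HVB Y₄}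
  {f₁ : X → Y₁} {f₂ : X → Y₂} {f₃ : X → Y₃} {f₄ : X → Y₄} {g : X' → X}

lemma pb_tensor_pb_conn (h₁ : Smooth f₁) (h₂ : Smooth f₂) (hg : Smooth g) (i a b) (x : X')
    (v : Tan x) :
    ((E₁.pb (fun x => f₁ (g x))).tensor (E₂.pb (fun x => f₂ (g x)))).conn i a b x v
      = (((E₁.pb f₁).tensor (E₂.pb f₂)).pb g).conn i a b x v :=
  (tensor_conn_congr (E := (E₁.pb f₁).pb g) (F := (E₂.pb f₂).pb g)
    (pb_pb_conn E₁ h₁ hg) (pb_pb_conn E₂ h₂ hg) i a b x v).trans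
    (tensor_pb_conn (E₁.pb f₁) (E₂.pb f₂) g i a b x v).symm

lemma IsMor.pb_pb {T : ∀ x, (E₁.pb f₁).fib x →ₗ[ℂ] (E₂.pb f₂).fib x}
    (h : IsMor (E₁.pb f₁) (E₂.pb f₂) T) (e₁ : E₁.IsVB) (e₂ : E₂.IsVB) (h₁ : Smooth f₁)
    (h₂ : Smooth f₂) (hg : Smooth g) :
    IsMor (E₁.pb (fun x => f₁ (g x))) (E₂.pb (fun x => f₂ (g x))) (fun x => T (g x)) :=
  (h.pb (e₁.pb h₁) (e₂.pb h₂) hg).congr_conn (pb_pb_conn E₁ h₁ hg) (pb_pb_conn E₂ h₂ hg)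

lemma IsMor.tensor_pb {T : ∀ x, ((E₁.pb f₁).tensor (E₂.pb f₂)).fib x →ₗ[ℂ] (E₃.pb f₃).fib x}
    (h : IsMor ((E₁.pb f₁).tensor (E₂.pb f₂)) (E₃.pb f₃) T) (e₁ : E₁.IsVB) (e₂ : E₂.IsVB)
    (e₃ : E₃.IsVB) (h₁ : Smooth f₁) (h₂ : Smooth f₂) (h₃ : Smooth f₃) (hg : Smooth g) :
    IsMor ((E₁.pb (fun x => f₁ (g x))).tensor (E₂.pb (fun x => f₂ (g x))))
      (E₃.pb (fun x => f₃ (g x))) (fun x => T (g x)) :=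
  (h.pb ((e₁.pb h₁).tensor (e₂.pb h₂)) (e₃.pb h₃) hg).congr_conn
    (pb_tensor_pb_conn h₁ h₂ hg) (pb_pb_conn E₃ h₃ hg)

lemma IsMor.tensor_tensor_pb {T : ∀ x, ((E₁.pb f₁).tensor (E₂.pb f₂)).fib x →ₗ[ℂ]
      ((E₃.pb f₃).tensor (E₄.pb f₄)).fib x}
    (h : IsMor ((E₁.pb f₁).tensor (E₂.pb f₂)) ((E₃.pb f₃).tensor (E₄.pb f₄)) T) (e₁ : E₁.IsVB)
    (e₂ : E₂.IsVB) (e₃ : E₃.IsVB) (e₄ : E₄.IsVB) (h₁ : Smooth f₁) (h₂ : Smooth f₂)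
    (h₃ : Smooth f₃) (h₄ : Smooth f₄) (hg : Smooth g) :
    IsMor ((E₁.pb (fun x => f₁ (g x))).tensor (E₂.pb (fun x => f₂ (g x))))
      ((E₃.pb (fun x => f₃ (g x))).tensor (E₄.pb (fun x => f₄ (g x)))) (fun x => T (g x)) :=
  (h.pb ((e₁.pb h₁).tensor (e₂.pb h₂)) ((e₃.pb h₃).tensor (e₄.pb h₄)) hg).congr_conn
    (pb_tensor_pb_conn h₁ h₂ hg) (pb_tensor_pb_conn h₃ h₄ hg)

/-- Both bundles have the same fibres and frames. The identity map serves as a link in chains of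
morphisms where a composed 1-morphism, whose bundle is a tensor product of pullbacks, is pulled back
once more. -/
lemma IsMor.tensorPb (e₁ : E₁.IsVB) (e₂ : E₂.IsVB) (h₁ : Smooth f₁) (h₂ : Smooth f₂)
    (hg : Smooth g) :
    IsMor (((E₁.pb f₁).tensor (E₂.pb f₂)).pb g)
      ((E₁.pb (fun x => f₁ (g x))).tensor (E₂.pb (fun x => f₂ (g x)))) (fun _ => LinearMap.id) :=
  (((e₁.pb h₁).tensor (e₂.pb h₂)).pb hg).compat.congr_conn (fun _ _ _ _ _ => rfl)
    (pb_tensor_pb_conn h₁ h₂ hg)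

lemma IsMor.tensorPb_symm (e₁ : E₁.IsVB) (e₂ : E₂.IsVB) (h₁ : Smooth f₁) (h₂ : Smooth f₂)
    (hg : Smooth g) :
    IsMor ((E₁.pb (fun x => f₁ (g x))).tensor (E₂.pb (fun x => f₂ (g x))))
      (((E₁.pb f₁).tensor (E₂.pb f₂)).pb g) (fun _ => LinearMap.id) :=
  (((e₁.pb h₁).tensor (e₂.pb h₂)).pb hg).compat.congr_conn (pb_tensor_pb_conn h₁ h₂ hg)
    (fun _ _ _ _ _ => rfl)

end

end HVB

/-! ### The canonical trivialization over the diagonal -/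

lemma Smooth.fst {N X Y S : Mfd.{u}} {f : X → S} {g : Y → S} {hf : Smooth f} {hg : SurjSubm g}
    {h : N → fp f g hf hg} (hh : Smooth h) : Smooth (fun n => pr₁ (h n)) :=
  fp.smooth_fst.comp hh

lemma Smooth.snd {N X Y S : Mfd.{u}} {f : X → S} {g : Y → S} {hf : Smooth f} {hg : SurjSubm g}
    {h : N → fp f g hf hg} (hh : Smooth h) : Smooth (fun n => pr₂ (h n)) :=
  fp.smooth_snd.comp hh

lemma Smooth.mk {N X Y S : Mfd.{u}} {f : X → S} {g : Y → S} {hf : Smooth f} {hg : SurjSubm g}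
    {a : N → X} {b : N → Y} (ha : Smooth a) (hb : Smooth b) (hab : ∀ n, f (a n) = g (b n)) :
    Smooth (fun n => (fp.mk (a n) (b n) (hab n) : fp f g hf hg)) :=
  fp.smooth_of ha hb

lemma Smooth.id {X : Mfd.{u}} : Smooth (fun x : X => x) := contMDiff_id

section

variable {Y M : Mfd.{u}} {π : Y → M} {hπ : SurjSubm π}

lemma pr₁₂_smooth : Smooth (pr₁₂ : Y3 π hπ → Y2 π hπ) := fp.smooth_fst

lemma pr₁₃_smooth : Smooth (pr₁₃ : Y3 π hπ → Y2 π hπ) :=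
  Smooth.mk (Smooth.fst (Smooth.fst Smooth.id)) (Smooth.snd Smooth.id) _

lemma pr₂₃_smooth : Smooth (pr₂₃ : Y3 π hπ → Y2 π hπ) :=
  Smooth.mk (Smooth.snd (Smooth.fst Smooth.id)) (Smooth.snd Smooth.id) _

end

namespace BundleGerbe

variable {M : Mfd.{u}} (G : BundleGerbe M)

lemma finrank_Lf (p : Y2 G.π G.hπ) : Module.finrank ℂ (G.L.fib p) = 1 := by
  obtain ⟨i, -⟩ := G.isVB.cover p
  rw [Module.finrank_eq_card_basis (G.L.frame i p).toBasis]
  exact G.rank_eq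

/-- The unit element of `L` over a point of the diagonal. -/
def e (y : G.Y) : G.Lf y y rfl := (G.t rfl rfl).symm 1

lemma t_e (y : G.Y) : G.t rfl rfl (G.e y) = 1 := by simp [e]

lemma cast_rfl {y y' : G.Y} {h h' : G.π y = G.π y'} (e : y = y) (e' : y' = y') (l : G.Lf y y' h) :
    G.cast (h' := h') e e' l = l := rfl

lemma t_rfl {y : G.Y} (l : G.Lf y y rfl) : G.t rfl rfl l = G.tLin y l := rfl

lemma eq_t_smul_e {y : G.Y} (l : G.Lf y y rfl) : l = G.t rfl rfl l • G.e y :=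
  (G.t (y := y) rfl rfl).injective (by rw [map_smul, t_e, smul_eq_mul, mul_one])

lemma e_ne_zero (y : G.Y) : G.e y ≠ 0 := fun h => by
  have := G.t_e y
  rw [h, map_zero] at this
  exact zero_ne_one this

/-- On a line, `μ(e ⊗ e) = c e` makes left multiplication by `e` equal to `c` times the identity.
Its trace is `c` on the one hand and `t(e) = 1` on the other. -/
lemma μ_e_e (y : G.Y) : G.μ rfl rfl (G.e y ⊗ₜ G.e y) = G.e y := by
  have hfr : Module.finrank ℂ (G.Lf y y rfl) = 1 := G.finrank_Lf _
  obtain ⟨c, hc⟩ := (finrank_eq_one_iff_of_nonzero' (G.e y) (G.e_ne_zero y)).1 hfr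
    (G.μ rfl rfl (G.e y ⊗ₜ G.e y))
  have hend : TensorProduct.curry (G.μ (y₁ := y) rfl rfl).toLinearMap (G.e y)
      = c • LinearMap.id := by
    refine LinearMap.ext fun x => ?_
    obtain ⟨d, rfl⟩ := (finrank_eq_one_iff_of_nonzero' (G.e y) (G.e_ne_zero y)).1 hfr x
    rw [map_smul]
    simp only [LinearMap.smul_apply, LinearMap.id_apply, TensorProduct.curry_apply]
    rw [smul_comm c d, hc]; rfl
  have ht : G.tLin y (G.e y) = c := by
    have h1 : LinearMap.trace ℂ (G.Lf y y rfl) LinearMap.id = 1 := by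
      have : Module.Finite ℂ (G.Lf y y rfl) := Module.finite_of_finrank_eq_succ hfr
      rw [LinearMap.trace_id, hfr]; simp
    refine (congrArg (LinearMap.trace ℂ (G.Lf y y rfl)) hend).trans ?_
    refine (map_smul _ _ _).trans ((congrArg (c • ·) h1).trans ?_)
    simp
  have h1 := G.t_e y
  rw [t_rfl, ht] at h1
  rw [← hc, h1, one_smul]

/-- By associativity and `e·e = e`, the elements `e ⊗ l` and `e ⊗ μ(e ⊗ l)` have the same image
under `μ`, hence are equal. The factor `e ≠ 0` can then be cancelled. -/
lemma μ_e_left {y y' : G.Y} (h : G.π y = G.π y') (l : G.Lf y y' h) :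
    G.μ rfl h (G.e y ⊗ₜ l) = l := by
  have h1 := G.μ_assoc rfl rfl h (G.e y) (G.e y) l
  rw [μ_e_e] at h1
  have h2 := (G.μ rfl h).injective h1
  have hfr := G.finrank_Lf (fp.mk y y' h)
  by_cases hl : l = 0
  · rw [hl]; simp
  obtain ⟨c, hc⟩ := (finrank_eq_one_iff_of_nonzero' l hl).1 hfr (G.μ rfl h (G.e y ⊗ₜ l))
  rw [← hc] at h2 ⊢
  have h3 := congrArg (fun z => ‖z‖) (sub_eq_zero.2 h2)
  simp only [← TensorProduct.tmul_sub, TensorProduct.norm_tmul, norm_zero] at h3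
  rcases mul_eq_zero.1 h3 with h4 | h4
  · exact absurd (norm_eq_zero.1 h4) (G.e_ne_zero y)
  · exact (sub_eq_zero.1 (norm_eq_zero.1 h4)).symm

lemma μ_e_right {y y' : G.Y} (h : G.π y = G.π y') (l : G.Lf y y' h) :
    G.μ h rfl (l ⊗ₜ G.e y') = l := by
  have h1 := G.μ_assoc h rfl rfl l (G.e y') (G.e y')
  rw [μ_e_e] at h1
  have h2 := (G.μ h rfl).injective h1
  have hfr := G.finrank_Lf (fp.mk y y' h)
  by_cases hl : l = 0
  · rw [hl]; simp
  obtain ⟨c, hc⟩ := (finrank_eq_one_iff_of_nonzero' l hl).1 hfr (G.μ h rfl (l ⊗ₜ G.e y'))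
  rw [← hc] at h2 ⊢
  have h3 := congrArg (fun z => ‖z‖) (sub_eq_zero.2 h2)
  simp only [← TensorProduct.sub_tmul, TensorProduct.norm_tmul, norm_zero] at h3
  rcases mul_eq_zero.1 h3 with h4 | h4
  · exact sub_eq_zero.1 (norm_eq_zero.1 h4)
  · exact absurd (norm_eq_zero.1 h4) (G.e_ne_zero y')

/-- Over the diagonal `l = t(l) e` with `e` a unit. This expresses `t` through `μ`, which is the way
in which isometry and parallelity of `t` become accessible. -/
lemma μ_eq_t_smul {y y' : G.Y} (e : y = y') (h : G.π y = G.π y') (l l' : G.Lf y y' h) :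
    G.μ (y₂ := y') (y₃ := y') h rfl (l ⊗ₜ G.cast e rfl l') = G.t e h l • l' := by
  subst e
  rw [cast_rfl]
  conv_lhs => rw [G.eq_t_smul_e l, ← TensorProduct.smul_tmul', map_smul, μ_e_left]

section

variable {G} {W : Mfd.{u}} {f : W → Y2 G.π G.hπ}

/-- The trivialization of `f^* L` for a map `f` into the diagonal. -/
def tAlong (e : ∀ w, pr₁ (f w) = pr₂ (f w)) (w : W) : G.L.fib (f w) ≃ₗ[ℂ] ℂ :=
  G.t (e w) (fp.cond (f w))

lemma isMor_tAlong_smul (hf : Smooth f) (e : ∀ w, pr₁ (f w) = pr₂ (f w)) :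
    HVB.IsMor ((G.L.pb f).tensor (G.L.pb f)) (G.L.pb f) (fun w =>
      TensorProduct.lift (LinearMap.lsmul ℂ (G.L.fib (f w)) ∘ₗ
        (tAlong e w).toLinearMap)) := by
  -- Writing `f w = (y, y')`, the map `τ` is `(y, y', y')`. Then `π₁₂` and `π₁₃` return `f`, and so
  -- does `π₂₃` because `y = y'`.
  let τ : W → Y3 G.π G.hπ := fun w => fp.mk (f w) (pr₂ (f w)) (fp.cond (f w))
  have hτ : Smooth τ := Smooth.mk hf (Smooth.snd hf) _
  have h1 := G.μ_mor.tensor_pb (g := τ) G.isVB G.isVB G.isVB pr₁₂_smooth pr₂₃_smooth pr₁₃_smooth hτ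
  have he : ∀ w, f w = pr₂₃ (τ w) := fun w => fp.ext (e w) rfl
  have h2 := HVB.IsMor.tr (E := G.L) G.isVB hf he
  have hL := G.isVB.pb hf
  have hL' := G.isVB.pb (pr₂₃_smooth.comp hτ)
  have h3 := h1.comp (hL.compat.tensor h2 hL hL hL hL') (hL.tensor hL) (hL.tensor hL') hL
  refine Eq.mp (congrArg (HVB.IsMor _ _) (funext fun w => ?_)) h3
  refine TensorProduct.ext' fun l l' => ?_
  exact (G.μ_eq_t_smul (e w) (fp.cond (f w)) l l')

/-- In rank one the morphism `l ⊗ l' ↦ t(l) l'` has a single matrix entry `t = t(e_k)`. With `ω` the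
connection form of `L`, its parallelity reads `dt + ωt = t(ω + ω)`, that is `dt = tω`: the
trivialization is flat. -/
lemma tAlong_frame (hf : Smooth f) (e : ∀ w, pr₁ (f w) = pr₂ (f w)) {k : G.L.ι} {w : W}
    (hw : f w ∈ G.L.dom k) (b : G.L.κ) :
    CSmoothAt (fun w => tAlong e w (G.L.frame k (f w) b)) w ∧
      ∀ v : Tan w, dFun (fun w => tAlong e w (G.L.frame k (f w) b)) w v
        = tAlong e w (G.L.frame k (f w) b) * (G.L.pb f).conn k b b w v := by
  have hL := G.isVB.pb hf
  have hm := (isMor_tAlong_smul hf e).morAt (hL.tensor hL) hL (i := (k, k)) (j := k) ⟨hw, hw⟩ hw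
  have : Subsingleton G.L.κ := Fintype.card_le_one_iff_subsingleton.1 G.rank_eq.le
  let _ : Unique G.L.κ := ⟨⟨b⟩, fun a => Subsingleton.elim a b⟩
  have hb : default = b := rfl
  have hco : HVB.coef ((G.L.pb f).tensor (G.L.pb f)) (G.L.pb f) (fun w =>
      TensorProduct.lift (LinearMap.lsmul ℂ (G.L.fib (f w)) ∘ₗ
        (tAlong e w).toLinearMap)) (k, k) k b (b, b)
        = fun w => tAlong e w (G.L.frame k (f w) b) := by
    funext w
    simp [HVB.coef, OrthonormalBasis.tensorProduct_apply']
  have h1 := hm.smooth b (b, b)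
  have h2 := hm.parallel b (b, b)
  rw [hco] at h1
  refine ⟨h1, fun v => ?_⟩
  have h3 := h2 v
  rw [Fintype.sum_unique, Fintype.sum_prod_type, Fintype.sum_unique, Fintype.sum_unique,
    hb, hco] at h3
  simp only [if_true, _root_.add_apply] at h3
  linear_combination h3

/-- Apply the isometry `l ⊗ l' ↦ t(l) l'` to `l ⊗ l` and cancel `‖l‖`. -/
lemma norm_tAlong (hf : Smooth f) (e : ∀ w, pr₁ (f w) = pr₂ (f w)) (w : W) (l : G.L.fib (f w)) :
    ‖tAlong e w l‖ = ‖l‖ := by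
  by_cases hl : l = 0
  · simp [hl]
  have h := (isMor_tAlong_smul hf e).isometry w (l ⊗ₜ l)
  rw [TensorProduct.norm_tmul, TensorProduct.lift.tmul] at h
  have h' : ‖tAlong e w l‖ * ‖l‖ = ‖l‖ * ‖l‖ := by
    rw [← h, ← norm_smul]; rfl
  exact mul_right_cancel₀ (norm_ne_zero_iff.2 hl) h'

/-- In product frames the matrix is a Kronecker delta times the function `t(e_k)`. The connection of
`E` cancels, and what is left on the diagonal is `tAlong_frame`. -/
lemma isMor_contract_right {E : HVB W} (hE : E.IsVB) (hf : Smooth f)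
    (e : ∀ w, pr₁ (f w) = pr₂ (f w)) :
    HVB.IsMor (E.tensor (G.L.pb f)) E (fun w => ((tAlong e w).lTensor (E.fib w) ≪≫ₗ
      TensorProduct.rid ℂ (E.fib w)).toLinearMap) := by
  have hL := G.isVB.pb hf
  refine HVB.IsMor.of_exists_morAt (hE.tensor hL) hE (fun w v => ?_) fun w => ?_
  · exact (TensorProduct.norm_rid _).trans (TensorProduct.norm_map LinearIsometry.id
      (⟨(tAlong e w).toLinearMap, norm_tAlong hf e w⟩ : G.L.fib (f w) →ₗᵢ[ℂ] ℂ) v)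
  obtain ⟨i, hi⟩ := hE.cover w
  obtain ⟨k, hk⟩ := G.isVB.cover (f w)
  refine ⟨(i, k), i, ⟨hi, hk⟩, hi, ?_⟩
  have : Subsingleton G.L.κ := Fintype.card_le_one_iff_subsingleton.1 G.rank_eq.le
  have hco : ∀ a b, HVB.coef (E.tensor (G.L.pb f)) E (fun w =>
      ((tAlong e w).lTensor (E.fib w) ≪≫ₗ TensorProduct.rid ℂ (E.fib w)).toLinearMap) (i, k) i a b
      = fun w => if a = b.1 then tAlong e w (G.L.frame k (f w) b.2) else 0 := by
    intro a b; funext w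
    simp [HVB.coef, OrthonormalBasis.tensorProduct_apply',
      OrthonormalBasis.inner_eq_ite]
  refine ⟨fun a b => ?_, fun a b v => ?_⟩
  · rw [hco]
    split_ifs
    · exact (tAlong_frame hf e hk b.2).1
    · exact contMDiffAt_const
  · obtain ⟨b, q⟩ := b
    let _ : Unique G.L.κ := ⟨⟨q⟩, fun a => Subsingleton.elim a q⟩
    have hq : default = q := rfl
    have h2 := (tAlong_frame hf e hk q).2 v
    rw [Fintype.sum_prod_type_right, Fintype.sum_unique (ι := G.L.κ), hq]
    simp only [hco, mul_ite, mul_zero, ite_mul, zero_mul, if_true, Finset.sum_ite_eq,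
      Finset.sum_ite_eq', Finset.mem_univ, _root_.add_apply]
    by_cases h : a = b
    · subst h
      simp only [if_true]
      rw [h2]
      ring
    · simp only [if_neg h, dFun_const]
      simp [mul_comm]

lemma isMor_contract_left {E : HVB W} (hE : E.IsVB) (hf : Smooth f)
    (e : ∀ w, pr₁ (f w) = pr₂ (f w)) :
    HVB.IsMor ((G.L.pb f).tensor E) E (fun w => ((tAlong e w).rTensor (E.fib w) ≪≫ₗ
      TensorProduct.lid ℂ (E.fib w)).toLinearMap) := by
  have hL := G.isVB.pb hf
  refine HVB.IsMor.of_exists_morAt (hL.tensor hE) hE (fun w v => ?_) fun w => ?_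
  · exact (TensorProduct.norm_lid _).trans (TensorProduct.norm_map
      (⟨(tAlong e w).toLinearMap, norm_tAlong hf e w⟩ : G.L.fib (f w) →ₗᵢ[ℂ] ℂ)
      LinearIsometry.id v)
  obtain ⟨i, hi⟩ := hE.cover w
  obtain ⟨k, hk⟩ := G.isVB.cover (f w)
  refine ⟨(k, i), i, ⟨hk, hi⟩, hi, ?_⟩
  have : Subsingleton G.L.κ := Fintype.card_le_one_iff_subsingleton.1 G.rank_eq.le
  have hco : ∀ a b, HVB.coef ((G.L.pb f).tensor E) E (fun w =>
      ((tAlong e w).rTensor (E.fib w) ≪≫ₗ TensorProduct.lid ℂ (E.fib w)).toLinearMap) (k, i) i a b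
      = fun w => if a = b.2 then tAlong e w (G.L.frame k (f w) b.1) else 0 := by
    intro a b; funext w
    simp [HVB.coef, OrthonormalBasis.tensorProduct_apply',
      OrthonormalBasis.inner_eq_ite]
  refine ⟨fun a b => ?_, fun a b v => ?_⟩
  · rw [hco]
    split_ifs
    · exact (tAlong_frame hf e hk b.1).1
    · exact contMDiffAt_const
  · obtain ⟨q, b⟩ := b
    let _ : Unique G.L.κ := ⟨⟨q⟩, fun a => Subsingleton.elim a q⟩
    have hq : default = q := rfl
    have h2 := (tAlong_frame hf e hk q).2 v
    rw [Fintype.sum_prod_type, Fintype.sum_unique (ι := G.L.κ), hq]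
    simp only [hco, mul_ite, mul_zero, ite_mul, zero_mul, if_true, Finset.sum_ite_eq,
      Finset.sum_ite_eq', Finset.mem_univ, _root_.add_apply]
    by_cases h : a = b
    · subst h
      simp only [if_true]
      rw [h2]
      ring
    · simp only [if_neg h, dFun_const]
      simp [mul_comm]

end

end BundleGerbe

/-! ### Exterior derivatives and traces of curvatures -/

section dForm

variable {X X' : Mfd.{u}}

/-- A `1`-form in the chart at `x`. -/
def locForm (θ : ∀ x : X, Tan x →L[ℝ] ℂ) (x : X) (y : X.E) : X.E →L[ℝ] ℂ :=
  (θ ((chartAt X.E x).symm y)).comp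
    (mfderiv 𝓘(ℝ, X.E) 𝓘(ℝ, X.E) (chartAt X.E x).symm y)

/-- Smoothness of a `1`-form in a neighbourhood of a point. -/
def FormSmoothAt (θ : ∀ x : X, Tan x →L[ℝ] ℂ) (x : X) : Prop :=
  ∃ U : Set X, IsOpen U ∧ x ∈ U ∧ ContMDiffOn 𝓘(ℝ, X.E).tangent 𝓘(ℝ, ℂ) ∞
    (fun p : TangentBundle 𝓘(ℝ, X.E) X => θ p.1 p.2) {p | p.1 ∈ U}

/-- The form is smooth as a function on the tangent bundle. Its coordinate expression on a constant
vector is the composite of that function with the tangent map of the inverse chart. -/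
lemma FormSmoothAt.contDiffAt_locForm {θ : ∀ x : X, Tan x →L[ℝ] ℂ} {x : X}
    (h : FormSmoothAt θ x) : ContDiffAt ℝ ∞ (locForm θ x) (chartAt X.E x x) := by
  obtain ⟨U, hU, hx, hθ⟩ := h
  set c := chartAt X.E x with hc
  have hca : c ∈ IsManifold.maximalAtlas 𝓘(ℝ, X.E) ∞ X := IsManifold.chart_mem_maximalAtlas x
  set S : Set X.E := c.target ∩ c.symm ⁻¹' U with hS
  have hSo : IsOpen S := c.isOpen_inter_preimage_symm hU
  have hxS : c x ∈ S := ⟨mem_chart_target _ _, by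
    rw [mem_preimage, c.left_inv (mem_chart_source _ _)]; exact hx⟩
  have hcs : ContMDiffOn 𝓘(ℝ, X.E) 𝓘(ℝ, X.E) ∞ c.symm S :=
    (contMDiffOn_symm_of_mem_maximalAtlas hca).mono fun y hy => hy.1
  have ht := hcs.contMDiffOn_tangentMapWithin (m := ∞) (by simp) hSo.uniqueMDiffOn
  refine ContDiffOn.contDiffAt (s := S) ?_ (hSo.mem_nhds hxS)
  -- Since `X.E` is finite-dimensional, a family of linear forms is smooth once its value on each
  -- fixed vector is.
  rw [contDiffOn_clm_apply]
  intro v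
  have hv : ContMDiff 𝓘(ℝ, X.E) 𝓘(ℝ, X.E).tangent ∞
      (fun y => (⟨y, v⟩ : TangentBundle 𝓘(ℝ, X.E) X.E)) := by
    have h1 : ContMDiff 𝓘(ℝ, X.E) (𝓘(ℝ, X.E).prod 𝓘(ℝ, X.E)) ∞ (fun y : X.E => (y, v)) :=
      contMDiff_id.prodMk contMDiff_const
    rw [chartedSpaceSelf_prod] at h1
    exact (contMDiff_tangentBundleModelSpaceHomeomorph_symm (I := 𝓘(ℝ, X.E))).comp h1
  have h2 := ht.comp hv.contMDiffOn (fun y (hy : y ∈ S) => hy)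
  have h3 := hθ.comp h2 (fun y hy => hy.2)
  refine (h3.congr fun y hy => ?_).contDiffOn
  simp only [Function.comp, tangentMapWithin, locForm]
  rw [mfderivWithin_of_isOpen hSo hy]
  rfl

lemma FormSmoothAt.differentiableAt {θ : ∀ x : X, Tan x →L[ℝ] ℂ} {x : X}
    (h : FormSmoothAt θ x) : DifferentiableAt ℝ (fun y : X.E =>
      ContinuousAlternatingMap.ofSubsingleton ℝ X.E ℂ (0 : Fin 1) (locForm θ x y))
      (chartAt X.E x x) :=
  (ContinuousAlternatingMap.ofSubsingletonLIE (𝕜 := ℝ) (E := X.E) (F := ℂ)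
      (0 : Fin 1)).toContinuousLinearEquiv.differentiableAt.comp _
    (h.contDiffAt_locForm.differentiableAt (by simp))

lemma dForm_add {θ θ' : ∀ x : X, Tan x →L[ℝ] ℂ} {x : X} (h : FormSmoothAt θ x)
    (h' : FormSmoothAt θ' x) (v w : Tan x) :
    dForm (fun y => θ y + θ' y) x v w = dForm θ x v w + dForm θ' x v w :=
  congrArg (fun L : X.E [⋀^Fin 2]→L[ℝ] ℂ => L ![v, w])
    (extDeriv_fun_add h.differentiableAt h'.differentiableAt)

/-- Let `F` be the coordinate expression of `f`. Near the point, the coordinate expression of the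
pulled back form is the pullback along `F` of the coordinate expression of `θ`, because `c⁻¹ ∘ F = f
∘ c'⁻¹`. The claim is then naturality of the exterior derivative on vector spaces. -/
lemma dForm_pb {θ : ∀ x : X, Tan x →L[ℝ] ℂ} {f : X' → X} (hf : Smooth f) {x : X'}
    (h : FormSmoothAt θ (f x)) (v w : Tan x) :
    dForm (fun y => (θ (f y)).comp (D f y)) x v w = dForm θ (f x) (D f x v) (D f x w) := by
  set c' := chartAt X'.E x with hc'
  set c := chartAt X.E (f x) with hc
  have hca' : c' ∈ IsManifold.maximalAtlas 𝓘(ℝ, X'.E) ∞ X' :=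
    IsManifold.chart_mem_maximalAtlas x
  have hca : c ∈ IsManifold.maximalAtlas 𝓘(ℝ, X.E) ∞ X :=
    IsManifold.chart_mem_maximalAtlas (f x)
  set F : X'.E → X.E := fun y => c (f (c'.symm y)) with hF
  set S : Set X'.E := c'.target ∩ c'.symm ⁻¹' (f ⁻¹' c.source) with hS
  have hSo : IsOpen S :=
    c'.isOpen_inter_preimage_symm (c.open_source.preimage hf.continuous)
  have hFS : ∀ y ∈ S, ContMDiffAt 𝓘(ℝ, X'.E) 𝓘(ℝ, X.E) ∞ F y := by
    intro y hy
    have h1 := contMDiffAt_symm_of_mem_maximalAtlas hca' hy.1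
    have h2 := contMDiffAt_of_mem_maximalAtlas hca hy.2
    exact ContMDiffAt.comp y h2 ((hf _).comp y h1)
  have hx0 : c'.symm (c' x) = x := c'.left_inv (mem_chart_source _ _)
  have hFx : F (c' x) = c (f x) := by simp only [hF, hx0]
  have hxS : c' x ∈ S := ⟨mem_chart_target _ _, by
    rw [mem_preimage, mem_preimage, hx0]; exact mem_chart_source _ _⟩
  have hloc : ∀ y ∈ S, locForm (fun y => (θ (f y)).comp (D f y)) x y
      = (locForm θ (f x) (F y)).comp (fderiv ℝ F y) := by
    intro y hy
    have e1 : c.symm (F y) = f (c'.symm y) := c.left_inv hy.2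
    have a1 : MDifferentiableAt 𝓘(ℝ, X'.E) 𝓘(ℝ, X'.E) c'.symm y :=
      (contMDiffAt_symm_of_mem_maximalAtlas hca' hy.1).mdifferentiableAt (by simp)
    have a2 : MDifferentiableAt 𝓘(ℝ, X.E) 𝓘(ℝ, X.E) c.symm (F y) :=
      (contMDiffAt_symm_of_mem_maximalAtlas hca (c.map_source hy.2)).mdifferentiableAt (by simp)
    have a3 : MDifferentiableAt 𝓘(ℝ, X'.E) 𝓘(ℝ, X.E) F y :=
      (hFS y hy).mdifferentiableAt (by simp)
    have a4 : MDifferentiableAt 𝓘(ℝ, X'.E) 𝓘(ℝ, X.E) f (c'.symm y) :=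
      (hf _).mdifferentiableAt (by simp)
    have b1 : mfderiv 𝓘(ℝ, X'.E) 𝓘(ℝ, X.E) (c.symm ∘ F) y
        = (mfderiv 𝓘(ℝ, X.E) 𝓘(ℝ, X.E) c.symm (F y)).comp (fderiv ℝ F y) := by
      rw [mfderiv_comp y a2 a3, mfderiv_eq_fderiv]; rfl
    have b2 : mfderiv 𝓘(ℝ, X'.E) 𝓘(ℝ, X.E) (f ∘ c'.symm) y
        = (D f (c'.symm y)).comp (mfderiv 𝓘(ℝ, X'.E) 𝓘(ℝ, X'.E) c'.symm y) :=
      mfderiv_comp y a4 a1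
    have b3 : (c.symm ∘ F) =ᶠ[𝓝 y] (f ∘ c'.symm) := by
      filter_upwards [hSo.mem_nhds hy] with z hz
      exact c.left_inv hz.2
    have b4 := b3.mfderiv_eq (I := 𝓘(ℝ, X'.E)) (I' := 𝓘(ℝ, X.E))
    have key : ∀ (p q : X) (e : p = q) (u : X.E), (θ p : X.E →L[ℝ] ℂ) u = (θ q : X.E →L[ℝ] ℂ) u := by
      rintro p _ rfl u; rfl
    refine ContinuousLinearMap.ext fun u => ?_
    have c1 : (D f (c'.symm y) (mfderiv 𝓘(ℝ, X'.E) 𝓘(ℝ, X'.E) c'.symm y u) : X.E)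
        = (mfderiv 𝓘(ℝ, X.E) 𝓘(ℝ, X.E) c.symm (F y) (fderiv ℝ F y u) : X.E) := by
      have d1 := congrArg (fun L : X'.E →L[ℝ] X.E => L u) b1
      have d2 := congrArg (fun L : X'.E →L[ℝ] X.E => L u) b2
      have d3 := congrArg (fun L : X'.E →L[ℝ] X.E => L u) b4
      exact d2.symm.trans (d3.symm.trans d1)
    change (θ (f (c'.symm y)) : X.E →L[ℝ] ℂ) _ = (θ (c.symm (F y)) : X.E →L[ℝ] ℂ) _
    refine Eq.trans ?_ (key _ _ e1 _).symm
    exact congrArg (θ (f (c'.symm y)) : X.E →L[ℝ] ℂ) c1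
  -- The differential of `f` at `x` is defined as the derivative of its expression in the preferred
  -- charts at `x` and `f x`, and these are the charts in `F`.
  have hd : (D f x : X'.E →L[ℝ] X.E) = fderiv ℝ F (c' x) := by
    have hdf : MDifferentiableAt 𝓘(ℝ, X'.E) 𝓘(ℝ, X.E) f x := (hf x).mdifferentiableAt (by simp)
    simp only [D, mfderiv, hdf]
    simp only [mfld_simps, fderivWithin_univ, writtenInExtChartAt]
    rfl
  have hdif := h.differentiableAt
  rw [← hFx] at hdif
  have hpull := extDeriv_pullback (r := ∞) hdif (hFS _ hxS).contDiffAt (by simp; exact ENat.LEInfty.out)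
  have hev : (fun y : X'.E => ContinuousAlternatingMap.ofSubsingleton ℝ X'.E ℂ (0 : Fin 1)
        (locForm (fun y => (θ (f y)).comp (D f y)) x y)) =ᶠ[𝓝 (c' x)]
      (fun y => (ContinuousAlternatingMap.ofSubsingleton ℝ X.E ℂ (0 : Fin 1)
        (locForm θ (f x) (F y))).compContinuousLinearMap (fderiv ℝ F y)) := by
    filter_upwards [hSo.mem_nhds hxS] with y hy
    rw [hloc y hy]
    rfl
  have h1 := hev.extDeriv_eq.trans hpull
  rw [hFx, ← hd] at h1
  refine (congrArg (fun L : X'.E [⋀^Fin 2]→L[ℝ] ℂ => L ![v, w]) h1).trans ?_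
  refine congrArg (extDeriv (fun y : X.E => ContinuousAlternatingMap.ofSubsingleton ℝ X.E ℂ
    (0 : Fin 1) (locForm θ (f x) y)) (c (f x))) ?_
  funext k
  fin_cases k <;> rfl

end dForm

namespace HVB

variable {X X' : Mfd.{u}}

lemma IsVB.formSmoothAt {E : HVB X} (hE : E.IsVB) {i : E.ι} {x : X} (hx : x ∈ E.dom i)
    (a b : E.κ) : FormSmoothAt (E.conn i a b) x :=
  ⟨E.dom i, hE.isOpen_dom i, hx, hE.conn_smooth i a b⟩

/-- The trace of `ω ∧ ω` vanishes: exchanging the two summation indices in one half of the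
commutator turns it into the other half. -/
lemma trCurv_eq (E : HVB X) (i : E.ι) (x : X) (v w : Tan x) :
    E.trCurv i x v w = Complex.I * ∑ a, dForm (E.conn i a a) x v w := by
  simp only [trCurv, curvMatrix, Finset.sum_add_distrib, Finset.sum_sub_distrib]
  congr 1
  rw [Finset.sum_comm (f := fun a c => E.conn i a c x w * E.conn i c a x v)]
  simp only [mul_comm (E.conn i _ _ x w), sub_self, add_zero]

lemma trCurv_pb {E : HVB X} (hE : E.IsVB) {f : X' → X} (hf : Smooth f) {i : E.ι} {x : X'}
    (hx : f x ∈ E.dom i) (v w : Tan x) :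
    (E.pb f).trCurv i x v w = E.trCurv i (f x) (D f x v) (D f x w) := by
  rw [trCurv_eq, trCurv_eq]
  exact congrArg _ (Finset.sum_congr rfl fun a _ => dForm_pb hf (hE.formSmoothAt hx a a) v w)

/-- Only the diagonal connection forms contribute to the trace. For a product index they are sums of
one form from each factor, and each is repeated as often as the rank of the other factor. -/
lemma trCurv_tensor {E F : HVB X} (hE : E.IsVB) (hF : F.IsVB) {i : E.ι} {j : F.ι} {x : X}
    (hi : x ∈ E.dom i) (hj : x ∈ F.dom j) (v w : Tan x) :
    (E.tensor F).trCurv (i, j) x v w = F.rank * E.trCurv i x v w + E.rank * F.trCurv j x v w := by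
  rw [trCurv_eq, trCurv_eq, trCurv_eq]
  have h : ∀ a : E.κ × F.κ, dForm ((E.tensor F).conn (i, j) a a) x v w
      = dForm (E.conn i a.1 a.1) x v w + dForm (F.conn j a.2 a.2) x v w := by
    intro a
    have e : (E.tensor F).conn (i, j) a a = fun y => E.conn i a.1 a.1 y + F.conn j a.2 a.2 y := by
      funext y; simp
    rw [e]
    exact dForm_add (hE.formSmoothAt hi _ _) (hF.formSmoothAt hj _ _) v w
  refine (congrArg _ (Finset.sum_congr rfl fun a _ => h a)).trans ?_
  rw [Fintype.sum_prod_type]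
  simp only [Finset.sum_add_distrib, Finset.sum_const, Finset.card_univ, nsmul_eq_mul]
  rw [← Finset.mul_sum]
  ring

end HVB

/-! ### Tensor products with lines -/

section lines

variable {V L : Type*} [AddCommGroup V] [Module ℂ V] [AddCommGroup L] [Module ℂ L]

/-- This makes it possible to compute with `α` elementwise: after fixing a generator of the line,
every value is a pure tensor. -/
lemma exists_eq_tmul (hL : Module.finrank ℂ L = 1) {m : L} (hm : m ≠ 0) (x : V ⊗[ℂ] L) :
    ∃ v, x = v ⊗ₜ m := by
  induction x with
  | zero => exact ⟨0, by simp⟩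
  | tmul v l =>
    obtain ⟨c, rfl⟩ := (finrank_eq_one_iff_of_nonzero' m hm).1 hL l
    exact ⟨c • v, by rw [TensorProduct.smul_tmul]⟩
  | add x y hx hy =>
    obtain ⟨v, rfl⟩ := hx
    obtain ⟨w, rfl⟩ := hy
    exact ⟨v + w, by rw [TensorProduct.add_tmul]⟩

lemma exists_eq_tmul' (hL : Module.finrank ℂ L = 1) {m : L} (hm : m ≠ 0) (x : L ⊗[ℂ] V) :
    ∃ v, x = m ⊗ₜ v := by
  obtain ⟨v, hv⟩ := exists_eq_tmul hL hm (TensorProduct.comm ℂ L V x)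
  refine ⟨v, (TensorProduct.comm ℂ L V).injective ?_⟩
  rw [hv, TensorProduct.comm_tmul]

/-- The norm of a pure tensor is the product of the norms, so a nonzero factor cancels. -/
lemma tmul_right_injective_of_ne_zero {V L : Type*} [NormedAddCommGroup V] [InnerProductSpace ℂ V]
    [NormedAddCommGroup L] [InnerProductSpace ℂ L] {m : L} (hm : m ≠ 0) {v w : V}
    (h : (v ⊗ₜ[ℂ] m : V ⊗[ℂ] L) = w ⊗ₜ m) : v = w := by
  have h3 := congrArg (fun z => ‖z‖) (sub_eq_zero.2 h)
  simp only [← TensorProduct.sub_tmul, TensorProduct.norm_tmul, norm_zero] at h3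
  exact sub_eq_zero.1 (norm_eq_zero.1 ((mul_eq_zero.1 h3).resolve_right (norm_ne_zero_iff.2 hm)))

lemma tmul_left_injective_of_ne_zero {V L : Type*} [NormedAddCommGroup V] [InnerProductSpace ℂ V]
    [NormedAddCommGroup L] [InnerProductSpace ℂ L] {m : L} (hm : m ≠ 0) {v w : V}
    (h : (m ⊗ₜ[ℂ] v : L ⊗[ℂ] V) = m ⊗ₜ w) : v = w := by
  have h3 := congrArg (fun z => ‖z‖) (sub_eq_zero.2 h)
  simp only [← TensorProduct.tmul_sub, TensorProduct.norm_tmul, norm_zero] at h3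
  exact sub_eq_zero.1 (norm_eq_zero.1 ((mul_eq_zero.1 h3).resolve_left (norm_ne_zero_iff.2 hm)))

lemma tensor_induction₃ {V U T : Type*} [AddCommGroup V] [Module ℂ V] [AddCommGroup U]
    [Module ℂ U] [AddCommGroup T] [Module ℂ T] {Q : V ⊗[ℂ] (U ⊗[ℂ] T) → Prop} (h0 : Q 0)
    (hadd : ∀ a b, Q a → Q b → Q (a + b)) (h : ∀ v u t, Q (v ⊗ₜ (u ⊗ₜ t))) (w) : Q w := by
  induction w using TensorProduct.induction_on with
  | zero => exact h0
  | tmul v t =>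
    induction t using TensorProduct.induction_on with
    | zero => rwa [TensorProduct.tmul_zero]
    | tmul u t => exact h v u t
    | add t₁ t₂ h₁ h₂ => rw [TensorProduct.tmul_add]; exact hadd _ _ h₁ h₂
  | add w₁ w₂ h₁ h₂ => exact hadd _ _ h₁ h₂

/-- Evaluates the right-hand side of the axiom `α_μ` when both applications of `α` yield pure
tensors. The next lemma does the same for the `α` of a composed 1-morphism. -/
lemma mul_chain {V V' L₁ L₂ L₃ L₄ : Type*} [AddCommGroup V] [Module ℂ V]
    [AddCommGroup V'] [Module ℂ V'] [AddCommGroup L₁] [Module ℂ L₁] [AddCommGroup L₂] [Module ℂ L₂]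
    [AddCommGroup L₃] [Module ℂ L₃] [AddCommGroup L₄] [Module ℂ L₄]
    (f : L₁ ⊗[ℂ] V ≃ₗ[ℂ] V' ⊗[ℂ] L₂) (g : L₂ ⊗[ℂ] L₃ ≃ₗ[ℂ] L₄) {l : L₁} {v : V} {v' : V'} {m : L₂}
    {n : L₃} {w : V ⊗[ℂ] L₃} (e' : w = v ⊗ₜ n) (e : f (l ⊗ₜ v) = v' ⊗ₜ m) :
    g.lTensor V' (TensorProduct.assoc ℂ _ _ _ (f.rTensor L₃ ((TensorProduct.assoc ℂ _ _ _).symm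
      (l ⊗ₜ w)))) = v' ⊗ₜ g (m ⊗ₜ n) := by
  simp [e, e']

lemma tensor_chain {V V' U U' L₁ L₂ L₂' L₃ : Type*} [AddCommGroup V] [Module ℂ V]
    [AddCommGroup V'] [Module ℂ V'] [AddCommGroup U] [Module ℂ U] [AddCommGroup U'] [Module ℂ U']
    [AddCommGroup L₁] [Module ℂ L₁] [AddCommGroup L₂] [Module ℂ L₂] [AddCommGroup L₂']
    [Module ℂ L₂'] [AddCommGroup L₃] [Module ℂ L₃] (f : L₁ ⊗[ℂ] V ≃ₗ[ℂ] V' ⊗[ℂ] L₂)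
    (c : L₂ ≃ₗ[ℂ] L₂') (f' : L₂' ⊗[ℂ] U ≃ₗ[ℂ] U' ⊗[ℂ] L₃) {l : L₁} {v : V} {v' : V'} {m : L₂}
    {u : U} {u' : U'} {n : L₃} (e : f (l ⊗ₜ v) = v' ⊗ₜ m) (e' : f' (c m ⊗ₜ u) = u' ⊗ₜ n) :
    ((TensorProduct.assoc ℂ L₁ V U).symm ≪≫ₗ f.rTensor _ ≪≫ₗ TensorProduct.assoc ℂ _ _ _ ≪≫ₗ
      (c.rTensor _).lTensor _ ≪≫ₗ f'.lTensor _ ≪≫ₗ (TensorProduct.assoc ℂ _ _ _).symm)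
      (l ⊗ₜ (v ⊗ₜ u)) = (v' ⊗ₜ u') ⊗ₜ n := by
  simp [e, e']

end lines

/-! ### Nonzero elements and identifications in the fibres of `L` -/

namespace BundleGerbe

variable {M : Mfd.{u}} (G : BundleGerbe M)

lemma exists_ne_zero {y y' : G.Y} (h : G.π y = G.π y') : ∃ l : G.Lf y y' h, l ≠ 0 := by
  by_contra hne
  push Not at hne
  have : Subsingleton (G.Lf y y' h) := ⟨fun a b => (hne a).trans (hne b).symm⟩
  have h1 : Module.finrank ℂ (G.Lf y y' h) = 1 := G.finrank_Lf _
  rw [Module.finrank_zero_of_subsingleton] at h1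
  exact zero_ne_one h1

lemma cast_e {y y₁ y₂ : G.Y} (e₁ : y = y₁) (e₂ : y = y₂) (h : G.π y₁ = G.π y₂) :
    G.cast (h' := h) e₁ e₂ (G.e y) = (G.t (e₁.symm.trans e₂) h).symm 1 := by
  subst e₁ e₂
  rfl

lemma cast_cast {y₁ y₁' y₂ y₂' y₃ y₃' : G.Y} {h : G.π y₁ = G.π y₁'} {h' : G.π y₂ = G.π y₂'}
    {h'' : G.π y₃ = G.π y₃'} (e : y₁ = y₂) (e' : y₁' = y₂') (f : y₂ = y₃) (f' : y₂' = y₃')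
    (l : G.Lf y₁ y₁' h) :
    G.cast (h' := h'') f f' (G.cast (h' := h') e e' l) = G.cast (e.trans f) (e'.trans f') l := by
  subst e e' f f'
  rfl

lemma cast_symm_cast {y₁ y₁' y₂ y₂' : G.Y} {h : G.π y₁ = G.π y₁'} {h' : G.π y₂ = G.π y₂'}
    (e : y₁ = y₂) (e' : y₁' = y₂') (f : y₂ = y₁) (f' : y₂' = y₁') (l : G.Lf y₁ y₁' h) :
    G.cast (h' := h) f f' (G.cast (h' := h') e e' l) = l := by
  subst e e'
  rfl

lemma μ_ne_zero {y₁ y₂ y₃ : G.Y} (h₁₂ : G.π y₁ = G.π y₂) (h₂₃ : G.π y₂ = G.π y₃)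
    {l : G.Lf y₁ y₂ h₁₂} {l' : G.Lf y₂ y₃ h₂₃} (hl : l ≠ 0) (hl' : l' ≠ 0) :
    G.μ h₁₂ h₂₃ (l ⊗ₜ l') ≠ 0 := by
  intro h
  rw [LinearEquiv.map_eq_zero_iff] at h
  have h1 : ‖(l ⊗ₜ[ℂ] l' : G.Lf y₁ y₂ h₁₂ ⊗[ℂ] G.Lf y₂ y₃ h₂₃)‖ = 0 := by rw [h, norm_zero]
  rw [TensorProduct.norm_tmul] at h1
  rcases mul_eq_zero.1 h1 with h1 | h1
  · exact hl (norm_eq_zero.1 h1)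
  · exact hl' (norm_eq_zero.1 h1)

end BundleGerbe

/-! ### The relational form of `α` and the maps compatible with it -/

namespace OneMorData

variable {M : Mfd.{u}} {G₁ G₂ G₃ G₄ : BundleGerbe M}

/-- The isomorphism `α`, with the points of `Y₁` and `Y₂` given up to equality only. -/
def αAt (D : OneMorData G₁ G₂) {z x : D.Z} {y₁ x₁ : G₁.Y} {y₂ x₂ : G₂.Y} (a : D.src z = y₁)
    (a' : D.src x = x₁) (b : D.tgt z = y₂) (b' : D.tgt x = x₂) (h : G₁.π y₁ = G₁.π x₁)
    (h' : G₂.π y₂ = G₂.π x₂) :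
    G₁.Lf y₁ x₁ h ⊗[ℂ] D.A.fib x ≃ₗ[ℂ] D.A.fib z ⊗[ℂ] G₂.Lf y₂ x₂ h' := by
  subst a a' b b'
  exact D.α h

lemma αAt_tmul (D : OneMorData G₁ G₂) {z x : D.Z} {y₁ x₁ : G₁.Y} {y₂ x₂ : G₂.Y}
    (a : D.src z = y₁) (a' : D.src x = x₁) (b : D.tgt z = y₂) (b' : D.tgt x = x₂)
    (h : G₁.π y₁ = G₁.π x₁) (h' : G₂.π y₂ = G₂.π x₂) (h'' : D.base z = D.base x)
    (l : G₁.Lf y₁ x₁ h) (v : D.A.fib x) :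
    D.αAt a a' b b' h h' (l ⊗ₜ v)
      = (G₂.cast (h := π_pr₂ h'') b b').lTensor _
          (D.α h'' (G₁.cast (h' := h'') a.symm a'.symm l ⊗ₜ v)) := by
  subst a a' b b'
  change D.α h'' (l ⊗ₜ v) = LinearMap.lTensor (D.A.fib z) LinearMap.id (D.α h'' (l ⊗ₜ v))
  rw [LinearMap.lTensor_id]
  rfl

/-- The relation `α (l ⊗ v) = v' ⊗ m`. -/
def Act (D : OneMorData G₁ G₂) {z x : D.Z} {y₁ x₁ : G₁.Y} {y₂ x₂ : G₂.Y}
    {h : G₁.π y₁ = G₁.π x₁} {h' : G₂.π y₂ = G₂.π x₂} (l : G₁.Lf y₁ x₁ h) (v : D.A.fib x)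
    (v' : D.A.fib z) (m : G₂.Lf y₂ x₂ h') : Prop :=
  ∃ (a : D.src z = y₁) (a' : D.src x = x₁) (b : D.tgt z = y₂) (b' : D.tgt x = x₂),
    D.αAt a a' b b' h h' (l ⊗ₜ v) = v' ⊗ₜ m

section Act

variable {D : OneMorData G₁ G₂} {z x p : D.Z} {y₁ x₁ p₁ : G₁.Y} {y₂ x₂ p₂ : G₂.Y}
  {h : G₁.π y₁ = G₁.π x₁} {h' : G₂.π y₂ = G₂.π x₂}

lemma act_iff {hz : D.base z = D.base x} {l : G₁.Lf (D.src z) (D.src x) hz} {v : D.A.fib x}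
    {v' : D.A.fib z} {m : G₂.Lf (D.tgt z) (D.tgt x) (π_pr₂ hz)} :
    D.Act l v v' m ↔ D.α hz (l ⊗ₜ v) = v' ⊗ₜ m :=
  ⟨fun ⟨_, _, _, _, e⟩ => e, fun e => ⟨rfl, rfl, rfl, rfl, e⟩⟩

lemma exists_act (a : D.src z = y₁) (a' : D.src x = x₁) (b : D.tgt z = y₂) (b' : D.tgt x = x₂)
    (l : G₁.Lf y₁ x₁ h) (v : D.A.fib x) {m : G₂.Lf y₂ x₂ h'} (hm : m ≠ 0) :
    ∃ v' : D.A.fib z, D.Act l v v' m := by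
  obtain ⟨v', hv⟩ := exists_eq_tmul (G₂.finrank_Lf _) hm (D.αAt a a' b b' h h' (l ⊗ₜ v))
  exact ⟨v', a, a', b, b', hv⟩

variable {l : G₁.Lf y₁ x₁ h} {m : G₂.Lf y₂ x₂ h'} {v w : D.A.fib x} {v' w' : D.A.fib z}

lemma Act.unique (hm : m ≠ 0) (h₁ : D.Act l v v' m) (h₂ : D.Act l v w' m) : v' = w' := by
  obtain ⟨a, a', b, b', e⟩ := h₁
  obtain ⟨_, _, _, _, e'⟩ := h₂
  exact tmul_right_injective_of_ne_zero hm (e.symm.trans e')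

lemma Act.unique' (hl : l ≠ 0) (h₁ : D.Act l v v' m) (h₂ : D.Act l w v' m) : v = w := by
  obtain ⟨a, a', b, b', e⟩ := h₁
  obtain ⟨_, _, _, _, e'⟩ := h₂
  exact tmul_left_injective_of_ne_zero hl ((D.αAt a a' b b' h h').injective (e.trans e'.symm))

lemma Act.add (h₁ : D.Act l v v' m) (h₂ : D.Act l w w' m) : D.Act l (v + w) (v' + w') m := by
  obtain ⟨a, a', b, b', e⟩ := h₁
  obtain ⟨_, _, _, _, e'⟩ := h₂
  exact ⟨a, a', b, b', by rw [TensorProduct.tmul_add, map_add, e, e', TensorProduct.add_tmul]⟩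

lemma act_zero (a : D.src z = y₁) (a' : D.src x = x₁) (b : D.tgt z = y₂) (b' : D.tgt x = x₂)
    (l : G₁.Lf y₁ x₁ h) (m : G₂.Lf y₂ x₂ h') : D.Act l (0 : D.A.fib x) (0 : D.A.fib z) m :=
  ⟨a, a', b, b', by simp⟩

/-- This is the axiom `α_μ`, freed from the identifications of base points: once the equalities are
substituted, both sides are pure tensors. -/
lemma Act.mul (hD : D.IsOneMor) {hp : G₁.π x₁ = G₁.π p₁} {hp' : G₂.π x₂ = G₂.π p₂}
    {k : G₁.Lf x₁ p₁ hp} {n : G₂.Lf x₂ p₂ hp'} {u : D.A.fib p} (h₁ : D.Act l v v' m)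
    (h₂ : D.Act k u v n) : D.Act (G₁.μ h hp (l ⊗ₜ k)) u v' (G₂.μ h' hp' (m ⊗ₜ n)) := by
  obtain ⟨a, a', b, b', e⟩ := h₁
  obtain ⟨_, c, _, d, e'⟩ := h₂
  subst a a' b b' c d
  change D.α h (l ⊗ₜ v) = _ at e
  change D.α hp (k ⊗ₜ u) = _ at e'
  exact act_iff.2 ((hD.α_μ h hp l k u).trans (mul_chain (D.α h) (G₂.μ h' hp') e' e))

end Act

/-- Compatibility of linear maps with `α` and `α'`. -/
def Comm (D D' : OneMorData G₁ G₂) {z x : D.Z} {z' x' : D'.Z}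
    (g : D.A.fib z →ₗ[ℂ] D'.A.fib z') (f : D.A.fib x →ₗ[ℂ] D'.A.fib x') : Prop :=
  ∀ ⦃y₁ x₁ : G₁.Y⦄ ⦃y₂ x₂ : G₂.Y⦄ ⦃h : G₁.π y₁ = G₁.π x₁⦄ ⦃h' : G₂.π y₂ = G₂.π x₂⦄
    (l : G₁.Lf y₁ x₁ h) (v : D.A.fib x) (v' : D.A.fib z) (m : G₂.Lf y₂ x₂ h'), m ≠ 0 →
    D.Act l v v' m → D'.Act l (f v) (g v') m

section Comm

variable {D D' D'' : OneMorData G₁ G₂} {z x : D.Z} {z' x' : D'.Z} {z'' x'' : D''.Z}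

lemma Comm.comp {g : D.A.fib z →ₗ[ℂ] D'.A.fib z'} {f : D.A.fib x →ₗ[ℂ] D'.A.fib x'}
    {g' : D'.A.fib z' →ₗ[ℂ] D''.A.fib z''} {f' : D'.A.fib x' →ₗ[ℂ] D''.A.fib x''}
    (h' : Comm D' D'' g' f') (h : Comm D D' g f) : Comm D D'' (g' ∘ₗ g) (f' ∘ₗ f) :=
  fun _ _ _ _ _ _ l v v' m hm ha => h' l _ _ m hm (h l v v' m hm ha)

lemma Comm.id : Comm D D (LinearMap.id : D.A.fib z →ₗ[ℂ] _) (LinearMap.id : D.A.fib x →ₗ[ℂ] _) :=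
  fun _ _ _ _ _ _ _ _ _ _ _ ha => ha

lemma src_eq (h : D.ζ z = D'.ζ z') : D.src z = D'.src z' := congrArg pr₁ h

lemma tgt_eq (h : D.ζ z = D'.ζ z') : D.tgt z = D'.tgt z' := congrArg pr₂ h

/-- Transport `f⁻¹ v` by `l` and `m` to an element `u` and push the relation forward. Uniqueness
identifies `g u` with the element `v'` that was given. -/
lemma Comm.symm {g : D.A.fib z ≃ₗ[ℂ] D'.A.fib z'} {f : D.A.fib x ≃ₗ[ℂ] D'.A.fib x'}
    (hz : D.ζ z = D'.ζ z') (hx : D.ζ x = D'.ζ x')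
    (h : Comm D D' g.toLinearMap f.toLinearMap) :
    Comm D' D g.symm.toLinearMap f.symm.toLinearMap := by
  intro y₁ x₁ y₂ x₂ _ _ l v v' m hm ha
  have ha' := ha
  obtain ⟨a, a', b, b', -⟩ := ha'
  obtain ⟨u, hu⟩ := exists_act ((src_eq hz).trans a) ((src_eq hx).trans a')
    ((tgt_eq hz).trans b) ((tgt_eq hx).trans b') l (f.symm v) hm
  have h1 := h l _ _ m hm hu
  simp only [LinearEquiv.coe_coe, LinearEquiv.apply_symm_apply] at h1
  have h2 := Act.unique hm ha h1
  subst h2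
  simpa using hu

/-- The rigidity principle. Given `v`, choose nonzero `l` and `m` and transport `v` to `u` over `z`.
Both `f v` and `f' v` are then related to `g u` by the same `l` and `m`, and `l ≠ 0` allows only one
such element. -/
lemma Comm.ext {g : D.A.fib z →ₗ[ℂ] D'.A.fib z'} {f f' : D.A.fib x →ₗ[ℂ] D'.A.fib x'}
    (hb : D.base z = D.base x) (h : Comm D D' g f) (h' : Comm D D' g f') : f = f' := by
  refine LinearMap.ext fun v => ?_
  obtain ⟨l, hl⟩ := G₁.exists_ne_zero (y := D.src z) (y' := D.src x) hb
  obtain ⟨m, hm⟩ := G₂.exists_ne_zero (y := D.tgt z) (y' := D.tgt x) (π_pr₂ hb)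
  obtain ⟨u, hu⟩ := exists_act rfl rfl rfl rfl l v hm
  exact (h l v u m hm hu).unique' hl (h' l v u m hm hu)

/-- For `m ≠ 0` the transported element is unique, so compatibility need only be checked on one that
is constructed for the purpose. The existential form is stable under addition and thus suited to
induction on tensors. -/
lemma Comm.of_forall_exists {g : D.A.fib z →ₗ[ℂ] D'.A.fib z'} {f : D.A.fib x →ₗ[ℂ] D'.A.fib x'}
    (h : ∀ ⦃y₁ x₁ : G₁.Y⦄ ⦃y₂ x₂ : G₂.Y⦄ ⦃h : G₁.π y₁ = G₁.π x₁⦄ ⦃h' : G₂.π y₂ = G₂.π x₂⦄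
      (_ : D.src z = y₁) (_ : D.src x = x₁) (_ : D.tgt z = y₂) (_ : D.tgt x = x₂)
      (l : G₁.Lf y₁ x₁ h) (m : G₂.Lf y₂ x₂ h'), m ≠ 0 → ∀ v,
      ∃ v', D.Act l v v' m ∧ D'.Act l (f v) (g v') m) : Comm D D' g f := by
  intro y₁ x₁ y₂ x₂ _ _ l v v' m hm ha
  have ha' := ha
  obtain ⟨a, a', b, b', -⟩ := ha'
  obtain ⟨u, h1, h2⟩ := h a a' b b' l m hm v
  rwa [Act.unique hm ha h1]

lemma exists_act_zero {g : D.A.fib z →ₗ[ℂ] D'.A.fib z'} {f : D.A.fib x →ₗ[ℂ] D'.A.fib x'}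
    (hz : D.ζ z = D'.ζ z') (hx : D.ζ x = D'.ζ x')
    {y₁ x₁ : G₁.Y} {y₂ x₂ : G₂.Y} {h : G₁.π y₁ = G₁.π x₁} {h' : G₂.π y₂ = G₂.π x₂}
    (a : D.src z = y₁) (a' : D.src x = x₁) (b : D.tgt z = y₂) (b' : D.tgt x = x₂)
    (l : G₁.Lf y₁ x₁ h) (m : G₂.Lf y₂ x₂ h') :
    ∃ v', D.Act l (0 : D.A.fib x) v' m ∧ D'.Act l (f 0) (g v') m := by
  refine ⟨0, act_zero a a' b b' l m, ?_⟩
  rw [map_zero, map_zero]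
  exact act_zero ((src_eq hz).symm.trans a) ((src_eq hx).symm.trans a')
    ((tgt_eq hz).symm.trans b) ((tgt_eq hx).symm.trans b') l m

lemma exists_act_add {g : D.A.fib z →ₗ[ℂ] D'.A.fib z'} {f : D.A.fib x →ₗ[ℂ] D'.A.fib x'}
    {y₁ x₁ : G₁.Y} {y₂ x₂ : G₂.Y} {h : G₁.π y₁ = G₁.π x₁} {h' : G₂.π y₂ = G₂.π x₂}
    {l : G₁.Lf y₁ x₁ h} {m : G₂.Lf y₂ x₂ h'} {v w : D.A.fib x}
    (hv : ∃ v', D.Act l v v' m ∧ D'.Act l (f v) (g v') m)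
    (hw : ∃ w', D.Act l w w' m ∧ D'.Act l (f w) (g w') m) :
    ∃ u, D.Act l (v + w) u m ∧ D'.Act l (f (v + w)) (g u) m := by
  obtain ⟨a, ha, ha'⟩ := hv
  obtain ⟨b, hb, hb'⟩ := hw
  refine ⟨a + b, ha.add hb, ?_⟩
  rw [map_add, map_add]
  exact ha'.add hb'

/-- Translates between the relational form and the equation with explicit identifications of fibres
that occurs in the axioms of 2-morphisms and of strict isomorphisms. -/
lemma comm_iff {g : D.A.fib z →ₗ[ℂ] D'.A.fib z'} {f : D.A.fib x →ₗ[ℂ] D'.A.fib x'}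
    (hz : D.ζ z = D'.ζ z') (hx : D.ζ x = D'.ζ x') (h : D.base z = D.base x)
    (h' : D'.base z' = D'.base x') :
    Comm D D' g f ↔ ∀ (l : G₁.Lf (D.src z) (D.src x) h) (v : D.A.fib x),
      TensorProduct.map g (G₂.cast (h' := π_pr₂ h') (tgt_eq hz) (tgt_eq hx)).toLinearMap
          (D.α h (l ⊗ₜ v))
        = D'.α h' (G₁.cast (src_eq hz) (src_eq hx) l ⊗ₜ f v) := by
  have key : ∀ (l : G₁.Lf (D.src z) (D.src x) h) (v : D.A.fib x) (v' : D.A.fib z)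
      (m : G₂.Lf (D.tgt z) (D.tgt x) (π_pr₂ h)),
      D'.Act l (f v) (g v') m ↔ D'.α h' (G₁.cast (src_eq hz) (src_eq hx) l ⊗ₜ f v)
        = g v' ⊗ₜ G₂.cast (h' := π_pr₂ h') (tgt_eq hz) (tgt_eq hx) m := by
    intro l v v' m
    have h1 := D'.αAt_tmul (src_eq hz).symm (src_eq hx).symm (tgt_eq hz).symm (tgt_eq hx).symm
      h (π_pr₂ h) h' l (f v)
    constructor
    · rintro ⟨_, _, _, _, e⟩
      apply ((G₂.cast (h' := π_pr₂ h) (tgt_eq hz).symm (tgt_eq hx).symm).lTensor _).injective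
      refine h1.symm.trans (e.trans ?_)
      exact congrArg (fun n => g v' ⊗ₜ[ℂ] n) (G₂.cast_symm_cast _ _ _ _ m).symm
    · intro e
      refine ⟨(src_eq hz).symm, (src_eq hx).symm, (tgt_eq hz).symm, (tgt_eq hx).symm, ?_⟩
      rw [h1]
      refine (congrArg _ e).trans ?_
      exact congrArg (fun n => g v' ⊗ₜ[ℂ] n) (G₂.cast_symm_cast _ _ _ _ m)
  constructor
  · intro hc l v
    -- A single nonzero `m` suffices, since `α (l ⊗ v)` is of the form `u ⊗ m` for it.
    obtain ⟨m, hm⟩ := G₂.exists_ne_zero (y := D.tgt z) (y' := D.tgt x) (π_pr₂ h)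
    obtain ⟨u, hu⟩ := exists_act rfl rfl rfl rfl l v hm
    have h1 := (key l v u m).1 (hc l v u m hm hu)
    rw [act_iff.1 hu, h1]
    rfl
  · intro hc
    refine Comm.of_forall_exists ?_
    rintro _ _ _ _ _ _ rfl rfl rfl rfl l m hm v
    obtain ⟨u, hu⟩ := exists_act rfl rfl rfl rfl l v hm
    refine ⟨u, hu, (key l v u m).2 ?_⟩
    rw [← hc l v, act_iff.1 hu]
    rfl

end Comm

/-! ### The isomorphism `d` -/

section d

variable {D : OneMorData G₁ G₂} {z z' x x' : D.Z}

/-- The composite defining `d` inserts the unit of `L₂`, applies `α⁻¹` and strips off the unit of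
`L₁`. Read backwards, this is `α (e ⊗ d v) = v ⊗ e`, a relation that determines `d v`. -/
lemma d_act (hz : D.ζ z = D.ζ z') (v : D.A.fib z) :
    D.Act (G₁.e (D.src z)) (D.d hz v) v (G₂.e (D.tgt z)) := by
  have hb : D.base z = D.base z' := congrArg toM hz
  refine ⟨rfl, (src_eq hz).symm, rfl, (tgt_eq hz).symm, ?_⟩
  rw [D.αAt_tmul rfl (src_eq hz).symm rfl (tgt_eq hz).symm rfl rfl hb]
  set l := (G₁.t (rfl.trans (src_eq hz)) hb).symm 1 with hl
  have hl0 : l ≠ 0 := by simp [hl]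
  obtain ⟨u, hu⟩ := exists_eq_tmul' (G₁.finrank_Lf _) hl0 ((D.α hb).symm (v ⊗ₜ
    (G₂.t (tgt_eq hz) (π_pr₂ hb)).symm 1))
  have hd : D.d hz v = u := by
    have h1 : D.d hz v = TensorProduct.lid ℂ _ ((G₁.t (src_eq hz) hb).rTensor _ ((D.α hb).symm (v ⊗ₜ
      (G₂.t (tgt_eq hz) (π_pr₂ hb)).symm 1))) := rfl
    rw [h1, hu, LinearEquiv.rTensor_tmul, TensorProduct.lid_tmul]
    have h2 : G₁.t (src_eq hz) hb l = 1 := by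
      rw [hl]; exact LinearEquiv.apply_symm_apply _ _
    rw [h2, one_smul]
  rw [hd]
  have h3 : D.α hb (l ⊗ₜ u) = v ⊗ₜ (G₂.t (tgt_eq hz) (π_pr₂ hb)).symm 1 := by
    exact (congrArg (D.α hb) hu.symm).trans (LinearEquiv.apply_symm_apply _ _)
  have h4 : G₁.cast (h' := hb) rfl (src_eq hz) (G₁.e (D.src z)) = l := G₁.cast_e _ _ _
  refine (congrArg (fun k => (G₂.cast (h := π_pr₂ hb) (h' := rfl) rfl (tgt_eq hz).symm).lTensor _
    (D.α hb (k ⊗ₜ u))) h4).trans ((congrArg _ h3).trans ?_)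
  refine congrArg (fun n => v ⊗ₜ[ℂ] n) ?_
  refine (congrArg _ (G₂.cast_e rfl (tgt_eq hz) (π_pr₂ hb)).symm).trans ?_
  exact G₂.cast_cast _ _ _ _ _

/-- Multiplying the relation for `v` by the one for `d v`, and using `e·e = e`, shows that `d (d v)`
and `d v` satisfy the same relation. Hence `d` is idempotent, and being injective it is the
identity. -/
lemma d_self (hD : D.IsOneMor) (hz : D.ζ z = D.ζ z) (v : D.A.fib z) : D.d hz v = v := by
  have h1 := d_act hz v
  have h2 := Act.mul hD h1 (d_act hz (D.d hz v))
  rw [BundleGerbe.μ_e_e, BundleGerbe.μ_e_e] at h2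
  exact (D.d hz).injective (h2.unique' (G₁.e_ne_zero _) h1)

/-- Expand `l` as `l·e` and as `e·l`, and `m` likewise. Transporting `d v` from `x'` to `z` along
these two factorizations, once through `x` and once through `z'`, gives the same element by
uniqueness. -/
lemma d_comm (hD : D.IsOneMor) (hz : D.ζ z = D.ζ z') (hx : D.ζ x = D.ζ x') :
    Comm D D (D.d hz).toLinearMap (D.d hx).toLinearMap := by
  refine Comm.of_forall_exists ?_
  rintro _ _ _ _ h h' rfl rfl rfl rfl l m hm v
  obtain ⟨v', hv'⟩ := exists_act rfl rfl rfl rfl l v hm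
  refine ⟨v', hv', ?_⟩
  have h1 := Act.mul hD hv' (d_act hx v)
  rw [BundleGerbe.μ_e_right, BundleGerbe.μ_e_right] at h1
  obtain ⟨b, hb⟩ := exists_act (z := z') (src_eq hz).symm (src_eq hx).symm (tgt_eq hz).symm
    (tgt_eq hx).symm l (D.d hx v) hm
  have h2 := Act.mul hD (d_act hz ((D.d hz).symm b)) (by simpa using hb)
  rw [BundleGerbe.μ_e_left, BundleGerbe.μ_e_left] at h2
  have h3 := Act.unique hm h1 h2
  rw [h3]
  simpa using hb

end d

/-! ### Identities and compositions -/

/-- The inverse of `μ` in the structure map of the identity is moved to the other side, so that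
associativity of `μ` becomes directly applicable. -/
lemma one_act_iff {G : BundleGerbe M} {y₁ x₁ y₂ x₂ : G.Y} {h : G.π y₁ = G.π x₁}
    {h' : G.π y₂ = G.π x₂} {hy : G.π y₁ = G.π y₂} {hx : G.π x₁ = G.π x₂}
    {l : G.Lf y₁ x₁ h} {k : G.Lf x₁ x₂ hx} {k' : G.Lf y₁ y₂ hy} {m : G.Lf y₂ x₂ h'} :
    (one G).Act (z := fp.mk y₁ y₂ hy) (x := fp.mk x₁ x₂ hx) l k k' m
      ↔ G.μ h hx (l ⊗ₜ k) = G.μ hy h' (k' ⊗ₜ m) := by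
  refine (act_iff (D := one G) (z := fp.mk y₁ y₂ hy) (x := fp.mk x₁ x₂ hx) (hz := h)).trans ?_
  exact LinearEquiv.symm_apply_eq _

section comp

variable {D : OneMorData G₁ G₂} {D' : OneMorData G₂ G₃} {p q : (D'.comp D).Z}
  {y₁ x₁ : G₁.Y} {y₂ x₂ : G₂.Y} {y₃ x₃ : G₃.Y} {h₁ : G₁.π y₁ = G₁.π x₁} {h₂ : G₂.π y₂ = G₂.π x₂}
  {h₃ : G₃.π y₃ = G₃.π x₃} {l : G₁.Lf y₁ x₁ h₁} {m : G₂.Lf y₂ x₂ h₂} {n : G₃.Lf y₃ x₃ h₃}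
  {v : D.A.fib (pr₁ q)} {v' : D.A.fib (pr₁ p)} {u : D'.A.fib (pr₂ q)} {u' : D'.A.fib (pr₂ p)}

/-- The element `m` produced by the action on `A` is the one that acts on `A'`. This is the meaning
of `(1 ⊗ α') ∘ (α ⊗ 1)`. -/
lemma Act.tmul (h : D.Act l v v' m) (h' : D'.Act m u u' n) :
    (D'.comp D).Act (z := p) (x := q) l (v ⊗ₜ u) (v' ⊗ₜ u') n := by
  obtain ⟨rfl, rfl, rfl, rfl, e⟩ := h
  obtain ⟨a, a', rfl, rfl, e'⟩ := h'
  have hb : D'.base (pr₂ p) = D'.base (pr₂ q) :=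
    (congrArg G₂.π a).trans (h₂.trans (congrArg G₂.π a').symm)
  rw [D'.αAt_tmul a a' rfl rfl h₂ h₃ hb] at e'
  refine ⟨rfl, rfl, rfl, rfl, ?_⟩
  refine tensor_chain (D.α h₁) (G₂.cast (h' := hb) (fp.cond p) (fp.cond q)) (D'.α hb) e ?_
  refine Eq.trans ?_ e'
  change _ = LinearMap.lTensor (D'.A.fib (pr₂ p)) LinearMap.id _
  rw [LinearMap.lTensor_id]
  rfl

end comp

lemma comp_exists_act {D : OneMorData G₁ G₂} {D' : OneMorData G₂ G₃} {p q : (D'.comp D).Z}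
    {h : (D'.comp D).base p = (D'.comp D).base q} (l : G₁.Lf _ _ h) (v : D.A.fib (pr₁ q))
    (u : D'.A.fib (pr₂ q)) {n : G₃.Lf ((D'.comp D).tgt p) ((D'.comp D).tgt q) (π_pr₂ h)}
    (hn : n ≠ 0) : ∃ (m : G₂.Lf (D.tgt (pr₁ p)) (D.tgt (pr₁ q)) (π_pr₂ (G₁ := G₁) h))
      (v' : D.A.fib (pr₁ p)) (u' : D'.A.fib (pr₂ p)), m ≠ 0 ∧ D.Act l v v' m ∧ D'.Act m u u' n := by
  obtain ⟨m, hm⟩ := G₂.exists_ne_zero (y := D.tgt (pr₁ p)) (y' := D.tgt (pr₁ q))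
    (π_pr₂ (G₁ := G₁) h)
  obtain ⟨v', hv'⟩ := exists_act (D := D) (z := pr₁ p) (x := pr₁ q) rfl rfl rfl rfl l v hm
  obtain ⟨u', hu'⟩ := exists_act (D := D') (z := pr₂ p) (x := pr₂ q) (fp.cond p).symm
    (fp.cond q).symm rfl rfl m u hn
  exact ⟨m, v', u', hm, hv', hu'⟩

/-- Compatibility can be checked on pure tensors. -/
lemma Comm.of_tmul {D : OneMorData G₁ G₂} {D' : OneMorData G₂ G₃} {E : OneMorData G₁ G₃}
    {p q : (D'.comp D).Z} {z x : E.Z} {g : (D'.comp D).A.fib p →ₗ[ℂ] E.A.fib z}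
    {f : (D'.comp D).A.fib q →ₗ[ℂ] E.A.fib x} (hz : (D'.comp D).ζ p = E.ζ z)
    (hx : (D'.comp D).ζ q = E.ζ x)
    (H : ∀ ⦃y₁ x₁ : G₁.Y⦄ ⦃y₂ x₂ : G₂.Y⦄ ⦃y₃ x₃ : G₃.Y⦄ ⦃h₁ : G₁.π y₁ = G₁.π x₁⦄
      ⦃h₂ : G₂.π y₂ = G₂.π x₂⦄ ⦃h₃ : G₃.π y₃ = G₃.π x₃⦄ (l : G₁.Lf y₁ x₁ h₁) (m : G₂.Lf y₂ x₂ h₂)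
      (n : G₃.Lf y₃ x₃ h₃) (v : D.A.fib (pr₁ q)) (v' : D.A.fib (pr₁ p)) (u : D'.A.fib (pr₂ q))
      (u' : D'.A.fib (pr₂ p)), m ≠ 0 → n ≠ 0 → D.Act l v v' m → D'.Act m u u' n →
      E.Act l (f (v ⊗ₜ u)) (g (v' ⊗ₜ u')) n) : Comm (D'.comp D) E g f := by
  refine Comm.of_forall_exists ?_
  rintro _ _ _ _ h _ rfl rfl rfl rfl l n hn w
  induction w using TensorProduct.induction_on with
  | zero => exact exists_act_zero hz hx rfl rfl rfl rfl l n
  | tmul v u =>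
    obtain ⟨m, v', u', hm, h1, h2⟩ := comp_exists_act l v u hn
    exact ⟨v' ⊗ₜ u', h1.tmul h2, H l m n v v' u u' hm hn h1 h2⟩
  | add w₁ w₂ h₁ h₂ => exact exists_act_add h₁ h₂

lemma Comm.tensor {D E : OneMorData G₁ G₂} {D' E' : OneMorData G₂ G₃} {p q : (D'.comp D).Z}
    {r s : (E'.comp E).Z} {g : D.A.fib (pr₁ p) →ₗ[ℂ] E.A.fib (pr₁ r)}
    {f : D.A.fib (pr₁ q) →ₗ[ℂ] E.A.fib (pr₁ s)} {g' : D'.A.fib (pr₂ p) →ₗ[ℂ] E'.A.fib (pr₂ r)}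
    {f' : D'.A.fib (pr₂ q) →ₗ[ℂ] E'.A.fib (pr₂ s)} (hz : (D'.comp D).ζ p = (E'.comp E).ζ r)
    (hx : (D'.comp D).ζ q = (E'.comp E).ζ s) (h : Comm D E g f) (h' : Comm D' E' g' f') :
    Comm (D'.comp D) (E'.comp E) (z := p) (x := q) (z' := r) (x' := s)
      (TensorProduct.map g g') (TensorProduct.map f f') :=
  Comm.of_tmul hz hx fun _ _ _ _ _ _ _ _ _ l m n v v' u u' hm hn h1 h2 =>
    (h l v v' m hm h1).tmul (h' m u u' n hn h2)

/-- Choose nonzero intermediate elements `m` and `n`. The chain of relations from `l` through `m`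
and `n` to `k` can be assembled in either bracketing, with the same elements `v'`, `u'`, `t'`. -/
lemma assocFib_comm_tmul (D'' : OneMorData G₃ G₄) (D' : OneMorData G₂ G₃) (D : OneMorData G₁ G₂)
    (p q : ((D''.comp D').comp D).Z) {h : ((D''.comp D').comp D).base p
      = ((D''.comp D').comp D).base q} (l : G₁.Lf _ _ h)
    {k : G₄.Lf (((D''.comp D').comp D).tgt p) (((D''.comp D').comp D).tgt q)
      (π_pr₂ (p := ((D''.comp D').comp D).ζ p) (q := ((D''.comp D').comp D).ζ q) h)} (hk : k ≠ 0)
    (v : D.A.fib (pr₁ q)) (u : D'.A.fib (pr₁ (pr₂ q))) (t : D''.A.fib (pr₂ (pr₂ q))) :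
    ∃ (v' : D.A.fib (pr₁ p)) (u' : D'.A.fib (pr₁ (pr₂ p))) (t' : D''.A.fib (pr₂ (pr₂ p))),
      ((D''.comp D').comp D).Act (z := p) (x := q) l (v ⊗ₜ (u ⊗ₜ t)) (v' ⊗ₜ (u' ⊗ₜ t')) k ∧
      (D''.comp (D'.comp D)).Act (z := assocMap D'' D' D p) (x := assocMap D'' D' D q) l
        ((v ⊗ₜ u) ⊗ₜ t) ((v' ⊗ₜ u') ⊗ₜ t') k := by
  have hb₁ : D.base (pr₁ p) = D.base (pr₁ q) := h
  have hb₂ : D'.base (pr₁ (pr₂ p)) = D'.base (pr₁ (pr₂ q)) :=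
    (congrArg G₂.π (fp.cond p)).symm.trans
      ((π_pr₂ hb₁).trans (congrArg G₂.π (fp.cond q)))
  obtain ⟨n, hn⟩ := G₃.exists_ne_zero (y := D'.tgt (pr₁ (pr₂ p)))
    (y' := D'.tgt (pr₁ (pr₂ q))) (π_pr₂ hb₂)
  obtain ⟨m, hm⟩ := G₂.exists_ne_zero (y := D.tgt (pr₁ p)) (y' := D.tgt (pr₁ q)) (π_pr₂ hb₁)
  obtain ⟨v', hv'⟩ := exists_act (D := D) (z := pr₁ p) (x := pr₁ q) rfl rfl rfl rfl l v hm
  obtain ⟨u', hu'⟩ := exists_act (D := D') (z := pr₁ (pr₂ p)) (x := pr₁ (pr₂ q))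
    (fp.cond p).symm (fp.cond q).symm rfl rfl m u hn
  obtain ⟨t', ht'⟩ := exists_act (D := D'') (z := pr₂ (pr₂ p)) (x := pr₂ (pr₂ q))
    (fp.cond (pr₂ p)).symm (fp.cond (pr₂ q)).symm rfl rfl n t hk
  refine ⟨v', u', t', ?_, ?_⟩
  · have h1 := Act.tmul (D := D') (D' := D'') (p := pr₂ p) (q := pr₂ q) hu' ht'
    exact Act.tmul (D := D) (D' := D''.comp D') (p := p) (q := q) hv' h1
  · have h1 := Act.tmul (D := D) (D' := D') (p := pr₁ (assocMap D'' D' D p))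
      (q := pr₁ (assocMap D'' D' D q)) hv' hu'
    exact Act.tmul (D := D'.comp D) (D' := D'') (p := assocMap D'' D' D p)
      (q := assocMap D'' D' D q) h1 ht'

lemma assocFib_comm (D'' : OneMorData G₃ G₄) (D' : OneMorData G₂ G₃) (D : OneMorData G₁ G₂)
    (p q : ((D''.comp D').comp D).Z) :
    Comm ((D''.comp D').comp D) (D''.comp (D'.comp D)) (assocFib D'' D' D p).toLinearMap
      (assocFib D'' D' D q).toLinearMap := by
  refine Comm.of_forall_exists ?_
  rintro _ _ _ _ h _ rfl rfl rfl rfl l k hk w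
  refine tensor_induction₃ (V := D.A.fib (pr₁ q)) (U := D'.A.fib (pr₁ (pr₂ q)))
    (T := D''.A.fib (pr₂ (pr₂ q))) (Q := fun w => ∃ v', ((D''.comp D').comp D).Act (z := p) (x := q)
      l w v' k ∧ (D''.comp (D'.comp D)).Act l ((assocFib D'' D' D q).toLinearMap w)
        ((assocFib D'' D' D p).toLinearMap v') k) ?_ ?_ ?_ w
  · exact exists_act_zero (D := (D''.comp D').comp D) (D' := D''.comp (D'.comp D)) rfl rfl rfl rfl
      rfl rfl l k
  · exact fun a b ha hb => exists_act_add ha hb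
  · intro v u t
    obtain ⟨v', u', t', h1, h2⟩ := assocFib_comm_tmul D'' D' D p q l hk v u t
    exact ⟨_, h1, h2⟩

end OneMorData

/-! ### Additivity of the normalised trace of the curvature -/

namespace HVB

variable {X : Mfd.{u}}

lemma IsMor.congr {E E' : HVB X} {T T' : ∀ x, E.fib x →ₗ[ℂ] E'.fib x} (h : IsMor E E' T)
    (h' : ∀ x, T' x = T x) : IsMor E E' T' := by
  rwa [show T' = T from funext h']

/-- Ranks multiply, and each summand of the trace carries the rank of the other factor, so
normalised traces add. The sum `(b - a) + (c - b)` telescopes. -/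
lemma tensor_pb_curv {Z Z' : Mfd.{u}} {A : HVB Z} {A' : HVB Z'} (hA : A.IsVB) (hA' : A'.IsVB)
    {f : X → Z} {f' : X → Z'} (hf : Smooth f) (hf' : Smooth f') (hr : 0 < A.rank)
    (hr' : 0 < A'.rank) {i : A.ι} {j : A'.ι} {x : X} (hi : f x ∈ A.dom i) (hj : f' x ∈ A'.dom j)
    {v w : Tan x} {a b c : ℝ}
    (h : (1 / (A.rank : ℂ)) * A.trCurv i (f x) (D f x v) (D f x w) = ((b - a : ℝ) : ℂ))
    (h' : (1 / (A'.rank : ℂ)) * A'.trCurv j (f' x) (D f' x v) (D f' x w) = ((c - b : ℝ) : ℂ)) :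
    (1 / (((A.pb f).tensor (A'.pb f')).rank : ℂ)) * ((A.pb f).tensor (A'.pb f')).trCurv (i, j) x v w
      = ((c - a : ℝ) : ℂ) := by
  rw [trCurv_tensor (hA.pb hf) (hA'.pb hf') hi hj, trCurv_pb hA hf hi, trCurv_pb hA' hf' hj]
  have n : (A.rank : ℂ) ≠ 0 := Nat.cast_ne_zero.2 hr.ne'
  have n' : (A'.rank : ℂ) ≠ 0 := Nat.cast_ne_zero.2 hr'.ne'
  have e : (((A.pb f).tensor (A'.pb f')).rank : ℂ) = A.rank * A'.rank := by
    change ((Fintype.card (A.κ × A'.κ) : ℕ) : ℂ) = _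
    rw [Fintype.card_prod, Nat.cast_mul]
  rw [e]
  push_cast at h h' ⊢
  rw [show (c : ℂ) - a = (b - a) + (c - b) by ring, ← h, ← h']
  field_simp

end HVB

lemma eq_mul_chain_of_tmul {V U W W' K L L' N N' N'' : Type*} [AddCommGroup V] [Module ℂ V]
    [AddCommGroup U] [Module ℂ U] [AddCommGroup W] [Module ℂ W] [AddCommGroup W'] [Module ℂ W']
    [AddCommGroup K] [Module ℂ K] [AddCommGroup L] [Module ℂ L] [AddCommGroup L'] [Module ℂ L']
    [AddCommGroup N] [Module ℂ N] [AddCommGroup N'] [Module ℂ N'] [AddCommGroup N'']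
    [Module ℂ N''] (f₁₃ : K ⊗[ℂ] (V ⊗[ℂ] U) ≃ₗ[ℂ] W ⊗[ℂ] N'')
    (f₂₃ : L' ⊗[ℂ] (V ⊗[ℂ] U) ≃ₗ[ℂ] W' ⊗[ℂ] N') (f₁₂ : L ⊗[ℂ] W' ≃ₗ[ℂ] W ⊗[ℂ] N)
    (g : N ⊗[ℂ] N' ≃ₗ[ℂ] N'') {k : K} {l : L} {l' : L'}
    (H : ∀ v u, f₁₃ (k ⊗ₜ (v ⊗ₜ u)) = g.lTensor _ (TensorProduct.assoc ℂ _ _ _ (f₁₂.rTensor _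
      ((TensorProduct.assoc ℂ _ _ _).symm (l ⊗ₜ f₂₃ (l' ⊗ₜ (v ⊗ₜ u))))))) (a : V ⊗[ℂ] U) :
    f₁₃ (k ⊗ₜ a) = g.lTensor _ (TensorProduct.assoc ℂ _ _ _ (f₁₂.rTensor _
      ((TensorProduct.assoc ℂ _ _ _).symm (l ⊗ₜ f₂₃ (l' ⊗ₜ a))))) := by
  induction a using TensorProduct.induction_on with
  | zero => simp only [TensorProduct.tmul_zero, map_zero]
  | tmul v u => exact H v u
  | add a b ha hb => simp only [TensorProduct.tmul_add, map_add, ha, hb]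

/-! ### The identity and the composition are 1-morphisms -/

namespace OneMorData

variable {M : Mfd.{u}} {G₁ G₂ G₃ G₄ : BundleGerbe M}

lemma src₂_smooth (D : OneMorData G₁ G₂) : Smooth D.src₂ :=
  Smooth.mk (D.src_subm.smooth.comp fp.smooth_fst) (D.src_subm.smooth.comp fp.smooth_snd) _

lemma tgt₂_smooth (D : OneMorData G₁ G₂) : Smooth D.tgt₂ :=
  Smooth.mk (D.tgt_subm.smooth.comp fp.smooth_fst) (D.tgt_subm.smooth.comp fp.smooth_snd) _

/-- The isomorphism `α` over two maps to `Z` with equal images in `M`. -/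
lemma IsOneMor.isMor_α {D : OneMorData G₁ G₂} (hD : D.IsOneMor) {W : Mfd.{u}} {g : W → D.ZZ}
    (hg : Smooth g) :
    HVB.IsMor ((G₁.L.pb fun w => D.src₂ (g w)).tensor (D.A.pb fun w => pr₂ (g w)))
      ((D.A.pb fun w => pr₁ (g w)).tensor (G₂.L.pb fun w => D.tgt₂ (g w)))
      (fun w => (D.α (fp.cond (g w))).toLinearMap) :=
  hD.α_mor.tensor_tensor_pb G₁.isVB hD.isVB hD.isVB G₂.isVB D.src₂_smooth fp.smooth_snd
    fp.smooth_fst D.tgt₂_smooth hg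

/-- Over `w ↦ (f w, f' w)` the map `d` is the inverse of a contraction with `t`, followed by the
inverse of `α` and by another contraction. All three are morphisms. -/
lemma isMor_d {D : OneMorData G₁ G₂} (hD : D.IsOneMor) {W : Mfd.{u}} {f f' : W → D.Z}
    (hf : Smooth f) (hf' : Smooth f') (h : ∀ w, D.ζ (f w) = D.ζ (f' w)) :
    HVB.IsMor (D.A.pb f) (D.A.pb f') (fun w => (D.d (h w)).toLinearMap) := by
  let g : W → D.ZZ := fun w => fp.mk (f w) (f' w) (congrArg toM (h w))
  have hg : Smooth g := Smooth.mk hf hf' _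
  have hA := hD.isVB.pb hf
  have hA' := hD.isVB.pb hf'
  have h₁ := G₁.isVB.pb (D.src₂_smooth.comp hg)
  have h₂ := G₂.isVB.pb (D.tgt₂_smooth.comp hg)
  have hr := (BundleGerbe.isMor_contract_right hA (D.tgt₂_smooth.comp hg)
    (fun w => tgt_eq (h w))).symm (hA.tensor h₂) hA
  have hl := BundleGerbe.isMor_contract_left hA' (D.src₂_smooth.comp hg) (fun w => src_eq (h w))
  exact (hl.comp (((hD.isMor_α hg).symm (h₁.tensor hA') (hA.tensor h₂)).comp hr hA
    (hA.tensor h₂) (h₁.tensor hA')) hA (h₁.tensor hA') hA')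

lemma one_isOneMor (G : BundleGerbe M) : (one G).IsOneMor where
  isVB := G.isVB
  rank_pos := by
    change 0 < G.L.rank
    rw [G.rank_eq]
    exact one_pos
  α_mor := by
    -- Over a point `((a, b), (c, d))` these two maps are `(a, c, d)` and `(a, b, d)`. The structure
    -- map is `μ` over the first, followed by the inverse of `μ` over the second.
    let g₁ : (one G).ZZ → Y3 G.π G.hπ := fun p =>
      fp.mk (fp.mk (pr₁ (pr₁ p)) (pr₁ (pr₂ p)) (fp.cond p)) (pr₂ (pr₂ p))
        ((fp.cond p).trans (fp.cond (pr₂ p)))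
    let g₂ : (one G).ZZ → Y3 G.π G.hπ := fun p =>
      fp.mk (pr₁ p) (pr₂ (pr₂ p)) ((fp.cond p).trans (fp.cond (pr₂ p)))
    have hs₁ : Smooth (pr₁ : (one G).ZZ → Y2 G.π G.hπ) := fp.smooth_fst
    have hs₂ : Smooth (pr₂ : (one G).ZZ → Y2 G.π G.hπ) := fp.smooth_snd
    have hg₁ : Smooth g₁ := Smooth.mk (Smooth.mk (Smooth.fst hs₁) (Smooth.fst hs₂) _) (Smooth.snd hs₂) _
    have hg₂ : Smooth g₂ := Smooth.mk hs₁ (Smooth.snd hs₂) _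
    have h₁ := G.μ_mor.tensor_pb G.isVB G.isVB G.isVB pr₁₂_smooth pr₂₃_smooth pr₁₃_smooth hg₁
    have h₂ := G.μ_mor.tensor_pb G.isVB G.isVB G.isVB pr₁₂_smooth pr₂₃_smooth pr₁₃_smooth hg₂
    have v₁ := (G.isVB.pb (pr₁₂_smooth.comp hg₁)).tensor (G.isVB.pb (pr₂₃_smooth.comp hg₁))
    have v₂ := (G.isVB.pb (pr₁₂_smooth.comp hg₂)).tensor (G.isVB.pb (pr₂₃_smooth.comp hg₂))
    have v₃ := G.isVB.pb (pr₁₃_smooth.comp hg₁)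
    exact (h₂.symm v₂ v₃).comp h₁ v₁ v₃ v₂
  curv_eq i z hz v w := by
    change (1 / (G.L.rank : ℂ)) * G.L.trCurv i z v w = _
    rw [G.rank_eq, Nat.cast_one, div_one, one_mul]
    exact G.curv_eq i z hz v w
  α_μ {z₁ z₂ z₃} h₁₂ h₂₃ l l' a := by
    obtain ⟨m', hm'⟩ := G.exists_ne_zero (y := pr₂ z₂) (y' := pr₂ z₃)
      (π_pr₂ (G₁ := G) (G₂ := G) h₂₃)
    obtain ⟨m, hm⟩ := G.exists_ne_zero (y := pr₂ z₁) (y' := pr₂ z₂)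
      (π_pr₂ (G₁ := G) (G₂ := G) h₁₂)
    obtain ⟨a', ha'⟩ := exists_act (D := one G) (z := z₂) (x := z₃) rfl rfl rfl rfl l' a hm'
    obtain ⟨a'', ha''⟩ := exists_act (D := one G) (z := z₁) (x := z₂) rfl rfl rfl rfl l a' hm
    refine Eq.trans ?_ (mul_chain ((one G).α h₁₂) (G.μ _ _) (act_iff.1 ha') (act_iff.1 ha'')).symm
    -- What remains is `(l l') a = a'' (m m')`, given `l' a = a' m'` and `l a' = a'' m`. It follows
    -- by associating three times.
    refine act_iff.1 ((one_act_iff (hy := fp.cond z₁) (hx := fp.cond z₃)).2 ?_)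
    have e₁ := (one_act_iff (hy := fp.cond z₁) (hx := fp.cond z₂)).1 ha''
    have e₂ := (one_act_iff (hy := fp.cond z₂) (hx := fp.cond z₃)).1 ha'
    refine (G.μ_assoc _ _ _ l l' a).trans ((congrArg (fun x => G.μ _ _ (l ⊗ₜ x)) e₂).trans ?_)
    refine (G.μ_assoc _ _ _ l a' m').symm.trans
      ((congrArg (fun x => G.μ _ _ (x ⊗ₜ m')) e₁).trans ?_)
    exact G.μ_assoc _ _ _ a'' m m'

section comp

variable {D : OneMorData G₁ G₂} {D' : OneMorData G₂ G₃}

lemma comp_isVB (hD' : D'.IsOneMor) (hD : D.IsOneMor) : (D'.comp D).A.IsVB :=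
  (hD.isVB.pb fp.smooth_fst).tensor (hD'.isVB.pb fp.smooth_snd)

/-- The structure map is factored into elementary morphisms. Besides `α`, `α'` and rebracketings
there are `s₀` and `s₇`, which distribute the pullback over the tensor product, and `s₄`, which
identifies the two pullbacks of `L₂` along maps that agree on `Z ×_{Y₂} Z'`. -/
lemma comp_α_mor (hD' : D'.IsOneMor) (hD : D.IsOneMor) :
    HVB.IsMor ((G₁.L.pb (D'.comp D).src₂).tensor ((D'.comp D).A.pb pr₂))
      (((D'.comp D).A.pb pr₁).tensor (G₃.L.pb (D'.comp D).tgt₂))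
      (fun p => ((D'.comp D).α (fp.cond p)).toLinearMap) := by
  have hs₁ : Smooth (pr₁ : (D'.comp D).ZZ → compZ D' D) := fp.smooth_fst
  have hs₂ : Smooth (pr₂ : (D'.comp D).ZZ → compZ D' D) := fp.smooth_snd
  let g : (D'.comp D).ZZ → D.ZZ := fun p => fp.mk (pr₁ (pr₁ p)) (pr₁ (pr₂ p)) (fp.cond p)
  have hg : Smooth g := Smooth.mk (Smooth.fst hs₁) (Smooth.fst hs₂) _
  let g' : (D'.comp D).ZZ → D'.ZZ := fun p => fp.mk (pr₂ (pr₁ p)) (pr₂ (pr₂ p))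
    ((congrArg G₂.π (fp.cond (pr₁ p))).symm.trans ((π_pr₂ (fp.cond (g p))).trans
      (congrArg G₂.π (fp.cond (pr₂ p)))))
  have hg' : Smooth g' := Smooth.mk (Smooth.snd hs₁) (Smooth.snd hs₂) _
  have vL₁ := G₁.isVB.pb (D.src₂_smooth.comp hg)
  have vL₂ := G₂.isVB.pb (D.tgt₂_smooth.comp hg)
  have vL₂' := G₂.isVB.pb (D'.src₂_smooth.comp hg')
  have vL₃ := G₃.isVB.pb (D'.tgt₂_smooth.comp hg')
  have vA₁ := hD.isVB.pb (Smooth.fst hs₁)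
  have vA₂ := hD.isVB.pb (Smooth.fst hs₂)
  have vA₁' := hD'.isVB.pb (Smooth.snd hs₁)
  have vA₂' := hD'.isVB.pb (Smooth.snd hs₂)
  have vC₁ := (comp_isVB hD' hD).pb hs₁
  have vC₂ := (comp_isVB hD' hD).pb hs₂
  have s₀ := (vL₁.compat.tensor (HVB.IsMor.tensorPb (f₁ := (pr₁ : compZ D' D → D.Z))
    (f₂ := (pr₂ : compZ D' D → D'.Z)) hD.isVB hD'.isVB fp.smooth_fst fp.smooth_snd hs₂) vL₁ vL₁ vC₂ (vA₂.tensor vA₂')).congr (fun _ => TensorProduct.map_id.symm)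
  have s₁ := (HVB.IsMor.assoc vL₁ vA₂ vA₂').symm ((vL₁.tensor vA₂).tensor vA₂')
    (vL₁.tensor (vA₂.tensor vA₂'))
  have s₂ := (hD.isMor_α hg).tensor vA₂'.compat (vL₁.tensor vA₂) (vA₁.tensor vL₂) vA₂' vA₂'
  have s₃ := HVB.IsMor.assoc vA₁ vL₂ vA₂'
  have s₄ := vA₁.compat.tensor ((HVB.IsMor.tr G₂.isVB (D.tgt₂_smooth.comp hg) (g := fun p =>
    D'.src₂ (g' p)) fun p => fp.ext (fp.cond (pr₁ p)) (fp.cond (pr₂ p))).tensor vA₂'.compat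
      vL₂ vL₂' vA₂' vA₂') vA₁ vA₁ (vL₂.tensor vA₂') (vL₂'.tensor vA₂')
  have s₅ := vA₁.compat.tensor (hD'.isMor_α hg') vA₁ vA₁ (vL₂'.tensor vA₂') (vA₁'.tensor vL₃)
  have s₆ := (HVB.IsMor.assoc vA₁ vA₁' vL₃).symm ((vA₁.tensor vA₁').tensor vL₃)
    (vA₁.tensor (vA₁'.tensor vL₃))
  have s₇ := ((HVB.IsMor.tensorPb_symm (f₁ := (pr₁ : compZ D' D → D.Z))
    (f₂ := (pr₂ : compZ D' D → D'.Z)) hD.isVB hD'.isVB fp.smooth_fst fp.smooth_snd hs₁).tensor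
    vL₃.compat (vA₁.tensor vA₁') vC₁ vL₃ vL₃).congr (fun _ => TensorProduct.map_id.symm)
  have v₀ := vL₁.tensor vC₂
  have v₁ := vL₁.tensor (vA₂.tensor vA₂')
  have v₂ := (vL₁.tensor vA₂).tensor vA₂'
  have v₃ := (vA₁.tensor vL₂).tensor vA₂'
  have v₄ := vA₁.tensor (vL₂.tensor vA₂')
  have v₅ := vA₁.tensor (vL₂'.tensor vA₂')
  have v₆ := vA₁.tensor (vA₁'.tensor vL₃)
  have v₇ := (vA₁.tensor vA₁').tensor vL₃
  have v₈ := vC₁.tensor vL₃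
  have r₁ := s₁.comp s₀ v₀ v₁ v₂
  have r₂ := s₂.comp r₁ v₀ v₂ v₃
  have r₃ := s₃.comp r₂ v₀ v₃ v₄
  have r₄ := s₄.comp r₃ v₀ v₄ v₅
  have r₅ := s₅.comp r₄ v₀ v₅ v₆
  have r₆ := s₆.comp r₅ v₀ v₆ v₇
  have r₇ := s₇.comp r₆ v₀ v₇ v₈
  exact r₇

lemma comp_curv_eq (hD' : D'.IsOneMor) (hD : D.IsOneMor) (i) (z : (D'.comp D).Z)
    (hz : z ∈ (D'.comp D).A.dom i) (v w : Tan z) :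
    (1 / ((D'.comp D).A.rank : ℂ)) * (D'.comp D).A.trCurv i z v w =
      ((G₃.C.pb (D'.comp D).tgt z v w - G₁.C.pb (D'.comp D).src z v w : ℝ) : ℂ) := by
  obtain ⟨i, j⟩ := i
  have s₁ : Smooth (pr₁ : compZ D' D → D.Z) := fp.smooth_fst
  have s₂ : Smooth (pr₂ : compZ D' D → D'.Z) := fp.smooth_snd
  have c₁ := hD.curv_eq i (pr₁ z) hz.1 (BGrb.D pr₁ z v) (BGrb.D pr₁ z w)
  have c₂ := hD'.curv_eq j (pr₂ z) hz.2 (BGrb.D pr₂ z v) (BGrb.D pr₂ z w)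
  have k₁ : G₁.C.pb D.src (pr₁ z) (BGrb.D pr₁ z v) (BGrb.D pr₁ z w)
      = G₁.C.pb (D'.comp D).src z v w := by
    refine (congrArg₂ (fun a b => G₁.C.toFun _ a b) (D_comp D.src_subm.smooth s₁ z v)
      (D_comp D.src_subm.smooth s₁ z w)).symm
  have k₃ : G₃.C.pb D'.tgt (pr₂ z) (BGrb.D pr₂ z v) (BGrb.D pr₂ z w)
      = G₃.C.pb (D'.comp D).tgt z v w := by
    refine (congrArg₂ (fun a b => G₃.C.toFun _ a b) (D_comp D'.tgt_subm.smooth s₂ z v)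
      (D_comp D'.tgt_subm.smooth s₂ z w)).symm
  -- The two maps from `Z ×_{Y₂} Z'` to `Y₂` coincide, so the contributions of `C₂` from the two
  -- factors are equal and will cancel.
  have k₂ : G₂.C.pb D.tgt (pr₁ z) (BGrb.D pr₁ z v) (BGrb.D pr₁ z w)
      = G₂.C.pb D'.src (pr₂ z) (BGrb.D pr₂ z v) (BGrb.D pr₂ z w) := by
    have e₁ : G₂.C.pb (fun z : compZ D' D => D.tgt (pr₁ z)) z v w = _ :=
      congrArg₂ (fun a b => G₂.C.toFun _ a b) (D_comp D.tgt_subm.smooth s₁ z v)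
        (D_comp D.tgt_subm.smooth s₁ z w)
    have e₂ : G₂.C.pb (fun z : compZ D' D => D'.src (pr₂ z)) z v w = _ :=
      congrArg₂ (fun a b => G₂.C.toFun _ a b) (D_comp D'.src_subm.smooth s₂ z v)
        (D_comp D'.src_subm.smooth s₂ z w)
    have e₃ : (fun z : compZ D' D => D.tgt (pr₁ z)) = fun z => D'.src (pr₂ z) :=
      funext fun z => fp.cond z
    exact e₁.symm.trans ((congrArg (fun f => G₂.C.pb f z v w) e₃).trans e₂)
  rw [← k₁, ← k₃]
  refine HVB.tensor_pb_curv hD.isVB hD'.isVB s₁ s₂ hD.rank_pos hD'.rank_pos hz.1 hz.2 c₁ ?_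
  rw [k₂]
  exact c₂

/-- On pure tensors, split both steps through nonzero elements `m` and `m'` of `L₂`.
Multiplicativity of `A` turns them into the product of `m` and `m'`, which is the input needed for
multiplicativity of `A'`. -/
lemma comp_α_μ (hD' : D'.IsOneMor) (hD : D.IsOneMor) {z₁ z₂ z₃ : (D'.comp D).Z}
    (h₁₂ : (D'.comp D).base z₁ = (D'.comp D).base z₂)
    (h₂₃ : (D'.comp D).base z₂ = (D'.comp D).base z₃)
    (l : G₁.Lf ((D'.comp D).src z₁) ((D'.comp D).src z₂) h₁₂)
    (l' : G₁.Lf ((D'.comp D).src z₂) ((D'.comp D).src z₃) h₂₃) (a : (D'.comp D).A.fib z₃) :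
    (D'.comp D).α (h₁₂.trans h₂₃) (G₁.μ h₁₂ h₂₃ (l ⊗ₜ l') ⊗ₜ a)
      = (G₃.μ (π_pr₂ h₁₂) (π_pr₂ h₂₃)).lTensor _ (TensorProduct.assoc ℂ _ _ _
          (((D'.comp D).α h₁₂).rTensor _ ((TensorProduct.assoc ℂ _ _ _).symm
            (l ⊗ₜ (D'.comp D).α h₂₃ (l' ⊗ₜ a))))) := by
  refine eq_mul_chain_of_tmul (V := D.A.fib (pr₁ z₃)) (U := D'.A.fib (pr₂ z₃))
    ((D'.comp D).α (h₁₂.trans h₂₃)) ((D'.comp D).α h₂₃) ((D'.comp D).α h₁₂)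
    (G₃.μ (π_pr₂ h₁₂) (π_pr₂ h₂₃)) (fun v u => ?_) a
  obtain ⟨n', hn'⟩ := G₃.exists_ne_zero (y := (D'.comp D).tgt z₂) (y' := (D'.comp D).tgt z₃)
    (π_pr₂ (p := (D'.comp D).ζ z₂) (q := (D'.comp D).ζ z₃) h₂₃)
  obtain ⟨n, hn⟩ := G₃.exists_ne_zero (y := (D'.comp D).tgt z₁) (y' := (D'.comp D).tgt z₂)
    (π_pr₂ (p := (D'.comp D).ζ z₁) (q := (D'.comp D).ζ z₂) h₁₂)
  obtain ⟨m', v', u', hm', a₁, b₁⟩ := comp_exists_act (p := z₂) (q := z₃) l' v u hn'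
  obtain ⟨m, v'', u'', hm, a₂, b₂⟩ := comp_exists_act (p := z₁) (q := z₂) l v' u' hn
  have t₁ := Act.tmul (p := z₂) (q := z₃) a₁ b₁
  have t₂ := Act.tmul (p := z₁) (q := z₂) a₂ b₂
  have t₃ := Act.tmul (p := z₁) (q := z₃) (a₂.mul hD a₁) (b₂.mul hD' b₁)
  exact (act_iff.1 t₃).trans
    (mul_chain ((D'.comp D).α h₁₂) (G₃.μ _ _) (act_iff.1 t₁) (act_iff.1 t₂)).symm

lemma comp_isOneMor (hD' : D'.IsOneMor) (hD : D.IsOneMor) : (D'.comp D).IsOneMor where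
  isVB := comp_isVB hD' hD
  rank_pos := by
    change 0 < Fintype.card (D.A.κ × D'.A.κ)
    rw [Fintype.card_prod]
    exact Nat.mul_pos hD.rank_pos hD'.rank_pos
  α_mor := comp_α_mor hD' hD
  curv_eq := comp_curv_eq hD' hD
  α_μ := comp_α_μ hD' hD

end comp

end OneMorData

/-! ### Symmetry of fibre products -/

section

variable {X Y S : Mfd.{u}} {f : X → S} {g : Y → S} {hf : Smooth f} {hg : SurjSubm g}
  {hf' : SurjSubm f} {hg' : Smooth g}

/-- The exchange of the factors of a fibre product. -/
def fp.swap (p : fp f g hf hg) : fp g f hg' hf' := fp.mk (pr₂ p) (pr₁ p) (fp.cond p).symm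

lemma fp.swap_smooth : Smooth (fp.swap : fp f g hf hg → fp g f hg' hf') :=
  Smooth.mk fp.smooth_snd fp.smooth_fst _

lemma fp.swap_subm : SurjSubm (fp.swap : fp f g hf hg → fp g f hg' hf') :=
  SurjSubm.of_section fp.swap_smooth (fun p => ⟨fp.swap p, rfl⟩)
    fun _ => ⟨fp.swap, fp.swap_smooth _, rfl, Filter.Eventually.of_forall fun _ => rfl⟩

end

/-! ### Strict associativity of the composition of 1-morphisms -/

namespace OneMorData

variable {M : Mfd.{u}} {G₁ G₂ G₃ G₄ : BundleGerbe M}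

lemma tr_comm (D : OneMorData G₁ G₂) {z z' x x' : D.Z} (hz : z = z') (hx : x = x') :
    Comm D D (D.A.tr hz).toLinearMap (D.A.tr hx).toLinearMap := by
  subst hz hx
  exact Comm.id

lemma ζ_assocMap (D'' : OneMorData G₃ G₄) (D' : OneMorData G₂ G₃) (D : OneMorData G₁ G₂)
    (z : ((D''.comp D').comp D).Z) :
    (D''.comp (D'.comp D)).ζ (assocMap D'' D' D z) = ((D''.comp D').comp D).ζ z := rfl

lemma assocMap_smooth (D'' : OneMorData G₃ G₄) (D' : OneMorData G₂ G₃) (D : OneMorData G₁ G₂) :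
    Smooth (assocMap D'' D' D) := by
  have h₁ : Smooth (pr₁ : compZ (D''.comp D') D → D.Z) := fp.smooth_fst
  have h₂ : Smooth (pr₂ : compZ (D''.comp D') D → compZ D'' D') := fp.smooth_snd
  exact Smooth.mk (Smooth.mk h₁ (Smooth.fst h₂) _) (Smooth.snd h₂) _

/-- Rebracketing is a morphism once both sides are written as triple tensor products of pullbacks to
one base. The remaining links distribute pullbacks over the nested tensor products. -/
lemma assocFib_isMor {D'' : OneMorData G₃ G₄} {D' : OneMorData G₂ G₃} {D : OneMorData G₁ G₂}
    (hD'' : D''.IsOneMor) (hD' : D'.IsOneMor) (hD : D.IsOneMor) :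
    HVB.IsMor ((D''.comp D').comp D).A ((D''.comp (D'.comp D)).A.pb (assocMap D'' D' D))
      (fun z => (assocFib D'' D' D z).toLinearMap) := by
  have h₁ : Smooth (pr₁ : compZ (D''.comp D') D → D.Z) := fp.smooth_fst
  have h₂ : Smooth (pr₂ : compZ (D''.comp D') D → compZ D'' D') := fp.smooth_snd
  have ha := assocMap_smooth D'' D' D
  have ha₁ : Smooth (fun z => (pr₁ (assocMap D'' D' D z) : compZ D' D)) := fp.smooth_fst.comp ha
  have vA := hD.isVB.pb h₁
  have vA' := hD'.isVB.pb (Smooth.fst h₂)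
  have vA'' := hD''.isVB.pb (Smooth.snd h₂)
  have vC := (comp_isVB hD'' hD').pb h₂
  have vC' := (comp_isVB hD' hD).pb ha₁
  have vE := (comp_isVB hD'' (comp_isOneMor hD' hD)).pb ha
  have s₀ := (vA.compat.tensor (HVB.IsMor.tensorPb (f₁ := (pr₁ : compZ D'' D' → D'.Z))
    (f₂ := (pr₂ : compZ D'' D' → D''.Z)) hD'.isVB hD''.isVB fp.smooth_fst fp.smooth_snd h₂)
    vA vA vC (vA'.tensor vA'')).congr (fun _ => TensorProduct.map_id.symm)
  have s₁ := (HVB.IsMor.assoc vA vA' vA'').symm ((vA.tensor vA').tensor vA'')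
    (vA.tensor (vA'.tensor vA''))
  have s₂ := ((HVB.IsMor.tensorPb_symm (f₁ := (pr₁ : compZ D' D → D.Z))
    (f₂ := (pr₂ : compZ D' D → D'.Z)) hD.isVB hD'.isVB fp.smooth_fst fp.smooth_snd ha₁).tensor
    vA''.compat (vA.tensor vA') vC' vA'' vA'').congr (fun _ => TensorProduct.map_id.symm)
  have s₃ := HVB.IsMor.tensorPb_symm (E₁ := (D'.comp D).A)
    (f₁ := (pr₁ : compZ D'' (D'.comp D) → compZ D' D))
    (f₂ := (pr₂ : compZ D'' (D'.comp D) → D''.Z)) (comp_isVB hD' hD) hD''.isVB fp.smooth_fst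
    fp.smooth_snd ha
  have v₀ := vA.tensor vC
  have v₁ := vA.tensor (vA'.tensor vA'')
  have v₂ := (vA.tensor vA').tensor vA''
  have v₃ := vC'.tensor vA''
  have r₁ := s₁.comp s₀ v₀ v₁ v₂
  have r₂ := s₂.comp r₁ v₀ v₂ v₃
  exact s₃.comp r₂ v₀ v₃ vE

lemma assoc_isStrictIso {D'' : OneMorData G₃ G₄} {D' : OneMorData G₂ G₃} {D : OneMorData G₁ G₂}
    (hD'' : D''.IsOneMor) (hD' : D'.IsOneMor) (hD : D.IsOneMor) :
    IsStrictIso ((D''.comp D').comp D) (D''.comp (D'.comp D)) (assocMap D'' D' D)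
      (assocFib D'' D' D) where
  smooth := assocMap_smooth D'' D' D
  inverse := by
    have h₁ : Smooth (pr₁ : compZ D'' (D'.comp D) → compZ D' D) := fp.smooth_fst
    have h₂ : Smooth (pr₂ : compZ D'' (D'.comp D) → D''.Z) := fp.smooth_snd
    refine ⟨fun z => fp.mk (pr₁ (pr₁ z)) (fp.mk (pr₂ (pr₁ z)) (pr₂ z) (fp.cond z) : compZ D'' D')
      (fp.cond (pr₁ z)), ?_, fun _ => rfl, fun _ => rfl⟩
    exact Smooth.mk (Smooth.fst h₁) (Smooth.mk (Smooth.snd h₁) h₂ _) _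
  over_P := ζ_assocMap D'' D' D
  isMor := assocFib_isMor hD'' hD' hD
  comm {z z'} h h' l a :=
    ((comm_iff (D := (D''.comp D').comp D) (D' := D''.comp (D'.comp D)) (ζ_assocMap D'' D' D z).symm
      (ζ_assocMap D'' D' D z').symm h h').1 (assocFib_comm D'' D' D z z') l a).symm

end OneMorData

/-! ### The triples satisfy the axioms of 2-morphisms -/

namespace Triple

open OneMorData

variable {M : Mfd.{u}} {G₁ G₂ G₃ G₄ : BundleGerbe M}

section

variable {D D' D'' : OneMorData G₁ G₂}

lemma IsTwoMor.comm_β {T : Triple D D'} (h : T.IsTwoMor) (w w' : T.W) :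
    Comm D D' (T.β w) (T.β w') := by
  intro y₁ x₁ y₂ x₂ k k' l v v' m hm ha
  have ha' := ha
  obtain ⟨rfl, rfl, -, -, -⟩ := ha'
  have hb : D'.base (pr₂ (T.om w)) = D'.base (pr₂ (T.om w')) :=
    (congrArg toM (fp.cond (T.om w))).symm.trans (k.trans (congrArg toM (fp.cond (T.om w'))))
  exact (comm_iff (fp.cond (T.om w)) (fp.cond (T.om w')) k hb).2 (h.comm k hb) l v v' m hm ha

lemma IsTwoMor.of_comm {T : Triple D D'}
    (h : HVB.IsMor (D.A.pb fun w => pr₁ (T.om w)) (D'.A.pb fun w => pr₂ (T.om w)) T.β)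
    (h' : ∀ w w', Comm D D' (T.β w) (T.β w')) : T.IsTwoMor :=
  ⟨h, fun {w w'} hb hb' => (comm_iff (fp.cond (T.om w)) (fp.cond (T.om w')) hb hb').1 (h' w w')⟩

lemma one_isTwoMor (hD : D.IsOneMor) : (one D).IsTwoMor :=
  IsTwoMor.of_comm (isMor_d hD fp.smooth_fst fp.smooth_snd fun w => fp.cond w)
    fun w w' => d_comm hD (fp.cond w) (fp.cond w')

lemma vcomp_isTwoMor (hD : D.IsOneMor) (hD' : D'.IsOneMor) (hD'' : D''.IsOneMor)
    {T' : Triple D' D''} {T : Triple D D'} (hT' : T'.IsTwoMor) (hT : T.IsTwoMor) :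
    (T'.vcomp T).IsTwoMor := by
  refine IsTwoMor.of_comm ?_ fun w w' => ?_
  · have s₁ : Smooth (pr₁ : (T'.vcomp T).W → T.W) := fp.smooth_fst
    have s₂ : Smooth (pr₂ : (T'.vcomp T).W → T'.W) := fp.smooth_snd
    have o₁ := Smooth.fst T.om_subm.smooth
    have o₂ := Smooth.snd T.om_subm.smooth
    have o₁' := Smooth.fst T'.om_subm.smooth
    have o₂' := Smooth.snd T'.om_subm.smooth
    have a₁ := hT.isMor.pb_pb hD.isVB hD'.isVB o₁ o₂ s₁
    have a₂ := hT'.isMor.pb_pb hD'.isVB hD''.isVB o₁' o₂' s₂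
    have a₃ := HVB.IsMor.tr hD'.isVB (o₂.comp s₁) (g := fun w : (T'.vcomp T).W =>
      pr₁ (T'.om (pr₂ w))) fun w => fp.cond w
    have v₁ := hD.isVB.pb (o₁.comp s₁)
    have v₂ := hD'.isVB.pb (o₂.comp s₁)
    have v₃ := hD'.isVB.pb (o₁'.comp s₂)
    have v₄ := hD''.isVB.pb (o₂'.comp s₂)
    exact a₂.comp (a₃.comp a₁ v₁ v₂ v₃) v₁ v₃ v₄
  · exact (hT'.comm_β (pr₂ w) (pr₂ w')).comp
      ((tr_comm D' (fp.cond w) (fp.cond w')).comp (hT.comm_β (pr₁ w) (pr₁ w')))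

/-- The inverse of a triple with bijective `β`. -/
def inv (T : Triple D D') (h : ∀ w, Function.Bijective (T.β w)) : Triple D' D where
  W := T.W
  om := fun w => fp.swap (T.om w)
  om_subm := fp.swap_subm.comp T.om_subm
  β := fun w => (LinearEquiv.ofBijective (T.β w) (h w)).symm.toLinearMap

lemma inv_isTwoMor (hD : D.IsOneMor) (hD' : D'.IsOneMor) {T : Triple D D'} (hT : T.IsTwoMor)
    (h : ∀ w, Function.Bijective (T.β w)) : (T.inv h).IsTwoMor := by
  refine IsTwoMor.of_comm ?_ fun w w' => ?_
  · have h' : HVB.IsMor (D.A.pb fun w => pr₁ (T.om w)) (D'.A.pb fun w => pr₂ (T.om w))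
      (fun w => (LinearEquiv.ofBijective (T.β w) (h w)).toLinearMap) := hT.isMor
    exact h'.symm (hD.isVB.pb (Smooth.fst T.om_subm.smooth))
      (hD'.isVB.pb (Smooth.snd T.om_subm.smooth))
  · exact Comm.symm (g := LinearEquiv.ofBijective (T.β w) (h w))
      (f := LinearEquiv.ofBijective (T.β w') (h w')) (fp.cond (T.om w)) (fp.cond (T.om w'))
      (hT.comm_β w w')

end

set_option maxRecDepth 4000 in
lemma hcomp_isTwoMor {D₁ D₁' : OneMorData G₁ G₂} {D₂ D₂' : OneMorData G₂ G₃} (h₁ : D₁.IsOneMor)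
    (h₁' : D₁'.IsOneMor) (h₂ : D₂.IsOneMor) (h₂' : D₂'.IsOneMor) {T₂ : Triple D₂ D₂'}
    {T₁ : Triple D₁ D₁'} (hT₂ : T₂.IsTwoMor) (hT₁ : T₁.IsTwoMor) : (T₂.hcomp T₁).IsTwoMor := by
  have hC := comp_isOneMor h₂ h₁
  have hC' := comp_isOneMor h₂' h₁'
  refine IsTwoMor.of_comm ?_ fun w w' => ?_
  · have c₁ : Smooth (fun w : (T₂.hcomp T₁).W => pr₁ (pr₁ w)) := fp.smooth_fst.comp fp.smooth_fst
    have c₂ : Smooth (fun w : (T₂.hcomp T₁).W => pr₂ (pr₁ w)) := fp.smooth_snd.comp fp.smooth_fst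
    have c₃ : Smooth (fun w : (T₂.hcomp T₁).W => pr₂ w) := fp.smooth_snd
    have o₁ := Smooth.fst T₁.om_subm.smooth
    have o₁' := Smooth.snd T₁.om_subm.smooth
    have o₂ := Smooth.fst T₂.om_subm.smooth
    have o₂' := Smooth.snd T₂.om_subm.smooth
    have p₁ : Smooth (pr₁ : W₁₂ T₂ T₁ → T₁.W) := fp.smooth_fst
    have p₂ : Smooth (pr₂ : W₁₂ T₂ T₁ → T₂.W) := fp.smooth_snd
    have q₁ : Smooth (fun w : (T₂.hcomp T₁).W => pr₁ (pr₂ (pr₁ w))) := p₁.comp c₂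
    have q₂ : Smooth (fun w : (T₂.hcomp T₁).W => pr₂ (pr₂ (pr₁ w))) := p₂.comp c₂
    have u₁ : Smooth (fun w : (T₂.hcomp T₁).W => uMap T₂ T₁ (pr₂ (pr₁ w))) :=
      Smooth.mk (o₁.comp q₁) (o₂.comp q₂) _
    have u₂ : Smooth (fun w : (T₂.hcomp T₁).W => uMap' T₂ T₁ (pr₂ (pr₁ w))) :=
      Smooth.mk (o₁'.comp q₁) (o₂'.comp q₂) _
    have d₁ := isMor_d hC c₁ u₁ (fun w => fp.cond (pr₁ w))
    have d₂ := isMor_d hC' u₂ c₃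
      (fun w => (ζ_uMap' T₂ T₁ _).trans ((fp.cond (pr₁ w)).symm.trans (fp.cond w)))
    have v₁ := h₁.isVB.pb (o₁.comp q₁)
    have v₁' := h₁'.isVB.pb (o₁'.comp q₁)
    have v₂ := h₂.isVB.pb (o₂.comp q₂)
    have v₂' := h₂'.isVB.pb (o₂'.comp q₂)
    have b := (hT₁.isMor.pb_pb h₁.isVB h₁'.isVB o₁ o₁' q₁).tensor
      (hT₂.isMor.pb_pb h₂.isVB h₂'.isVB o₂ o₂' q₂) v₁ v₁' v₂ v₂'
    have t := HVB.IsMor.tensorPb (f₁ := (pr₁ : compZ D₂ D₁ → D₁.Z))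
      (f₂ := (pr₂ : compZ D₂ D₁ → D₂.Z)) h₁.isVB h₂.isVB fp.smooth_fst fp.smooth_snd u₁
    have t' := HVB.IsMor.tensorPb_symm (f₁ := (pr₁ : compZ D₂' D₁' → D₁'.Z))
      (f₂ := (pr₂ : compZ D₂' D₁' → D₂'.Z)) h₁'.isVB h₂'.isVB fp.smooth_fst fp.smooth_snd u₂
    have vc := hC.isVB.pb c₁
    have vu := hC.isVB.pb u₁
    have vu' := hC'.isVB.pb u₂
    have vc' := hC'.isVB.pb c₃
    have r₁ := t.comp d₁ vc vu (v₁.tensor v₂)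
    have r₂ := b.comp r₁ vc (v₁.tensor v₂) (v₁'.tensor v₂')
    have r₃ := t'.comp r₂ vc (v₁'.tensor v₂') vu'
    exact d₂.comp r₃ vc vu' vc'
  · have k := d_comm hC (z := pr₁ (pr₁ w)) (z' := uMap T₂ T₁ (pr₂ (pr₁ w))) (x := pr₁ (pr₁ w'))
      (x' := uMap T₂ T₁ (pr₂ (pr₁ w'))) (fp.cond (pr₁ w)) (fp.cond (pr₁ w'))
    have k' := d_comm hC' (z := uMap' T₂ T₁ (pr₂ (pr₁ w))) (z' := pr₂ w)
      (x := uMap' T₂ T₁ (pr₂ (pr₁ w'))) (x' := pr₂ w')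
      ((ζ_uMap' T₂ T₁ _).trans ((fp.cond (pr₁ w)).symm.trans (fp.cond w)))
      ((ζ_uMap' T₂ T₁ _).trans ((fp.cond (pr₁ w')).symm.trans (fp.cond w')))
    have b := Comm.tensor (p := uMap T₂ T₁ (pr₂ (pr₁ w))) (q := uMap T₂ T₁ (pr₂ (pr₁ w')))
      (r := uMap' T₂ T₁ (pr₂ (pr₁ w))) (s := uMap' T₂ T₁ (pr₂ (pr₁ w')))
      ((ζ_uMap T₂ T₁ _).trans (ζ_uMap' T₂ T₁ _).symm)
      ((ζ_uMap T₂ T₁ _).trans (ζ_uMap' T₂ T₁ _).symm)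
      (hT₁.comm_β (pr₁ (pr₂ (pr₁ w))) (pr₁ (pr₂ (pr₁ w'))))
      (hT₂.comm_β (pr₂ (pr₂ (pr₁ w))) (pr₂ (pr₂ (pr₁ w'))))
    have c := Comm.comp (D := D₂.comp D₁) (D' := D₂.comp D₁) (D'' := D₂'.comp D₁')
      (z := pr₁ (pr₁ w)) (x := pr₁ (pr₁ w')) (z' := uMap T₂ T₁ (pr₂ (pr₁ w)))
      (x' := uMap T₂ T₁ (pr₂ (pr₁ w'))) (z'' := uMap' T₂ T₁ (pr₂ (pr₁ w)))
      (x'' := uMap' T₂ T₁ (pr₂ (pr₁ w'))) b k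
    have c' := Comm.comp (D := D₂.comp D₁) (D' := D₂'.comp D₁') (D'' := D₂'.comp D₁')
      (z := pr₁ (pr₁ w)) (x := pr₁ (pr₁ w')) (z' := uMap' T₂ T₁ (pr₂ (pr₁ w)))
      (x' := uMap' T₂ T₁ (pr₂ (pr₁ w'))) (z'' := pr₂ w) (x'' := pr₂ w') k' c
    exact c'

lemma assoc_isTwoMor {D'' : OneMorData G₃ G₄} {D' : OneMorData G₂ G₃} {D : OneMorData G₁ G₂}
    (hD'' : D''.IsOneMor) (hD' : D'.IsOneMor) (hD : D.IsOneMor) :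
    (Triple.assoc D'' D' D).IsTwoMor := by
  have hC := comp_isOneMor (comp_isOneMor hD'' hD') hD
  have hC' := comp_isOneMor hD'' (comp_isOneMor hD' hD)
  refine IsTwoMor.of_comm ?_ fun w w' => ?_
  · have s₁ : Smooth (pr₁ : (Triple.assoc D'' D' D).W → ((D''.comp D').comp D).Z) := fp.smooth_fst
    have s₂ : Smooth (pr₂ : (Triple.assoc D'' D' D).W → (D''.comp (D'.comp D)).Z) := fp.smooth_snd
    have ha := assocMap_smooth D'' D' D
    have h₁ := ((assocFib_isMor hD'' hD' hD).pb hC.isVB (hC'.isVB.pb ha) s₁).congr_conn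
      (fun _ _ _ _ _ => rfl) (HVB.pb_pb_conn _ ha s₁)
    exact (isMor_d hC' (ha.comp s₁) s₂ fun w => fp.cond w).comp h₁ (hC.isVB.pb s₁)
      (hC'.isVB.pb (ha.comp s₁)) (hC'.isVB.pb s₂)
  · have h₁ := assocFib_comm D'' D' D (pr₁ w) (pr₁ w')
    have h₂ := d_comm hC' (z := assocMap D'' D' D (pr₁ w)) (z' := pr₂ w)
      (x := assocMap D'' D' D (pr₁ w')) (x' := pr₂ w') (fp.cond w) (fp.cond w')
    exact Comm.comp h₂ h₁

end Triple

/-! ### The unitors satisfy the axioms of 2-morphisms -/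

namespace BundleGerbe

variable {M : Mfd.{u}} (G : BundleGerbe M) {y₁ y₂ y₂' y₃ : G.Y} {h : G.π y₁ = G.π y₂}
  {h' : G.π y₂ = G.π y₃} {k : G.π y₁ = G.π y₂'} {k' : G.π y₂' = G.π y₃} {l : G.Lf y₁ y₂ h}
  {l' : G.Lf y₂ y₃ h'} {m : G.Lf y₁ y₂' k} {m' : G.Lf y₂' y₃ k'}

lemma left_ne_zero_of_μ_eq (e : G.μ h h' (l ⊗ₜ l') = G.μ k k' (m ⊗ₜ m')) (hl : l ≠ 0)
    (hl' : l' ≠ 0) : m ≠ 0 := by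
  rintro rfl
  rw [TensorProduct.zero_tmul, map_zero] at e
  exact G.μ_ne_zero h h' hl hl' e

lemma left_eq_zero_of_μ_eq (e : G.μ h h' (l ⊗ₜ l') = G.μ k k' (m ⊗ₜ m')) (hl' : l' = 0)
    (hm' : m' ≠ 0) : m = 0 := by
  by_contra hm
  rw [hl', TensorProduct.tmul_zero, map_zero] at e
  exact G.μ_ne_zero k k' hm hm' e.symm

end BundleGerbe

namespace OneMorData

variable {M : Mfd.{u}} {G₁ G₂ : BundleGerbe M} {D : OneMorData G₁ G₂} {z x : D.Z} {y₁ x₁ : G₁.Y}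
  {y₂ x₂ : G₂.Y} {h : G₁.π y₁ = G₁.π x₁} {h' : G₂.π y₂ = G₂.π x₂} {l k : G₁.Lf y₁ x₁ h}
  {m n : G₂.Lf y₂ x₂ h'} {v : D.A.fib x} {v' : D.A.fib z}

lemma Act.congr_left (ha : D.Act l v v' m) (e : l = k) : D.Act k v v' m := e ▸ ha

lemma Act.congr_right (ha : D.Act l v v' m) (e : m = n) : D.Act l v v' n := e ▸ ha

lemma Act.congr_tgt (ha : D.Act l v v' m) {w' : D.A.fib z} (e : v' = w') : D.Act l v w' m := e ▸ ha

end OneMorData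

namespace Triple

open OneMorData

variable {M : Mfd.{u}} {G₁ G₂ : BundleGerbe M}

/-- Characterises the left unitor by `α (k ⊗ a) = λ(k ⊗ a) ⊗ e`, which holds because `λ` is `α`
followed by the contraction that sends `e` to `1`. The point `y` is kept free up to equality so that
`e` can be multiplied with elements on either side. -/
lemma lam_act (D : OneMorData G₁ G₂) (w : (lam D).W) {h : G₁.π (pr₁ (pr₁ (pr₁ w)))
    = G₁.π (pr₂ (pr₁ (pr₁ w)))} {y : G₂.Y} (hy : D.tgt (pr₂ (pr₁ w)) = y)
    (k : G₁.Lf (pr₁ (pr₁ (pr₁ w))) (pr₂ (pr₁ (pr₁ w))) h) (a : D.A.fib (pr₂ (pr₁ w))) :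
    D.Act (z := pr₂ w) (x := pr₂ (pr₁ w)) k a ((lam D).β w (k ⊗ₜ a)) (G₂.e y) := by
  subst hy
  have e : (D.comp (OneMorData.one G₁)).ζ (pr₁ w) = D.ζ (pr₂ w) := fp.cond w
  have e₁ : pr₁ (pr₁ (pr₁ w)) = D.src (pr₂ w) := (src_eq e :)
  have e₁' : pr₂ (pr₁ (pr₁ w)) = D.src (pr₂ (pr₁ w)) := fp.cond (pr₁ w)
  have e₂ : D.tgt (pr₂ w) = D.tgt (pr₂ (pr₁ w)) := (tgt_eq e :).symm
  have hb : D.base (pr₂ w) = D.base (pr₂ (pr₁ w)) :=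
    (congrArg toM e).symm.trans (h.trans (congrArg G₁.π e₁'))
  have hβ : (lam D).β w (k ⊗ₜ a) = TensorProduct.rid ℂ _ ((G₂.t e₂ (π_pr₂ hb)).lTensor _
    (D.α hb (G₁.cast (h' := hb) e₁ e₁' k ⊗ₜ a))) := rfl
  set m := (G₂.t e₂ (π_pr₂ hb)).symm 1 with hm
  have hm0 : m ≠ 0 := by simp [hm]
  obtain ⟨v, hv⟩ := exists_eq_tmul (G₂.finrank_Lf _) hm0
    (D.α hb (G₁.cast (h' := hb) e₁ e₁' k ⊗ₜ a))
  have hβ' : (lam D).β w (k ⊗ₜ a) = v := by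
    rw [hβ, hv, LinearEquiv.lTensor_tmul, TensorProduct.rid_tmul]
    have h2 : G₂.t e₂ (π_pr₂ hb) m = 1 := by
      rw [hm]; exact LinearEquiv.apply_symm_apply _ _
    rw [h2, one_smul]
  refine ⟨e₁.symm, e₁'.symm, e₂, rfl, ?_⟩
  refine (D.αAt_tmul e₁.symm e₁'.symm e₂ rfl h rfl hb k a).trans ?_
  refine (congrArg _ hv).trans ?_
  refine Eq.trans ?_ (congrArg (fun v => v ⊗ₜ[ℂ] G₂.e (D.tgt (pr₂ (pr₁ w)))) hβ'.symm)
  refine congrArg (fun n => v ⊗ₜ[ℂ] n) ?_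
  refine (congrArg (G₂.cast (h := π_pr₂ hb) (h' := rfl) e₂ rfl)
    (G₂.cast_e e₂.symm rfl (π_pr₂ hb)).symm).trans ?_
  exact G₂.cast_cast _ _ _ _ _

/-- Dually, the right unitor is characterised by `α (e ⊗ ρ(a ⊗ k)) = a ⊗ k`. -/
lemma rho_act (D : OneMorData G₁ G₂) (w : (rho D).W) {h : G₂.π (pr₁ (pr₂ (pr₁ w)))
    = G₂.π (pr₂ (pr₂ (pr₁ w)))} {y : G₁.Y} (hy : D.src (pr₁ (pr₁ w)) = y)
    (a : D.A.fib (pr₁ (pr₁ w))) (k : G₂.Lf (pr₁ (pr₂ (pr₁ w))) (pr₂ (pr₂ (pr₁ w))) h) :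
    D.Act (z := pr₁ (pr₁ w)) (x := pr₂ w) (G₁.e y) ((rho D).β w (a ⊗ₜ k)) a k := by
  subst hy
  have e : ((OneMorData.one G₂).comp D).ζ (pr₁ w) = D.ζ (pr₂ w) := fp.cond w
  have e₁ : D.src (pr₁ (pr₁ w)) = D.src (pr₂ w) := (src_eq e :)
  have e₂ : D.tgt (pr₁ (pr₁ w)) = pr₁ (pr₂ (pr₁ w)) := fp.cond (pr₁ w)
  have e₂' : pr₂ (pr₂ (pr₁ w)) = D.tgt (pr₂ w) := (tgt_eq e :)
  have hb : D.base (pr₁ (pr₁ w)) = D.base (pr₂ w) := congrArg G₁.π e₁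
  have hβ : (rho D).β w (a ⊗ₜ k) = TensorProduct.lid ℂ _ ((G₁.t e₁ hb).rTensor _
    ((D.α hb).symm (a ⊗ₜ G₂.cast (h' := π_pr₂ hb) e₂.symm e₂' k))) := rfl
  set l := (G₁.t e₁ hb).symm 1 with hl
  have hl0 : l ≠ 0 := by simp [hl]
  obtain ⟨v, hv⟩ := exists_eq_tmul' (G₁.finrank_Lf _) hl0
    ((D.α hb).symm (a ⊗ₜ G₂.cast (h' := π_pr₂ hb) e₂.symm e₂' k))
  have hβ' : (rho D).β w (a ⊗ₜ k) = v := by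
    rw [hβ, hv, LinearEquiv.rTensor_tmul, TensorProduct.lid_tmul]
    have h2 : G₁.t e₁ hb l = 1 := by
      rw [hl]; exact LinearEquiv.apply_symm_apply _ _
    rw [h2, one_smul]
  refine ⟨rfl, e₁.symm, e₂, e₂'.symm, ?_⟩
  refine (D.αAt_tmul rfl e₁.symm e₂ e₂'.symm rfl h hb _ _).trans ?_
  have h3 : G₁.cast (h' := hb) rfl e₁ (G₁.e (D.src (pr₁ (pr₁ w)))) = l := G₁.cast_e _ _ _
  have h4 : D.α hb (G₁.cast (h' := hb) rfl e₁ (G₁.e (D.src (pr₁ (pr₁ w)))) ⊗ₜ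
      (rho D).β w (a ⊗ₜ k)) = a ⊗ₜ G₂.cast (h' := π_pr₂ hb) e₂.symm e₂' k :=
    (congrArg₂ (fun l v => D.α hb (l ⊗ₜ v)) h3 hβ').trans
      ((congrArg (D.α hb) hv.symm).trans (LinearEquiv.apply_symm_apply _ _))
  refine (congrArg _ h4).trans ?_
  exact congrArg (fun n => a ⊗ₜ[ℂ] n) (G₂.cast_symm_cast _ _ _ _ k)

/-- For the identity the relation between `v` and `v'` says `l·v = v'·m`. Acting on `u` by this
element in its two factorizations produces both the transport of `λ(v ⊗ u)` and `λ(v' ⊗ u')`, with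
the same nonzero right-hand factor `n`. -/
lemma lam_comm {D : OneMorData G₁ G₂} (hD : D.IsOneMor) (w w' : (lam D).W) :
    Comm (D.comp (OneMorData.one G₁)) D ((lam D).β w) ((lam D).β w') := by
  refine Comm.of_tmul (p := pr₁ w) (q := pr₁ w') (z := pr₂ w) (x := pr₂ w') (fp.cond w)
    (fp.cond w') ?_
  intro y₁ x₁ y₂ x₂ y₃ x₃ h₁ h₂ h₃ l m n v v' u u' hm hn h k
  have h' := h
  have k' := k
  obtain ⟨rfl, rfl, rfl, rfl, -⟩ := h'
  obtain ⟨-, -, b, b', -⟩ := k'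
  have s₁ : (OneMorData.one G₁).src (pr₁ (pr₁ w)) = D.src (pr₂ w) := (src_eq (fp.cond w) :)
  have s₂ : (OneMorData.one G₁).src (pr₁ (pr₁ w')) = D.src (pr₂ w') := (src_eq (fp.cond w') :)
  have t₁ : D.tgt (pr₂ (pr₁ w)) = D.tgt (pr₂ w) := (tgt_eq (fp.cond w) :)
  have t₂ : D.tgt (pr₂ (pr₁ w')) = D.tgt (pr₂ w') := (tgt_eq (fp.cond w') :)
  have e := (one_act_iff (hy := fp.cond (pr₁ (pr₁ w))) (hx := fp.cond (pr₁ (pr₁ w')))).1 h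
  obtain ⟨r, hr⟩ := exists_act (D := D) (z := pr₂ w) (x := pr₂ w') s₁.symm s₂.symm
    (t₁.symm.trans b) (t₂.symm.trans b') l ((lam D).β w' (v ⊗ₜ u)) hn
  have c₁ := Act.mul hD hr (lam_act D w' b' v u)
  have c₂ := Act.mul hD (lam_act D w b v' u') k
  rw [BundleGerbe.μ_e_right] at c₁
  rw [BundleGerbe.μ_e_left] at c₂
  exact hr.congr_tgt (Act.unique hn c₁ (c₂.congr_left e.symm))

lemma rho_comm {D : OneMorData G₁ G₂} (hD : D.IsOneMor) (w w' : (rho D).W) :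
    Comm ((OneMorData.one G₂).comp D) D ((rho D).β w) ((rho D).β w') := by
  refine Comm.of_tmul (p := pr₁ w) (q := pr₁ w') (z := pr₂ w) (x := pr₂ w') (fp.cond w)
    (fp.cond w') ?_
  intro y₁ x₁ y₂ x₂ y₃ x₃ h₁ h₂ h₃ l m n v v' u u' hm hn h k
  have h' := h
  have k' := k
  obtain ⟨a, a', -, -, -⟩ := h'
  obtain ⟨rfl, rfl, rfl, rfl, -⟩ := k'
  have s₁ : D.src (pr₁ (pr₁ w)) = D.src (pr₂ w) := (src_eq (fp.cond w) :)
  have s₂ : D.src (pr₁ (pr₁ w')) = D.src (pr₂ w') := (src_eq (fp.cond w') :)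
  have t₁ : (OneMorData.one G₂).tgt (pr₂ (pr₁ w)) = D.tgt (pr₂ w) := (tgt_eq (fp.cond w) :)
  have t₂ : (OneMorData.one G₂).tgt (pr₂ (pr₁ w')) = D.tgt (pr₂ w') := (tgt_eq (fp.cond w') :)
  have e := (one_act_iff (hy := fp.cond (pr₂ (pr₁ w))) (hx := fp.cond (pr₂ (pr₁ w')))).1 k
  obtain ⟨r, hr⟩ := exists_act (D := D) (z := pr₂ w) (x := pr₂ w') (s₁.symm.trans a)
    (s₂.symm.trans a') t₁.symm t₂.symm l ((rho D).β w' (v ⊗ₜ u)) hn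
  -- In this case `u` and `u'` enter on the right of the relation, where cancellation requires them
  -- to be nonzero. If `u` vanishes then so does `u'`, and the claim is trivial.
  by_cases hu : u = 0
  · have hu' : u' = 0 := G₂.left_eq_zero_of_μ_eq e hu hn
    have z₁ : (rho D).β w' (v ⊗ₜ u) = 0 :=
      (congrArg (fun u => (rho D).β w' (v ⊗ₜ u)) hu).trans
        ((congrArg _ (TensorProduct.tmul_zero _ v)).trans (map_zero _))
    have z₂ : (rho D).β w (v' ⊗ₜ u') = 0 :=
      (congrArg (fun u => (rho D).β w (v' ⊗ₜ u)) hu').trans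
        ((congrArg _ (TensorProduct.tmul_zero _ v')).trans (map_zero _))
    refine (congrArg₂ (fun a b => D.Act l a b n) z₁ z₂).mpr ?_
    exact act_zero (s₁.symm.trans a) (s₂.symm.trans a') t₁.symm t₂.symm l n
  · have hne := G₂.μ_ne_zero h₂ (fp.cond (pr₂ (pr₁ w'))) hm hu
    have hu' : u' ≠ 0 := G₂.left_ne_zero_of_μ_eq e hm hu
    have c₁ := Act.mul hD h (rho_act D w' a' v u)
    rw [BundleGerbe.μ_e_right] at c₁
    -- The element `b` is obtained from `r` by the action of the unit and `u'`. Because `m·u =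
    -- u'·n`, it coincides with `v'`. Hence `r` satisfies the relation that characterises `ρ(v' ⊗
    -- u')`.
    obtain ⟨b, hb⟩ := exists_act (D := D) (z := pr₁ (pr₁ w)) (x := pr₂ w) a (s₁.symm.trans a)
      (fp.cond (pr₁ w)) t₁.symm (G₁.e y₁) r hu'
    have c₂ := Act.mul hD hb hr
    rw [BundleGerbe.μ_e_left] at c₂
    have c₃ := Act.unique hne (c₂.congr_right e.symm) c₁
    subst c₃
    have c₄ := Act.unique' (G₁.e_ne_zero y₁) hb (rho_act D w a b u')
    exact hr.congr_tgt c₄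

lemma lam_isTwoMor {D : OneMorData G₁ G₂} (hD : D.IsOneMor) : (lam D).IsTwoMor := by
  refine IsTwoMor.of_comm ?_ (lam_comm hD)
  have s₁ : Smooth (pr₁ : (lam D).W → compZ D (OneMorData.one G₁)) := fp.smooth_fst
  have s₂ : Smooth (pr₂ : (lam D).W → D.Z) := fp.smooth_snd
  have hb : ∀ w : (lam D).W, D.base (pr₂ w) = D.base (pr₂ (pr₁ w)) := fun w =>
    (congrArg toM (fp.cond w)).symm.trans ((fp.cond (pr₁ (pr₁ w))).trans
      (congrArg G₁.π (fp.cond (pr₁ w))))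
  let g : (lam D).W → D.ZZ := fun w => fp.mk (pr₂ w) (pr₂ (pr₁ w)) (hb w)
  have hg : Smooth g := Smooth.mk s₂ (Smooth.snd s₁) _
  have vL := G₁.isVB.pb (Smooth.fst s₁)
  have vL₁ := G₁.isVB.pb (D.src₂_smooth.comp hg)
  have vL₂ := G₂.isVB.pb (D.tgt₂_smooth.comp hg)
  have vA := hD.isVB.pb (Smooth.snd s₁)
  have vA' := hD.isVB.pb s₂
  have vC := (comp_isVB hD (one_isOneMor G₁)).pb s₁
  have r₀ := HVB.IsMor.tensorPb (E₁ := G₁.L)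
    (f₁ := (pr₁ : compZ D (OneMorData.one G₁) → (OneMorData.one G₁).Z))
    (f₂ := (pr₂ : compZ D (OneMorData.one G₁) → D.Z)) G₁.isVB hD.isVB fp.smooth_fst fp.smooth_snd s₁
  have r₁ := (HVB.IsMor.tr G₁.isVB (Smooth.fst s₁) (g := fun w => D.src₂ (g w)) fun w =>
    fp.ext (src_eq (fp.cond w) :) (fp.cond (pr₁ w))).tensor vA.compat vL vL₁ vA vA
  have r₂ := hD.isMor_α hg
  have r₃ := BundleGerbe.isMor_contract_right vA' (D.tgt₂_smooth.comp hg)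
    (fun w => (tgt_eq (fp.cond w) :).symm)
  have q₁ := r₁.comp r₀ vC (vL.tensor vA) (vL₁.tensor vA)
  have q₂ := r₂.comp q₁ vC (vL₁.tensor vA) (vA'.tensor vL₂)
  exact r₃.comp q₂ vC (vA'.tensor vL₂) vA'

lemma rho_isTwoMor {D : OneMorData G₁ G₂} (hD : D.IsOneMor) : (rho D).IsTwoMor := by
  refine IsTwoMor.of_comm ?_ (rho_comm hD)
  have s₁ : Smooth (pr₁ : (rho D).W → compZ (OneMorData.one G₂) D) := fp.smooth_fst
  have s₂ : Smooth (pr₂ : (rho D).W → D.Z) := fp.smooth_snd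
  have hs : ∀ w : (rho D).W, D.src (pr₁ (pr₁ w)) = D.src (pr₂ w) := fun w =>
    (src_eq (fp.cond w) :)
  let g : (rho D).W → D.ZZ := fun w => fp.mk (pr₁ (pr₁ w)) (pr₂ w) (congrArg G₁.π (hs w))
  have hg : Smooth g := Smooth.mk (Smooth.fst s₁) s₂ _
  have vL := G₂.isVB.pb (Smooth.snd s₁)
  have vL₁ := G₁.isVB.pb (D.src₂_smooth.comp hg)
  have vL₂ := G₂.isVB.pb (D.tgt₂_smooth.comp hg)
  have vA := hD.isVB.pb (Smooth.fst s₁)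
  have vA' := hD.isVB.pb s₂
  have vC := (comp_isVB (one_isOneMor G₂) hD).pb s₁
  have r₀ := HVB.IsMor.tensorPb (E₂ := G₂.L)
    (f₁ := (pr₁ : compZ (OneMorData.one G₂) D → D.Z))
    (f₂ := (pr₂ : compZ (OneMorData.one G₂) D → (OneMorData.one G₂).Z)) hD.isVB G₂.isVB
    fp.smooth_fst fp.smooth_snd s₁
  have r₁ := vA.compat.tensor (HVB.IsMor.tr G₂.isVB (Smooth.snd s₁) (g := fun w => D.tgt₂ (g w))
    fun w => fp.ext (fp.cond (pr₁ w)).symm (tgt_eq (fp.cond w) :)) vA vA vL vL₂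
  have r₂ := (hD.isMor_α hg).symm (vL₁.tensor vA') (vA.tensor vL₂)
  have r₃ := BundleGerbe.isMor_contract_left vA' (D.src₂_smooth.comp hg) hs
  have q₁ := r₁.comp r₀ vC (vA.tensor vL) (vA.tensor vL₂)
  have q₂ := r₂.comp q₁ vC (vA.tensor vL₂) (vL₁.tensor vA')
  exact r₃.comp q₂ vC (vL₁.tensor vA') vA'

end Triple

lemma linearMap_eq_of_tmul {V U W : Type*} [AddCommGroup V] [Module ℂ V] [AddCommGroup U]
    [Module ℂ U] [AddCommGroup W] [Module ℂ W] (f g : V ⊗[ℂ] U →ₗ[ℂ] W)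
    (h : ∀ v u, f (v ⊗ₜ u) = g (v ⊗ₜ u)) (x : V ⊗[ℂ] U) : f x = g x :=
  LinearMap.congr_fun (TensorProduct.ext' h) x

lemma HVB.tr_tr_symm {X : Mfd.{u}} (E : HVB X) {x y : X} (h : x = y) (a : E.fib y) :
    E.tr h (E.tr h.symm a) = a := by
  subst h
  rfl

/-! ### Contractions over the diagonal and the action of units -/

namespace BundleGerbe

variable {M : Mfd.{u}} (G : BundleGerbe M)

/-- The contraction `L_{(y,y)} ⊗ V → V`. -/
def contractLeft (y : G.Y) (V : Type*) [AddCommGroup V] [Module ℂ V] :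
    G.Lf y y rfl ⊗[ℂ] V ≃ₗ[ℂ] V :=
  (G.t rfl rfl).rTensor V ≪≫ₗ TensorProduct.lid ℂ V

/-- The contraction `V ⊗ L_{(y,y)} → V`. -/
def contractRight (y : G.Y) (V : Type*) [AddCommGroup V] [Module ℂ V] :
    V ⊗[ℂ] G.Lf y y rfl ≃ₗ[ℂ] V :=
  (G.t rfl rfl).lTensor V ≪≫ₗ TensorProduct.rid ℂ V

variable {V : Type*} [AddCommGroup V] [Module ℂ V]

lemma contractLeft_tmul (y : G.Y) (k : G.Lf y y rfl) (v : V) :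
    G.contractLeft y V (k ⊗ₜ v) = G.t rfl rfl k • v := rfl

lemma contractRight_tmul (y : G.Y) (v : V) (k : G.Lf y y rfl) :
    G.contractRight y V (v ⊗ₜ k) = G.t rfl rfl k • v := rfl

end BundleGerbe

namespace OneMorData

variable {M : Mfd.{u}} {G₁ G₂ : BundleGerbe M}

section

variable {D : OneMorData G₁ G₂} {z x : D.Z} {y₁ x₁ : G₁.Y}
  {y₂ x₂ : G₂.Y} {h : G₁.π y₁ = G₁.π x₁} {h' : G₂.π y₂ = G₂.π x₂} {l : G₁.Lf y₁ x₁ h}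
  {m : G₂.Lf y₂ x₂ h'} {v : D.A.fib x} {v' : D.A.fib z}

lemma Act.smul_left (ha : D.Act l v v' m) (c : ℂ) : D.Act (c • l) v (c • v') m := by
  obtain ⟨a, a', b, b', e⟩ := ha
  exact ⟨a, a', b, b', by rw [← TensorProduct.smul_tmul', map_smul, e, TensorProduct.smul_tmul']⟩

lemma Act.smul_right (ha : D.Act l v v' m) (c : ℂ) : D.Act l (c • v) v' (c • m) := by
  obtain ⟨a, a', b, b', e⟩ := ha
  exact ⟨a, a', b, b', by rw [TensorProduct.tmul_smul, map_smul, e, TensorProduct.tmul_smul]⟩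

end

lemma e_act {D : OneMorData G₁ G₂} (hD : D.IsOneMor) (z : D.Z) (v : D.A.fib z) :
    D.Act (z := z) (x := z) (G₁.e (D.src z)) v v (G₂.e (D.tgt z)) := by
  have h := d_act (D := D) (z := z) rfl v
  rwa [d_self hD] at h

end OneMorData

/-! ### Values of triples at points, and the equivalence relation -/

namespace Triple

open OneMorData

variable {M : Mfd.{u}} {G₁ G₂ G₃ G₄ : BundleGerbe M}

/-- `T` has the value `f` over the point `(z, z')`. -/
inductive Val {D D' : OneMorData G₁ G₂} (T : Triple D D') :
    ∀ (z : D.Z) (z' : D'.Z), (D.A.fib z →ₗ[ℂ] D'.A.fib z') → Prop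
  | mk (w : T.W) : Val T (pr₁ (T.om w)) (pr₂ (T.om w)) (T.β w)

section

variable {D D' D'' : OneMorData G₁ G₂} {T T' : Triple D D'} {z x : D.Z} {z' x' : D'.Z}
  {f : D.A.fib z →ₗ[ℂ] D'.A.fib z'} {g : D.A.fib x →ₗ[ℂ] D'.A.fib x'}

lemma val_of_eq (w : T.W) (e : pr₁ (T.om w) = z) (e' : pr₂ (T.om w) = z')
    (h : ∀ a, f (D.A.tr e a) = D'.A.tr e' (T.β w a)) : T.Val z z' f := by
  subst e e'
  have : f = T.β w := LinearMap.ext h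
  subst this
  exact Val.mk w

lemma Val.exists_eq (h : T.Val z z' f) : ∃ (w : T.W) (e : pr₁ (T.om w) = z)
    (e' : pr₂ (T.om w) = z'), ∀ a, f (D.A.tr e a) = D'.A.tr e' (T.β w a) := by
  cases h with
  | mk w => exact ⟨w, rfl, rfl, fun _ => rfl⟩

lemma exists_val (T : Triple D D') (h : D.ζ z = D'.ζ z') : ∃ f, T.Val z z' f := by
  obtain ⟨w, hw⟩ := T.om_subm.surj (fp.mk z z' h)
  have e : pr₁ (T.om w) = z := congrArg pr₁ hw
  have e' : pr₂ (T.om w) = z' := congrArg pr₂ hw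
  subst e e'
  exact ⟨_, Val.mk w⟩

lemma Val.comm (hT : T.IsTwoMor) (h : T.Val z z' f) (h' : T.Val x x' g) : Comm D D' f g := by
  cases h
  cases h'
  exact hT.comm_β _ _

/-- Surjectivity of the refinement over `W` lets every value of `T` be read off from `T'` as well.
Values therefore descend to equivalence classes. -/
lemma Rel.val (hr : T.Rel T') (h : T.Val z z' f) : T'.Val z z' f := by
  obtain ⟨X, r, r', hr, hr', e, H⟩ := hr
  cases h with
  | mk w =>
    obtain ⟨y, rfl⟩ := hr.surj w
    refine val_of_eq (r' y) (congrArg pr₁ (e y)).symm (congrArg pr₂ (e y)).symm fun a => ?_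
    have h := H y (D.A.tr (congrArg pr₁ (e y)).symm a)
    rw [HVB.tr_tr_symm] at h
    rw [h]
    exact (HVB.tr_tr_symm D'.A _ _).symm

lemma Rel.val_symm (hr : T.Rel T') (h : T'.Val z z' f) : T.Val z z' f := by
  obtain ⟨X, r, r', hr, hr', e, H⟩ := hr
  cases h with
  | mk w =>
    obtain ⟨y, rfl⟩ := hr'.surj w
    exact val_of_eq (r y) (congrArg pr₁ (e y)) (congrArg pr₂ (e y)) (H y)

/-- The common refinement is the fibre product of `W` and `W'` over `Z₁ ×_P Z₂`. Over each of its
points both morphisms are compatible with the shared value `f` at a point in the same fibre over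
`M`, and rigidity makes them agree. -/
lemma rel_of_val (hT : T.IsTwoMor) (hT' : T'.IsTwoMor)
    (h : ∀ m, ∃ z z' f, D.base z = m ∧ T.Val z z' f ∧ T'.Val z z' f) : T.Rel T' := by
  refine ⟨fp T.om T'.om T.om_subm.smooth T'.om_subm, fun x => pr₁ x, fun x => pr₂ x, fp.subm_fst,
    fp.subm_snd T.om_subm, fun x => fp.cond x, fun x a => ?_⟩
  obtain ⟨z, z', f, hz, hv, hv'⟩ := h (D.base (pr₁ (T.om (pr₁ x))))
  have h₁ := hv.comm hT (Val.mk (pr₁ x))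
  have h₂ := hv'.comm hT' (Val.mk (pr₂ x))
  have key : ∀ {p q : D.Z} {p' q' : D'.Z} (e : p = q) (e' : p' = q')
      {g : D.A.fib p →ₗ[ℂ] D'.A.fib p'} {g' : D.A.fib q →ₗ[ℂ] D'.A.fib q'}
      (_ : D.base z = D.base p) (_ : Comm D D' f g) (_ : Comm D D' f g') (a : D.A.fib p),
      g' (D.A.tr e a) = D'.A.tr e' (g a) := by
    intro p q p' q' e e' g g' hb hg hg' a
    subst e e'
    have := Comm.ext hb hg hg'
    subst this
    rfl
  exact key _ _ hz h₁ h₂ a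

lemma exists_common_val (T : Triple D D') (m : M) :
    ∃ z z' f, D.base z = m ∧ T.Val z z' f := by
  obtain ⟨z, hz⟩ := D.base_subm.surj m
  obtain ⟨z', hz'⟩ := D'.hζ.surj (D.ζ z)
  obtain ⟨f, hf⟩ := T.exists_val hz'.symm
  exact ⟨z, z', f, hz, hf⟩

/-- Every triple has a value over each point of `M`, and equivalent triples have the same values.
Transitivity thus follows from `rel_of_val`, without constructing a common refinement of the given
ones. -/
lemma rel_equivalence (D D' : OneMorData G₁ G₂) :
    Equivalence fun T T' : {T : Triple D D' // T.IsTwoMor} => T.1.Rel T'.1 where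
  refl T := rel_of_val T.2 T.2 fun m => by
    obtain ⟨z, z', f, hz, h⟩ := exists_common_val T.1 m
    exact ⟨z, z', f, hz, h, h⟩
  symm {T T'} hr := rel_of_val T'.2 T.2 fun m => by
    obtain ⟨z, z', f, hz, h⟩ := exists_common_val T.1 m
    exact ⟨z, z', f, hz, hr.val h, h⟩
  trans {T T' T''} hr hr' := rel_of_val T.2 T''.2 fun m => by
    obtain ⟨z, z', f, hz, h⟩ := exists_common_val T.1 m
    exact ⟨z, z', f, hz, h, hr'.val (hr.val h)⟩

lemma one_val (hD : D.IsOneMor) (z : D.Z) : (one D).Val z z LinearMap.id :=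
  val_of_eq (T := one D) (fp.mk z z rfl) rfl rfl fun a =>
    (d_self hD (z := z) rfl a).symm

lemma Val.vcomp {S : Triple D' D''} {z'' : D''.Z} {k : D'.A.fib z' →ₗ[ℂ] D''.A.fib z''}
    (hS : S.Val z' z'' k) (hT : T.Val z z' f) : (S.vcomp T).Val z z'' (k ∘ₗ f) := by
  obtain ⟨w, rfl, rfl, h⟩ := hT.exists_eq
  obtain ⟨w', e, rfl, h'⟩ := hS.exists_eq
  refine val_of_eq (T := S.vcomp T) (fp.mk w w' e.symm) rfl rfl fun a => ?_
  have h₁ := h' (D'.A.tr e.symm (T.β w a))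
  rw [HVB.tr_tr_symm] at h₁
  exact (congrArg k (h a)).trans h₁

lemma Val.inv {h : ∀ w, Function.Bijective (T.β w)} (hT : T.Val z z' f) :
    ∃ k, (T.inv h).Val z' z k ∧ k ∘ₗ f = LinearMap.id ∧ f ∘ₗ k = LinearMap.id := by
  cases hT with
  | mk w =>
    refine ⟨_, Val.mk (T := T.inv h) w, ?_, ?_⟩
    · exact LinearMap.ext fun a => (LinearEquiv.ofBijective (T.β w) (h w)).symm_apply_apply a
    · exact LinearMap.ext fun a => (LinearEquiv.ofBijective (T.β w) (h w)).apply_symm_apply a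

end

-- Over a pair of points in `W₁ ×_{Y₂} W₂`, take the points of `Z̃` and `Z̃'` to be their images.
-- Both maps `d` then sit over the diagonal and are identities by `d_self`.
set_option maxRecDepth 4000 in
lemma Val.hcomp {D₁ D₁' : OneMorData G₁ G₂} {D₂ D₂' : OneMorData G₂ G₃}
    (h : (D₂.comp D₁).IsOneMor) (h' : (D₂'.comp D₁').IsOneMor) {T₂ : Triple D₂ D₂'}
    {T₁ : Triple D₁ D₁'} {z₁ : D₁.Z} {z₁' : D₁'.Z} {z₂ : D₂.Z} {z₂' : D₂'.Z}
    {f₁ : D₁.A.fib z₁ →ₗ[ℂ] D₁'.A.fib z₁'} {f₂ : D₂.A.fib z₂ →ₗ[ℂ] D₂'.A.fib z₂'}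
    (hT₂ : T₂.Val z₂ z₂' f₂) (hT₁ : T₁.Val z₁ z₁' f₁) (e : D₁.tgt z₁ = D₂.src z₂)
    (e' : D₁'.tgt z₁' = D₂'.src z₂') :
    (T₂.hcomp T₁).Val (fp.mk z₁ z₂ e) (fp.mk z₁' z₂' e') (TensorProduct.map f₁ f₂) := by
  cases hT₁ with
  | mk w₁ =>
    cases hT₂ with
    | mk w₂ =>
      let p : W₁₂ T₂ T₁ := fp.mk w₁ w₂ e
      refine val_of_eq (T := T₂.hcomp T₁) (fp.mk (fp.mk (uMap T₂ T₁ p) p (ζ_uMap T₂ T₁ p))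
        (uMap' T₂ T₁ p) (ζ_uMap' T₂ T₁ p).symm) rfl rfl fun a => ?_
      have h₁ := d_self h (z := uMap T₂ T₁ p) rfl a
      exact (congrArg (TensorProduct.map (T₁.β w₁) (T₂.β w₂)) h₁.symm).trans
        (d_self h' (z := uMap' T₂ T₁ p) rfl _).symm

lemma assoc_val {D'' : OneMorData G₃ G₄} {D' : OneMorData G₂ G₃} {D : OneMorData G₁ G₂}
    (h : (D''.comp (D'.comp D)).IsOneMor) (z : ((D''.comp D').comp D).Z) :
    (Triple.assoc D'' D' D).Val z (assocMap D'' D' D z) (assocFib D'' D' D z).toLinearMap :=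
  val_of_eq (T := Triple.assoc D'' D' D) (fp.mk z (assocMap D'' D' D z) rfl) rfl rfl fun _ =>
    (d_self h (z := assocMap D'' D' D z) rfl _).symm

/-- Over the point `(y, y)` of the identity, an element of `L` is `t(k) e`. Since `e` acts trivially
on `a`, the characterisation `lam_act` leaves only the scalar `t(k)`. -/
lemma lam_val {D : OneMorData G₁ G₂} (hD : D.IsOneMor) {z : D.Z} {y : G₁.Y} (hy : y = D.src z) :
    (lam D).Val (fp.mk (fp.mk y y rfl) z hy) z (G₁.contractLeft y (D.A.fib z)).toLinearMap := by
  subst hy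
  let w : (lam D).W := fp.mk (fp.mk (fp.mk (D.src z) (D.src z) rfl) z rfl) z rfl
  refine val_of_eq (T := lam D) w rfl rfl ?_
  refine linearMap_eq_of_tmul (V := G₁.Lf (D.src z) (D.src z) rfl) (U := D.A.fib z)
    (G₁.contractLeft (D.src z) (D.A.fib z)).toLinearMap ((lam D).β w) fun k a => ?_
  have h₁ := lam_act D w rfl k a
  have h₂ := ((e_act hD z a).smul_left (G₁.t rfl rfl k)).congr_left (G₁.eq_t_smul_e k).symm
  exact Act.unique (G₂.e_ne_zero _) h₂ h₁

lemma rho_val {D : OneMorData G₁ G₂} (hD : D.IsOneMor) {z : D.Z} {y : G₂.Y} (hy : D.tgt z = y) :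
    (rho D).Val (fp.mk z (fp.mk y y rfl) hy) z (G₂.contractRight y (D.A.fib z)).toLinearMap := by
  subst hy
  let w : (rho D).W := fp.mk (fp.mk z (fp.mk (D.tgt z) (D.tgt z) rfl) rfl) z rfl
  refine val_of_eq (T := rho D) w rfl rfl ?_
  refine linearMap_eq_of_tmul (V := D.A.fib z) (U := G₂.Lf (D.tgt z) (D.tgt z) rfl)
    (G₂.contractRight (D.tgt z) (D.A.fib z)).toLinearMap ((rho D).β w) fun a k => ?_
  have h₁ := rho_act D w rfl a k
  have h₂ := ((e_act hD z a).smul_right (G₂.t rfl rfl k)).congr_right (G₂.eq_t_smul_e k).symm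
  exact Act.unique' (G₁.e_ne_zero _) h₂ h₁

lemma lam_bijective (D : OneMorData G₁ G₂) (w) : Function.Bijective ((lam D).β w) :=
  LinearEquiv.bijective _

lemma rho_bijective (D : OneMorData G₁ G₂) (w) : Function.Bijective ((rho D).β w) :=
  LinearEquiv.bijective _

lemma assoc_bijective (D'' : OneMorData G₃ G₄) (D' : OneMorData G₂ G₃) (D : OneMorData G₁ G₂) (w) :
    Function.Bijective ((Triple.assoc D'' D' D).β w) :=
  (LinearEquiv.bijective ((D''.comp (D'.comp D)).d (z := assocMap D'' D' D (pr₁ w)) (z' := pr₂ w)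
    (fp.cond w))).comp (LinearEquiv.bijective (assocFib D'' D' D (pr₁ w)))

end Triple

/-! ### Identities of tensor products behind the coherence laws -/

section tensor

variable {V V' U U' T T' S L : Type*} [AddCommGroup V] [Module ℂ V] [AddCommGroup V'] [Module ℂ V']
  [AddCommGroup U] [Module ℂ U] [AddCommGroup U'] [Module ℂ U'] [AddCommGroup T] [Module ℂ T]
  [AddCommGroup T'] [Module ℂ T'] [AddCommGroup S] [Module ℂ S]

lemma assoc_symm_natural (f : V →ₗ[ℂ] V') (g : U →ₗ[ℂ] U') (h : T →ₗ[ℂ] T') :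
    (TensorProduct.assoc ℂ V' U' T').symm.toLinearMap ∘ₗ TensorProduct.map f (TensorProduct.map g h)
      = TensorProduct.map (TensorProduct.map f g) h ∘ₗ
        (TensorProduct.assoc ℂ V U T).symm.toLinearMap := by
  refine LinearMap.ext fun w => ?_
  refine tensor_induction₃ (Q := fun w => ((TensorProduct.assoc ℂ V' U' T').symm.toLinearMap ∘ₗ
    TensorProduct.map f (TensorProduct.map g h)) w = (TensorProduct.map (TensorProduct.map f g) h ∘ₗ
        (TensorProduct.assoc ℂ V U T).symm.toLinearMap) w) ?_ ?_ ?_ w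
  · simp only [map_zero]
  · intro a b ha hb
    simp only [map_add, ha, hb]
  · intro v u t
    simp

lemma assoc_symm_pentagon :
    (TensorProduct.assoc ℂ (V ⊗[ℂ] U) T S).symm.toLinearMap ∘ₗ
        (TensorProduct.assoc ℂ V U (T ⊗[ℂ] S)).symm.toLinearMap
      = TensorProduct.map (TensorProduct.assoc ℂ V U T).symm.toLinearMap LinearMap.id ∘ₗ
        ((TensorProduct.assoc ℂ V (U ⊗[ℂ] T) S).symm.toLinearMap ∘ₗ
        TensorProduct.map LinearMap.id (TensorProduct.assoc ℂ U T S).symm.toLinearMap) := by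
  refine TensorProduct.ext' fun v w => ?_
  refine tensor_induction₃ (Q := fun w => (((TensorProduct.assoc ℂ (V ⊗[ℂ] U) T S).symm.toLinearMap ∘ₗ
        (TensorProduct.assoc ℂ V U (T ⊗[ℂ] S)).symm.toLinearMap) (v ⊗ₜ w))
      = (TensorProduct.map (TensorProduct.assoc ℂ V U T).symm.toLinearMap LinearMap.id ∘ₗ
        ((TensorProduct.assoc ℂ V (U ⊗[ℂ] T) S).symm.toLinearMap ∘ₗ
        TensorProduct.map LinearMap.id (TensorProduct.assoc ℂ U T S).symm.toLinearMap)) (v ⊗ₜ w))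
    ?_ ?_ ?_ w
  · simp only [TensorProduct.tmul_zero, map_zero]
  · intro a b ha hb
    simp only [TensorProduct.tmul_add, map_add, ha, hb]
  · intro u t s
    simp

end tensor

namespace BundleGerbe

variable {M : Mfd.{u}} (G : BundleGerbe M) (y : G.Y) {V V' : Type*} [AddCommGroup V] [Module ℂ V]
  [AddCommGroup V'] [Module ℂ V']

lemma contractLeft_natural (f : V →ₗ[ℂ] V') :
    (G.contractLeft y V').toLinearMap ∘ₗ TensorProduct.map LinearMap.id f
      = f ∘ₗ (G.contractLeft y V).toLinearMap :=
  TensorProduct.ext' fun k v => (map_smul f (G.t rfl rfl k) v).symm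

lemma contractRight_natural (f : V →ₗ[ℂ] V') :
    (G.contractRight y V').toLinearMap ∘ₗ TensorProduct.map f LinearMap.id
      = f ∘ₗ (G.contractRight y V).toLinearMap :=
  TensorProduct.ext' fun v k => (map_smul f (G.t rfl rfl k) v).symm

/-- The scalar `t(k)` obtained from the middle factor may be moved to either side of the tensor
product. This is the content of the triangle identity. -/
lemma contractRight_assoc_symm :
    TensorProduct.map (G.contractRight y V).toLinearMap LinearMap.id ∘ₗ
        (TensorProduct.assoc ℂ V (G.Lf y y rfl) V').symm.toLinearMap
      = TensorProduct.map LinearMap.id (G.contractLeft y V').toLinearMap := by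
  refine LinearMap.ext fun w => ?_
  refine tensor_induction₃ (Q := fun w => (TensorProduct.map (G.contractRight y V).toLinearMap
    LinearMap.id ∘ₗ (TensorProduct.assoc ℂ V (G.Lf y y rfl) V').symm.toLinearMap) w
      = TensorProduct.map LinearMap.id (G.contractLeft y V').toLinearMap w) ?_ ?_ ?_ w
  · simp only [map_zero]
  · intro a b ha hb
    simp only [map_add, ha, hb]
  · intro v k u
    simp [contractRight_tmul, contractLeft_tmul, TensorProduct.smul_tmul]

end BundleGerbe

/-! ### The operations on 2-morphisms and their laws -/

section

variable {M : Mfd.{u}} {G₁ G₂ G₃ G₄ G₅ : BundleGerbe M}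

/-- The identity 1-morphism. -/
abbrev OneMor.one (G : BundleGerbe M) : OneMor G G := ⟨OneMorData.one G, OneMorData.one_isOneMor G⟩

/-- The composition of 1-morphisms. -/
abbrev OneMor.comp (A' : OneMor G₂ G₃) (A : OneMor G₁ G₂) : OneMor G₁ G₃ :=
  ⟨A'.1.comp A.1, OneMorData.comp_isOneMor A'.2 A.2⟩

/-- Start with points of `Z₁` and `Z₂` that have the same image in `Y₂`. Points of `Z₁'` and `Z₂'`
chosen over the same images in `P` are then automatically composable. -/
lemma Triple.exists_composable_val {D₁ D₁' : OneMorData G₁ G₂} {D₂ D₂' : OneMorData G₂ G₃}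
    (T₂ : Triple D₂ D₂') (T₁ : Triple D₁ D₁') (m : M) : ∃ z₁ z₁' z₂ z₂' f₁ f₂, D₁.base z₁ = m ∧
      D₁.tgt z₁ = D₂.src z₂ ∧ D₁'.tgt z₁' = D₂'.src z₂' ∧ T₁.Val z₁ z₁' f₁ ∧ T₂.Val z₂ z₂' f₂ := by
  obtain ⟨z₁, hz⟩ := D₁.base_subm.surj m
  obtain ⟨z₂, e⟩ := D₂.src_subm.surj (D₁.tgt z₁)
  obtain ⟨z₁', h₁⟩ := D₁'.hζ.surj (D₁.ζ z₁)
  obtain ⟨z₂', h₂⟩ := D₂'.hζ.surj (D₂.ζ z₂)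
  obtain ⟨f₁, hf₁⟩ := T₁.exists_val h₁.symm
  obtain ⟨f₂, hf₂⟩ := T₂.exists_val h₂.symm
  exact ⟨z₁, z₁', z₂, z₂', f₁, f₂, hz, e.symm, (OneMorData.tgt_eq h₁).trans
    (e.symm.trans (OneMorData.src_eq h₂).symm), hf₁, hf₂⟩

namespace TwoMor

/-- The 2-morphism represented by a triple. -/
def mk {A A' : OneMor G₁ G₂} (T : Triple A.1 A'.1) (hT : T.IsTwoMor) : TwoMor A A' :=
  Quot.mk _ ⟨T, hT⟩

/-- A 2-morphism has the value `f` over the point `(z, z')`. -/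
def Val {A A' : OneMor G₁ G₂} (b : TwoMor A A') (z : A.1.Z) (z' : A'.1.Z)
    (f : A.1.A.fib z →ₗ[ℂ] A'.1.A.fib z') : Prop :=
  Quot.lift (fun T => T.1.Val z z' f) (fun _ _ h => propext ⟨h.val, h.val_symm⟩) b

lemma mk_val {A A' : OneMor G₁ G₂} {T : Triple A.1 A'.1} {hT : T.IsTwoMor} {z : A.1.Z}
    {z' : A'.1.Z} {f : A.1.A.fib z →ₗ[ℂ] A'.1.A.fib z'} (h : T.Val z z' f) :
    (mk T hT).Val z z' f := h

lemma exists_val {A A' : OneMor G₁ G₂} (b : TwoMor A A') {z : A.1.Z} {z' : A'.1.Z}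
    (h : A.1.ζ z = A'.1.ζ z') : ∃ f, b.Val z z' f := by
  induction b using Quot.ind with
  | mk T => exact T.1.exists_val h

/-- All laws below are proved with this criterion: it suffices to exhibit, over each `m`, one point
at which both sides are computed and agree. -/
lemma ext {A A' : OneMor G₁ G₂} {b b' : TwoMor A A'}
    (h : ∀ m, ∃ z z' f, A.1.base z = m ∧ b.Val z z' f ∧ b'.Val z z' f) : b = b' := by
  induction b using Quot.ind with
  | mk T =>
    induction b' using Quot.ind with
    | mk T' => exact Quot.sound (Triple.rel_of_val T.2 T'.2 h)

lemma Val.common {A A' : OneMor G₁ G₂} {b b' : TwoMor A A'} {z : A.1.Z} {z' : A'.1.Z}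
    {f f' : A.1.A.fib z →ₗ[ℂ] A'.1.A.fib z'} {m : M} (h : b.Val z z' f) (h' : b'.Val z z' f')
    (e : f = f') (hz : A.1.base z = m) :
    ∃ z z' f, A.1.base z = m ∧ b.Val z z' f ∧ b'.Val z z' f :=
  ⟨z, z', f, hz, h, e ▸ h'⟩

/-- The identity 2-morphism. -/
def one (A : OneMor G₁ G₂) : TwoMor A A := mk (Triple.one A.1) (Triple.one_isTwoMor A.2)

lemma one_val (A : OneMor G₁ G₂) (z : A.1.Z) : (one A).Val z z LinearMap.id :=
  Triple.one_val A.2 z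

/-- Vertical composition. -/
def vcomp {A A' A'' : OneMor G₁ G₂} (b' : TwoMor A' A'') (b : TwoMor A A') : TwoMor A A'' :=
  Quot.map₂ (fun T' T => ⟨T'.1.vcomp T.1, Triple.vcomp_isTwoMor A.2 A'.2 A''.2 T'.2 T.2⟩)
    -- A value of `T` is also a value of the equivalent triple `S`, so both composites share the
    -- composed value.
    (fun T' T S h => Triple.rel_of_val (Triple.vcomp_isTwoMor A.2 A'.2 A''.2 T'.2 T.2)
      (Triple.vcomp_isTwoMor A.2 A'.2 A''.2 T'.2 S.2) fun m => by
        obtain ⟨z, z', f, hz, hf⟩ := Triple.exists_common_val T.1 m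
        obtain ⟨z'', hz''⟩ := A''.1.hζ.surj (A'.1.ζ z')
        obtain ⟨g, hg⟩ := Triple.exists_val T'.1 hz''.symm
        exact ⟨z, z'', _, hz, hg.vcomp hf, hg.vcomp (h.val hf)⟩)
    (fun T' S' T h => Triple.rel_of_val (Triple.vcomp_isTwoMor A.2 A'.2 A''.2 T'.2 T.2)
      (Triple.vcomp_isTwoMor A.2 A'.2 A''.2 S'.2 T.2) fun m => by
        obtain ⟨z, z', f, hz, hf⟩ := Triple.exists_common_val T.1 m
        obtain ⟨z'', hz''⟩ := A''.1.hζ.surj (A'.1.ζ z')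
        obtain ⟨g, hg⟩ := Triple.exists_val T'.1 hz''.symm
        exact ⟨z, z'', _, hz, hg.vcomp hf, (h.val hg).vcomp hf⟩) b' b

lemma Val.vcomp {A A' A'' : OneMor G₁ G₂} {b' : TwoMor A' A''} {b : TwoMor A A'} {z : A.1.Z}
    {z' : A'.1.Z} {z'' : A''.1.Z} {g : A'.1.A.fib z' →ₗ[ℂ] A''.1.A.fib z''}
    {f : A.1.A.fib z →ₗ[ℂ] A'.1.A.fib z'} (h' : b'.Val z' z'' g) (h : b.Val z z' f) :
    (b'.vcomp b).Val z z'' (g ∘ₗ f) := by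
  induction b using Quot.ind with
  | mk T =>
    induction b' using Quot.ind with
    | mk T' => exact Triple.Val.vcomp (T := T.1) (S := T'.1) h' h

/-- Horizontal composition. -/
def hcomp {A₂ A₂' : OneMor G₂ G₃} {A₁ A₁' : OneMor G₁ G₂} (b₂ : TwoMor A₂ A₂')
    (b₁ : TwoMor A₁ A₁') : TwoMor (A₂.comp A₁) (A₂'.comp A₁') :=
  Quot.map₂ (fun T₂ T₁ => ⟨T₂.1.hcomp T₁.1,
      Triple.hcomp_isTwoMor A₁.2 A₁'.2 A₂.2 A₂'.2 T₂.2 T₁.2⟩)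
    (fun T₂ T₁ S₁ h => Triple.rel_of_val
      (Triple.hcomp_isTwoMor A₁.2 A₁'.2 A₂.2 A₂'.2 T₂.2 T₁.2)
      (Triple.hcomp_isTwoMor A₁.2 A₁'.2 A₂.2 A₂'.2 T₂.2 S₁.2) fun m => by
        obtain ⟨z₁, z₁', z₂, z₂', f₁, f₂, hz, e, e', h₁, h₂⟩ :=
          Triple.exists_composable_val T₂.1 T₁.1 m
        exact ⟨fp.mk z₁ z₂ e, fp.mk z₁' z₂' e', _, hz, h₂.hcomp (A₂.comp A₁).2 (A₂'.comp A₁').2 h₁ e e',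
          h₂.hcomp (A₂.comp A₁).2 (A₂'.comp A₁').2 (h.val h₁) e e'⟩)
    (fun T₂ S₂ T₁ h => Triple.rel_of_val
      (Triple.hcomp_isTwoMor A₁.2 A₁'.2 A₂.2 A₂'.2 T₂.2 T₁.2)
      (Triple.hcomp_isTwoMor A₁.2 A₁'.2 A₂.2 A₂'.2 S₂.2 T₁.2) fun m => by
        obtain ⟨z₁, z₁', z₂, z₂', f₁, f₂, hz, e, e', h₁, h₂⟩ :=
          Triple.exists_composable_val T₂.1 T₁.1 m
        exact ⟨fp.mk z₁ z₂ e, fp.mk z₁' z₂' e', _, hz, h₂.hcomp (A₂.comp A₁).2 (A₂'.comp A₁').2 h₁ e e',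
          (h.val h₂).hcomp (A₂.comp A₁).2 (A₂'.comp A₁').2 h₁ e e'⟩) b₂ b₁

lemma Val.hcomp {A₂ A₂' : OneMor G₂ G₃} {A₁ A₁' : OneMor G₁ G₂} {b₂ : TwoMor A₂ A₂'}
    {b₁ : TwoMor A₁ A₁'} {z₁ : A₁.1.Z} {z₁' : A₁'.1.Z} {z₂ : A₂.1.Z} {z₂' : A₂'.1.Z}
    {f₁ : A₁.1.A.fib z₁ →ₗ[ℂ] A₁'.1.A.fib z₁'} {f₂ : A₂.1.A.fib z₂ →ₗ[ℂ] A₂'.1.A.fib z₂'}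
    (h₂ : b₂.Val z₂ z₂' f₂) (h₁ : b₁.Val z₁ z₁' f₁) (e : A₁.1.tgt z₁ = A₂.1.src z₂)
    (e' : A₁'.1.tgt z₁' = A₂'.1.src z₂') :
    (b₂.hcomp b₁).Val (fp.mk z₁ z₂ e) (fp.mk z₁' z₂' e') (TensorProduct.map f₁ f₂) := by
  induction b₁ using Quot.ind with
  | mk T₁ =>
    induction b₂ using Quot.ind with
    | mk T₂ =>
      exact Triple.Val.hcomp (T₂ := T₂.1) (T₁ := T₁.1) (A₂.comp A₁).2 (A₂'.comp A₁').2 h₂ h₁ e e'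

/-- The associator. -/
def assoc (A'' : OneMor G₃ G₄) (A' : OneMor G₂ G₃) (A : OneMor G₁ G₂) :
    TwoMor ((A''.comp A').comp A) (A''.comp (A'.comp A)) :=
  mk (Triple.assoc A''.1 A'.1 A.1) (Triple.assoc_isTwoMor A''.2 A'.2 A.2)

/-- The left unitor. -/
def lam (A : OneMor G₁ G₂) : TwoMor (A.comp (OneMor.one G₁)) A :=
  mk (Triple.lam A.1) (Triple.lam_isTwoMor A.2)

/-- The right unitor. -/
def rho (A : OneMor G₁ G₂) : TwoMor ((OneMor.one G₂).comp A) A :=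
  mk (Triple.rho A.1) (Triple.rho_isTwoMor A.2)

lemma assoc_val (A'' : OneMor G₃ G₄) (A' : OneMor G₂ G₃) (A : OneMor G₁ G₂) {z : A.1.Z}
    {z' : A'.1.Z} {z'' : A''.1.Z} (e : A.1.tgt z = A'.1.src z') (e' : A'.1.tgt z' = A''.1.src z'') :
    (assoc A'' A' A).Val (fp.mk z (fp.mk z' z'' e') e) (fp.mk (fp.mk z z' e) z'' e')
      (TensorProduct.assoc ℂ (A.1.A.fib z) (A'.1.A.fib z') (A''.1.A.fib z'')).symm.toLinearMap :=
  Triple.assoc_val (A''.comp (A'.comp A)).2 (fp.mk z (fp.mk z' z'' e') e)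

lemma lam_val (A : OneMor G₁ G₂) {z : A.1.Z} {y : G₁.Y} (hy : y = A.1.src z) :
    (lam A).Val (fp.mk (fp.mk y y rfl) z hy) z (G₁.contractLeft y (A.1.A.fib z)).toLinearMap :=
  Triple.lam_val A.2 hy

lemma rho_val (A : OneMor G₁ G₂) {z : A.1.Z} {y : G₂.Y} (hy : A.1.tgt z = y) :
    (rho A).Val (fp.mk z (fp.mk y y rfl) hy) z (G₂.contractRight y (A.1.A.fib z)).toLinearMap :=
  Triple.rho_val A.2 hy

/-- The pointwise inverses form a triple over the same `W`. At suitable points both composites have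
the identity as value, as does the identity 2-morphism. -/
lemma exists_inverse {A A' : OneMor G₁ G₂} (T : Triple A.1 A'.1) (hT : T.IsTwoMor)
    (h : ∀ w, Function.Bijective (T.β w)) :
    ∃ i : TwoMor A' A, vcomp i (mk T hT) = one A ∧ vcomp (mk T hT) i = one A' := by
  refine ⟨mk (T.inv h) (Triple.inv_isTwoMor A.2 A'.2 hT h), ext fun m => ?_, ext fun m => ?_⟩
  · obtain ⟨z, z', f, hz, hf⟩ := Triple.exists_common_val T m
    obtain ⟨k, hk, hkf, hfk⟩ := hf.inv (h := h)
    refine ⟨z, z, LinearMap.id, hz, ?_, one_val A z⟩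
    rw [← hkf]
    exact Val.vcomp (mk_val hk) (mk_val hf)
  · obtain ⟨z', hz'⟩ := A'.1.base_subm.surj m
    obtain ⟨z, hz⟩ := A.1.hζ.surj (A'.1.ζ z')
    obtain ⟨f, hf⟩ := T.exists_val hz
    obtain ⟨k, hk, hkf, hfk⟩ := hf.inv (h := h)
    refine ⟨z', z', LinearMap.id, hz', ?_, one_val A' z'⟩
    rw [← hfk]
    exact Val.vcomp (mk_val hf) (mk_val hk)

lemma assoc_iso (C : OneMor G₃ G₄) (B : OneMor G₂ G₃) (A : OneMor G₁ G₂) :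
    ∃ i, vcomp i (assoc C B A) = one _ ∧ vcomp (assoc C B A) i = one _ :=
  exists_inverse (A := (C.comp B).comp A) (A' := C.comp (B.comp A)) (Triple.assoc C.1 B.1 A.1)
    (Triple.assoc_isTwoMor C.2 B.2 A.2) (Triple.assoc_bijective C.1 B.1 A.1)

lemma lam_iso (A : OneMor G₁ G₂) : ∃ i, vcomp i (lam A) = one _ ∧ vcomp (lam A) i = one _ :=
  exists_inverse (A := A.comp (OneMor.one G₁)) (Triple.lam A.1) (Triple.lam_isTwoMor A.2)
    (Triple.lam_bijective A.1)

lemma rho_iso (A : OneMor G₁ G₂) : ∃ i, vcomp i (rho A) = one _ ∧ vcomp (rho A) i = one _ :=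
  exists_inverse (A := (OneMor.one G₂).comp A) (Triple.rho A.1) (Triple.rho_isTwoMor A.2)
    (Triple.rho_bijective A.1)

lemma exists_val_over {A A' : OneMor G₁ G₂} (b : TwoMor A A') (z : A.1.Z) :
    ∃ z' f, A.1.ζ z = A'.1.ζ z' ∧ b.Val z z' f := by
  obtain ⟨z', h⟩ := A'.1.hζ.surj (A.1.ζ z)
  obtain ⟨f, hf⟩ := b.exists_val h.symm
  exact ⟨z', f, h.symm, hf⟩

lemma vcomp_assoc {A B C E : OneMor G₁ G₂} (b₃ : TwoMor C E) (b₂ : TwoMor B C)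
    (b₁ : TwoMor A B) : vcomp (vcomp b₃ b₂) b₁ = vcomp b₃ (vcomp b₂ b₁) := by
  refine ext fun m => ?_
  obtain ⟨z, hz⟩ := A.1.base_subm.surj m
  obtain ⟨z₁, f₁, -, h₁⟩ := b₁.exists_val_over z
  obtain ⟨z₂, f₂, -, h₂⟩ := b₂.exists_val_over z₁
  obtain ⟨z₃, f₃, -, h₃⟩ := b₃.exists_val_over z₂
  exact ⟨z, z₃, f₃ ∘ₗ f₂ ∘ₗ f₁, hz, (h₃.vcomp h₂).vcomp h₁, h₃.vcomp (h₂.vcomp h₁)⟩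

lemma one_vcomp {A B : OneMor G₁ G₂} (b : TwoMor A B) : vcomp (one B) b = b := by
  refine ext fun m => ?_
  obtain ⟨z, hz⟩ := A.1.base_subm.surj m
  obtain ⟨z', f, -, h⟩ := b.exists_val_over z
  exact ⟨z, z', f, hz, (one_val B z').vcomp h, h⟩

lemma vcomp_one {A B : OneMor G₁ G₂} (b : TwoMor A B) : vcomp b (one A) = b := by
  refine ext fun m => ?_
  obtain ⟨z, hz⟩ := A.1.base_subm.surj m
  obtain ⟨z', f, -, h⟩ := b.exists_val_over z
  exact ⟨z, z', f, hz, h.vcomp (one_val A z), h⟩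

lemma hcomp_one (B : OneMor G₂ G₃) (A : OneMor G₁ G₂) :
    hcomp (one B) (one A) = one (B.comp A) := by
  refine ext fun m => ?_
  obtain ⟨z, hz⟩ := A.1.base_subm.surj m
  obtain ⟨z', hz'⟩ := B.1.src_subm.surj (A.1.tgt z)
  have h := (one_val B z').hcomp (one_val A z) hz'.symm hz'.symm
  exact h.common (one_val (B.comp A) _) TensorProduct.map_id hz

lemma hcomp_vcomp {B B' B'' : OneMor G₂ G₃} {A A' A'' : OneMor G₁ G₂} (c' : TwoMor B' B'')
    (c : TwoMor B B') (b' : TwoMor A' A'') (b : TwoMor A A') :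
    hcomp (vcomp c' c) (vcomp b' b) = vcomp (hcomp c' b') (hcomp c b) := by
  refine ext fun m => ?_
  obtain ⟨z, hz⟩ := A.1.base_subm.surj m
  obtain ⟨x, hx⟩ := B.1.src_subm.surj (A.1.tgt z)
  obtain ⟨z', f, hz', h⟩ := b.exists_val_over z
  obtain ⟨z'', f', hz'', h'⟩ := b'.exists_val_over z'
  obtain ⟨x', g, hx', k⟩ := c.exists_val_over x
  obtain ⟨x'', g', hx'', k'⟩ := c'.exists_val_over x'
  have e := hx.symm
  have e' := (OneMorData.tgt_eq hz').symm.trans (e.trans (OneMorData.src_eq hx'))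
  have e'' := (OneMorData.tgt_eq hz'').symm.trans (e'.trans (OneMorData.src_eq hx''))
  have h₁ := (k'.vcomp k).hcomp (h'.vcomp h) e e''
  -- At these points the interchange law is the functoriality of the tensor product of linear maps.
  exact h₁.common ((k'.hcomp h' e' e'').vcomp (k.hcomp h e e')) (TensorProduct.map_comp f' g' f g) hz

lemma assoc_natural {C C' : OneMor G₃ G₄} {B B' : OneMor G₂ G₃} {A A' : OneMor G₁ G₂}
    (d : TwoMor C C') (c : TwoMor B B') (b : TwoMor A A') :
    vcomp (assoc C' B' A') (hcomp (hcomp d c) b) = vcomp (hcomp d (hcomp c b)) (assoc C B A) := by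
  refine ext fun m => ?_
  obtain ⟨z, hz⟩ := A.1.base_subm.surj m
  obtain ⟨x, hx⟩ := B.1.src_subm.surj (A.1.tgt z)
  obtain ⟨v, hv⟩ := C.1.src_subm.surj (B.1.tgt x)
  obtain ⟨z', f, hz', h⟩ := b.exists_val_over z
  obtain ⟨x', g, hx', k⟩ := c.exists_val_over x
  obtain ⟨v', i, hv', l⟩ := d.exists_val_over v
  have e := hx.symm
  have r := hv.symm
  have e' := (OneMorData.tgt_eq hz').symm.trans (e.trans (OneMorData.src_eq hx'))
  have r' := (OneMorData.tgt_eq hx').symm.trans (r.trans (OneMorData.src_eq hv'))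
  have h₁ := (assoc_val C' B' A' e' r').vcomp ((l.hcomp k r r').hcomp h e e')
  have h₂ := (l.hcomp (k.hcomp h e e') r r').vcomp (assoc_val C B A e r)
  exact h₁.common h₂ (assoc_symm_natural f g i) hz

lemma lam_natural {A A' : OneMor G₁ G₂} (b : TwoMor A A') :
    vcomp (lam A') (hcomp b (one (OneMor.one G₁))) = vcomp b (lam A) := by
  refine ext fun m => ?_
  -- The point of `Y₁` is chosen first, so that `(y, y)` can serve as the point of the identity
  -- 1-morphism, where the unitor is the contraction with `t`.
  obtain ⟨y, hy⟩ := G₁.hπ.surj m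
  obtain ⟨z, hz⟩ := A.1.src_subm.surj y
  obtain ⟨z', f, hz', h⟩ := b.exists_val_over z
  have e := hz.symm
  have e' := e.trans (OneMorData.src_eq hz')
  have h₁ := (lam_val A' e').vcomp (h.hcomp (one_val (OneMor.one G₁) (fp.mk y y rfl)) e e')
  have h₂ := h.vcomp (lam_val A e)
  exact h₁.common h₂ (G₁.contractLeft_natural y f) hy

lemma rho_natural {A A' : OneMor G₁ G₂} (b : TwoMor A A') :
    vcomp (rho A') (hcomp (one (OneMor.one G₂)) b) = vcomp b (rho A) := by
  refine ext fun m => ?_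
  obtain ⟨z, hz⟩ := A.1.base_subm.surj m
  obtain ⟨z', f, hz', h⟩ := b.exists_val_over z
  have e' := (OneMorData.tgt_eq hz').symm
  have h₁ := (rho_val A' e').vcomp
    ((one_val (OneMor.one G₂) (fp.mk (A.1.tgt z) (A.1.tgt z) rfl)).hcomp h rfl e')
  have h₂ := h.vcomp (rho_val A (z := z) rfl)
  exact h₁.common h₂ (G₂.contractRight_natural (A.1.tgt z) f) hz

/-- With four points that match successively in the spaces `Y`, all five associators have
rebracketings as values, and the pentagon for tensor products remains. -/
lemma pentagon (E : OneMor G₄ G₅) (C : OneMor G₃ G₄) (B : OneMor G₂ G₃) (A : OneMor G₁ G₂) :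
    vcomp (assoc E C (B.comp A)) (assoc (E.comp C) B A) =
      vcomp (hcomp (one E) (assoc C B A))
        (vcomp (assoc E (C.comp B) A) (hcomp (assoc E C B) (one A))) := by
  refine ext fun m => ?_
  obtain ⟨z, hz⟩ := A.1.base_subm.surj m
  obtain ⟨x, hx⟩ := B.1.src_subm.surj (A.1.tgt z)
  obtain ⟨v, hv⟩ := C.1.src_subm.surj (B.1.tgt x)
  obtain ⟨w, hw⟩ := E.1.src_subm.surj (C.1.tgt v)
  have e := hx.symm
  have r := hv.symm
  have s := hw.symm
  have h₁ := (assoc_val E C (B.comp A) (z := fp.mk z x e) r s).vcomp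
    (assoc_val (E.comp C) B A (z'' := fp.mk v w s) e r)
  have h₂ := ((one_val E w).hcomp (assoc_val C B A e r) s s).vcomp
    ((assoc_val E (C.comp B) A (z' := fp.mk x v r) e s).vcomp
      ((assoc_val E C B r s).hcomp (one_val A z) e e))
  exact h₁.common h₂ assoc_symm_pentagon hz

/-- The middle point is `(y, y)` with `y` the common image in `Y₂` of the outer two points. There
`ρ` and `λ` contract the same factor of `L₂`, from the right and from the left. -/
lemma triangle (A' : OneMor G₂ G₃) (A : OneMor G₁ G₂) :
    vcomp (hcomp (one A') (rho A)) (assoc A' (OneMor.one G₂) A) = hcomp (lam A') (one A) := by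
  refine ext fun m => ?_
  obtain ⟨z, hz⟩ := A.1.base_subm.surj m
  obtain ⟨z', hz'⟩ := A'.1.src_subm.surj (A.1.tgt z)
  have e := hz'.symm
  have h₁ := ((one_val A' z').hcomp (rho_val A (z := z) rfl) e e).vcomp
    (assoc_val A' (OneMor.one G₂) A (z' := fp.mk (A.1.tgt z) (A.1.tgt z) rfl) rfl e)
  have h₂ := (lam_val A' e).hcomp (one_val A z) rfl e
  exact h₁.common h₂ (G₂.contractRight_assoc_symm (A.1.tgt z)) hz

end TwoMor

end

/-- The 2-category of bundle gerbes over `M`. -/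
def twoCategory (M : Mfd.{u}) : TwoCategory (BundleGerbe M) OneMor TwoMor
    (fun G => ⟨OneMorData.one G, OneMorData.one_isOneMor G⟩)
    (fun A' A => ⟨A'.1.comp A.1, OneMorData.comp_isOneMor A'.2 A.2⟩) where
  id₂ := TwoMor.one
  vcomp := TwoMor.vcomp
  hcomp := TwoMor.hcomp
  assoc := TwoMor.assoc
  lam := TwoMor.lam
  rho := TwoMor.rho
  vcomp_assoc := TwoMor.vcomp_assoc
  id_vcomp := TwoMor.one_vcomp
  vcomp_id := TwoMor.vcomp_one
  hcomp_id := TwoMor.hcomp_one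
  hcomp_vcomp := TwoMor.hcomp_vcomp
  assoc_iso := TwoMor.assoc_iso
  assoc_natural := TwoMor.assoc_natural
  lam_iso := TwoMor.lam_iso
  lam_natural := TwoMor.lam_natural
  rho_iso := TwoMor.rho_iso
  rho_natural := TwoMor.rho_natural
  pentagon := TwoMor.pentagon
  triangle := TwoMor.triangle

end BGrb

end

theorem proposition2 (M : BGrb.Mfd.{u}) :
    (∀ (G₁ G₂ : BGrb.BundleGerbe M) (A A' : BGrb.OneMor G₁ G₂),
      Equivalence fun T T' : {T : BGrb.Triple A.1 A'.1 // T.IsTwoMor} => T.1.Rel T'.1) ∧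
    (∀ (G₁ G₂ G₃ G₄ : BGrb.BundleGerbe M) (A'' : BGrb.OneMor G₃ G₄) (A' : BGrb.OneMor G₂ G₃)
      (A : BGrb.OneMor G₁ G₂),
      BGrb.IsStrictIso ((A''.1.comp A'.1).comp A.1) (A''.1.comp (A'.1.comp A.1))
        (BGrb.assocMap A''.1 A'.1 A.1) (BGrb.assocFib A''.1 A'.1 A.1)) ∧
    ∃ (h_one : ∀ G : BGrb.BundleGerbe M, (BGrb.OneMorData.one G).IsOneMor)
      (h_comp : ∀ {G₁ G₂ G₃ : BGrb.BundleGerbe M} (A' : BGrb.OneMor G₂ G₃)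
        (A : BGrb.OneMor G₁ G₂), (A'.1.comp A.1).IsOneMor)
      (B : BGrb.TwoCategory (BGrb.BundleGerbe M) BGrb.OneMor BGrb.TwoMor
        (fun G => ⟨BGrb.OneMorData.one G, h_one G⟩)
        (fun A' A => ⟨A'.1.comp A.1, h_comp A' A⟩)),
      (∀ {G₁ G₂ : BGrb.BundleGerbe M} (A : BGrb.OneMor G₁ G₂),
        BGrb.Rep (B.id₂ A) (BGrb.Triple.one A.1)) ∧
      (∀ {G₁ G₂ : BGrb.BundleGerbe M} {A A' A'' : BGrb.OneMor G₁ G₂}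
        (b' : BGrb.TwoMor A' A'') (b : BGrb.TwoMor A A')
        (T' : BGrb.Triple A'.1 A''.1) (T : BGrb.Triple A.1 A'.1),
        BGrb.Rep b' T' → BGrb.Rep b T → BGrb.Rep (B.vcomp b' b) (T'.vcomp T)) ∧
      (∀ {G₁ G₂ G₃ : BGrb.BundleGerbe M} {A₂ A₂' : BGrb.OneMor G₂ G₃}
        {A₁ A₁' : BGrb.OneMor G₁ G₂} (b₂ : BGrb.TwoMor A₂ A₂') (b₁ : BGrb.TwoMor A₁ A₁')
        (T₂ : BGrb.Triple A₂.1 A₂'.1) (T₁ : BGrb.Triple A₁.1 A₁'.1),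
        BGrb.Rep b₂ T₂ → BGrb.Rep b₁ T₁ → BGrb.Rep (B.hcomp b₂ b₁) (T₂.hcomp T₁)) ∧
      (∀ {G₁ G₂ G₃ G₄ : BGrb.BundleGerbe M} (A'' : BGrb.OneMor G₃ G₄)
        (A' : BGrb.OneMor G₂ G₃) (A : BGrb.OneMor G₁ G₂),
        BGrb.Rep (B.assoc A'' A' A) (BGrb.Triple.assoc A''.1 A'.1 A.1)) ∧
      (∀ {G₁ G₂ : BGrb.BundleGerbe M} (A : BGrb.OneMor G₁ G₂),
        BGrb.Rep (B.lam A) (BGrb.Triple.lam A.1)) ∧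
      (∀ {G₁ G₂ : BGrb.BundleGerbe M} (A : BGrb.OneMor G₁ G₂),
        BGrb.Rep (B.rho A) (BGrb.Triple.rho A.1)) := by
  -- The operations of `twoCategory` were defined on representatives by the prescribed triples, so
  -- the equality of classes in `Rep` holds by definition and only the axioms of these triples have
  -- to be supplied.
  refine ⟨fun _ _ A A' => BGrb.Triple.rel_equivalence A.1 A'.1,
    fun _ _ _ _ A'' A' A => BGrb.OneMorData.assoc_isStrictIso A''.2 A'.2 A.2,
    BGrb.OneMorData.one_isOneMor, fun A' A => BGrb.OneMorData.comp_isOneMor A'.2 A.2,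
    BGrb.twoCategory M, fun A => ⟨BGrb.Triple.one_isTwoMor A.2, rfl⟩, ?_, ?_,
    fun A'' A' A => ⟨BGrb.Triple.assoc_isTwoMor A''.2 A'.2 A.2, rfl⟩,
    fun A => ⟨BGrb.Triple.lam_isTwoMor A.2, rfl⟩, fun A => ⟨BGrb.Triple.rho_isTwoMor A.2, rfl⟩⟩
  · rintro G₁ G₂ A A' A'' _ _ T' T ⟨h', rfl⟩ ⟨h, rfl⟩
    exact ⟨BGrb.Triple.vcomp_isTwoMor A.2 A'.2 A''.2 h' h, rfl⟩
  · rintro G₁ G₂ G₃ A₂ A₂' A₁ A₁' _ _ T₂ T₁ ⟨h₂, rfl⟩ ⟨h₁, rfl⟩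
    exact ⟨BGrb.Triple.hcomp_isTwoMor A₁.2 A₁'.2 A₂.2 A₂'.2 h₂ h₁, rfl⟩
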